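/- **Setting.** A dyadic interval is $I=2^{-j}[m,m+1]$ with $j,m\in\mathbb Z$; $\mathcal D$ is the set of all of them. For intervals $I,J$ put $\operatorname{rdist}(I,J)=\operatorname{diam}(I\cup J)/\max(|I|,|J|)$. For $\psi:\mathbb R\to\mathbb C$ and $I=2^{-j}[m,m+1]$ put $\psi_I(x)=2^{j/2}\psi(2^jx-m)$, and $\langle f,\psi_I\rangle=\int_{\mathbb R} f\,\overline{\psi_I}$. Let $\psi$ be differentiable, such that $(\psi_I)_{I\in\mathcal D}$ is an orthonormal basis of $L^2(\mathbb R)$, and such that $|\psi(x)|\le W(|x|)$ and $|\psi'(x)|\le W(|x|)$ for all $x$, for some decreasing $W:[0,\infty)\to[0,\infty)$ with $\int_0^\infty (1+x)W(x)\,dx<\infty$. $\mathrm{BMO}(\mathbb R)$ is the space of locally integrable $f:\mathbb R\to\mathbb C$ with $\|f\|_{\mathrm{BMO}}=\sup_Q\frac1{|Q|}\int_Q|f-f_Q|<\infty$, where $Q$ runs over the bounded intervals and $f_Q=\frac1{|Q|}\int_Qf$; functions that differ by a constant are identified. $H^1(\mathbb R)$ is the atomic Hardy space of all $g=\sum_i\mu_ia_i$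 with $\sum_i|\mu_i|<\infty$, where each $a_i$ is an atom (supported in a bounded interval $Q$, $\|a_i\|_{L^2}\le|Q|^{-1/2}$, $\int a_i=0$), and $\|g\|_{H^1}$ is the infimum of $\sum_i|\mu_i|$ over all such representations. For $k\in\mathbb Z$, $n\in\mathbb N$, $n\ge1$, and $I\in\mathcal D$ let $I_{k,n}$ be the (finite) family of all $J\in\mathcal D$ with $|I|=2^k|J|$ and $n\le\operatorname{rdist}(I,J)<n+1$, and let $$T_{k,n}f=\sum_{I\in\mathcal D}\ \sum_{J\in I_{k,n}}\langle f,\psi_J\rangle\,\psi_I .$$ **Proposition 3.1.** There is a constant $C>0$, depending only on $\psi$, such that for all $k\in\mathbb Z$ and $n\ge1$: 1. For every $f\in\mathrm{BMO}(\mathbb R)$ the series (over $I$) that defines $T_{k,n}f$ converges unconditionally in the weak* topology $\sigma(\mathrm{BMO}(\mathbb R),H^1(\mathbb R))$ to an element of $\mathrm{BMO}(\mathbb R)$, and $$\|T_{k,n}f\|_{\mathrm{BMO}(\mathbb R)}\le C\,2^{|k|/2}\bigl(\log(n+1)+\max(-k,0)+1\bigr)^{1/2}\|f\|_{\mathrm{BMO}(\mathbb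 R)} .$$ 2. For every $f\in H^1(\mathbb R)$ the series (over $I$) that defines $T_{k,n}f$ converges unconditionally in $H^1(\mathbb R)$, and $$\|T_{k,n}f\|_{H^1(\mathbb R)}\le C\,2^{|k|/2}\bigl(\log(n+1)+\max(k,0)+1\bigr)^{1/2}\|f\|_{H^1(\mathbb R)} .$$ -/

import Mathlib

open MeasureTheory Set Filter Topology
open scoped ENNReal ComplexConjugate

noncomputable section

/-! ### Dyadic intervals -/

/-- The dyadic interval `2^(-scale) [pos, pos + 1]`. -/
structure DyadicInterval where
  scale : ℤ
  pos : ℤ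

namespace DyadicInterval

/-- The length `|I| = 2^(-scale)`. -/
def length (I : DyadicInterval) : ℝ := (2 : ℝ) ^ (-I.scale)

/-- The left end point of `I`. -/
def left (I : DyadicInterval) : ℝ := I.pos * I.length

/-- The right end point of `I`. -/
def right (I : DyadicInterval) : ℝ := (I.pos + 1) * I.length

/-- The interval `I` as a set of real numbers. -/
def toSet (I : DyadicInterval) : Set ℝ := Icc I.left I.right

/-- The relative distance `rdist(I, J) = diam(I ∪ J) / max(|I|, |J|)`. -/
def rdist (I J : DyadicInterval) : ℝ :=
  Metric.diam (I.toSet ∪ J.toSet) / max I.length J.length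

/-- The family `I_{k,n}` of all dyadic intervals `J` with `|I| = 2^k |J|` and
`n ≤ rdist(I, J) < n + 1`. -/
def related (k : ℤ) (n : ℕ) (I : DyadicInterval) : Set DyadicInterval :=
  {J | I.length = (2 : ℝ) ^ k * J.length ∧ (n : ℝ) ≤ rdist I J ∧ rdist I J < n + 1}

theorem length_pos (I : DyadicInterval) : 0 < I.length := by
  unfold length; positivity

theorem left_mem (I : DyadicInterval) : I.left ∈ I.toSet := by
  refine ⟨le_rfl, ?_⟩
  have := I.length_pos
  unfold left right
  nlinarith

theorem related_finite (k : ℤ) (n : ℕ) (I : DyadicInterval) : (related k n I).Finite := by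
  set s : ℤ := I.scale + k with hs
  set l : ℝ := (2 : ℝ) ^ (-s) with hl
  have hl0 : 0 < l := by positivity
  set R : ℝ := (n + 1) * max I.length l with hR
  refine ((Set.finite_Icc ⌊(I.left - R) / l⌋ ⌈(I.left + R) / l⌉).image
    (fun p => (⟨s, p⟩ : DyadicInterval))).subset ?_
  rintro ⟨t, p⟩ ⟨h1, -, h3⟩
  have ht : t = s := by
    simp only [length] at h1
    rw [← zpow_add₀ (by norm_num : (2 : ℝ) ≠ 0)] at h1
    have := zpow_right_injective₀ (by norm_num : (0 : ℝ) < 2) (by norm_num) h1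
    omega
  subst ht
  set J : DyadicInterval := ⟨s, p⟩ with hJ
  have hJl : J.length = l := rfl
  have hb : Bornology.IsBounded (I.toSet ∪ J.toSet) :=
    (Metric.isBounded_Icc _ _).union (Metric.isBounded_Icc _ _)
  have hd := Metric.dist_le_diam_of_mem hb (Or.inr J.left_mem) (Or.inl I.left_mem)
  have hm : 0 < max I.length l := lt_max_of_lt_right hl0
  have h4 : Metric.diam (I.toSet ∪ J.toSet) < R := by
    unfold rdist at h3
    rw [hJl] at h3
    exact (div_lt_iff₀ hm).1 h3
  have h5 : |(p : ℝ) * l - I.left| < R := by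
    have : J.left = p * l := rfl
    rw [← this, ← Real.dist_eq]
    exact hd.trans_lt h4
  rw [abs_lt] at h5
  refine ⟨p, ⟨?_, ?_⟩, rfl⟩
  · have : (I.left - R) / l ≤ p := by
      rw [div_le_iff₀ hl0]; linarith [h5.1]
    exact_mod_cast (Int.floor_le _).trans this
  · have : (p : ℝ) ≤ (I.left + R) / l := by
      rw [le_div_iff₀ hl0]; linarith [h5.2]
    exact_mod_cast this.trans (Int.le_ceil _)

end DyadicInterval

/-! ### Wavelets -/

/-- `ψ_I(x) = 2^(j/2) ψ(2^j x - m)` for `I = 2^(-j) [m, m + 1]`. -/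
def waveletFn (ψ : ℝ → ℂ) (I : DyadicInterval) (x : ℝ) : ℂ :=
  (((2 : ℝ) ^ ((I.scale : ℝ) / 2) : ℝ) : ℂ) * ψ ((2 : ℝ) ^ I.scale * x - I.pos)

/-- The wavelet coefficient `⟨f, ψ_I⟩ = ∫ f(x) conj(ψ_I(x)) dx`. -/
def waveletCoeff (ψ f : ℝ → ℂ) (I : DyadicInterval) : ℂ :=
  ∫ x, f x * conj (waveletFn ψ I x)

/-- Differentiable functions `ψ` such that `(ψ_I)` is an orthonormal basis of `L²(ℝ)` and such that
`ψ` and `ψ'` have a common radial decreasing majorant `W` with `W` and `x W(x)` integrable on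
`[0, ∞)`. -/
structure IsWavelet (ψ : ℝ → ℂ) : Prop where
  differentiable : Differentiable ℝ ψ
  exists_majorant : ∃ W : ℝ → ℝ, AntitoneOn W (Ici 0) ∧ IntegrableOn W (Ici 0) ∧
    IntegrableOn (fun x => x * W x) (Ici 0) ∧
    (∀ x, ‖ψ x‖ ≤ W |x|) ∧ ∀ x, ‖deriv ψ x‖ ≤ W |x|
  exists_basis : ∃ b : HilbertBasis DyadicInterval ℂ (Lp ℂ 2 (volume : Measure ℝ)),
    ∀ I, (b I : ℝ → ℂ) =ᵐ[volume] waveletFn ψ I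

/-! ### The space BMO -/

/-- The `BMO` seminorm: the supremum over all bounded intervals `Q = (c, d]` of
`|Q|⁻¹ ∫_Q |f - f_Q|`, where `f_Q` is the mean of `f` over `Q`. -/
def bmoENorm (f : ℝ → ℂ) : ℝ≥0∞ :=
  ⨆ (c : ℝ) (d : ℝ) (_ : c < d),
    (∫⁻ x in Ioc c d, ‖f x - ⨍ y in Ioc c d, f y‖ₑ) / ENNReal.ofReal (d - c)

/-- `f ∈ BMO(ℝ)`. -/
def MemBMO (f : ℝ → ℂ) : Prop := LocallyIntegrable f ∧ bmoENorm f < ∞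

/-! ### The Hardy space `H¹` -/

/-- An atom of `H¹(ℝ)`: a function supported in a bounded interval `Q`, with
`‖a‖_{L²} ≤ |Q|^(-1/2)` and integral zero. -/
def IsHardyAtom (a : ℝ → ℂ) : Prop :=
  ∃ c d : ℝ, c < d ∧ Function.support a ⊆ Icc c d ∧ MemLp a 2 ∧
    eLpNorm a 2 volume ≤ ENNReal.ofReal ((d - c) ^ (-(1 / 2) : ℝ)) ∧ ∫ x, a x = 0

/-- `g = ∑ i, μ i * a i` (almost everywhere, equivalently in `L¹`) with atoms `a i` and
`∑ i, |μ i| < ∞`. -/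
def IsAtomicDecomposition (g : ℝ → ℂ) (μ : ℕ → ℂ) (a : ℕ → ℝ → ℂ) : Prop :=
  (∀ i, IsHardyAtom (a i)) ∧ Summable (fun i => ‖μ i‖) ∧
    ∀ᵐ x : ℝ, HasSum (fun i => μ i * a i x) (g x)

/-- The norm of `H¹(ℝ)`: the infimum of `∑ i, |μ i|` over all atomic decompositions; it is `∞` if
there is none. -/
def h1ENorm (g : ℝ → ℂ) : ℝ≥0∞ :=
  ⨅ (μ : ℕ → ℂ) (a : ℕ → ℝ → ℂ) (_ : IsAtomicDecomposition g μ a), ∑' i, ‖μ i‖ₑ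

/-- `g ∈ H¹(ℝ)`. -/
def MemH1 (g : ℝ → ℂ) : Prop := h1ENorm g < ∞

/-- `v` is the value of the (bilinear) duality pairing of `b ∈ BMO(ℝ)` and `g ∈ H¹(ℝ)`:
`v = ∑ i, μ i * ∫ b * a i`, whatever atomic decomposition `g = ∑ i, μ i * a i` is used. (The product
`b * g` need not be integrable.) -/
def IsDualPairing (b g : ℝ → ℂ) (v : ℂ) : Prop :=
  ∀ μ a, IsAtomicDecomposition g μ a → HasSum (fun i => μ i * ∫ x, b x * a i x) v

/-! ### The transform -/

/-- The coefficient `∑_{J ∈ I_{k,n}} ⟨f, ψ_J⟩` of `ψ_I` in `T_{k,n} f`. -/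
def transformCoeff (ψ : ℝ → ℂ) (k : ℤ) (n : ℕ) (f : ℝ → ℂ) (I : DyadicInterval) : ℂ :=
  ∑ J ∈ (DyadicInterval.related_finite k n I).toFinset, waveletCoeff ψ f J

/-- `h = T_{k,n} f` in `BMO(ℝ)`: the series `∑_I (∑_{J ∈ I_{k,n}} ⟨f, ψ_J⟩) ψ_I` converges
(unconditionally) to `h` in the weak* topology `σ(BMO(ℝ), H¹(ℝ))`. -/
def IsTransformBMO (ψ : ℝ → ℂ) (k : ℤ) (n : ℕ) (f h : ℝ → ℂ) : Prop :=
  MemBMO h ∧ ∀ g, MemH1 g → ∃ v, IsDualPairing h g v ∧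
    HasSum (fun I => transformCoeff ψ k n f I * ∫ x, waveletFn ψ I x * g x) v

/-- `h = T_{k,n} f` in `H¹(ℝ)`: the series `∑_I (∑_{J ∈ I_{k,n}} ⟨f, ψ_J⟩) ψ_I` converges
(unconditionally) to `h` in the norm of `H¹(ℝ)`. -/
def IsTransformH1 (ψ : ℝ → ℂ) (k : ℤ) (n : ℕ) (f h : ℝ → ℂ) : Prop :=
  MemH1 h ∧ Tendsto (fun F : Finset DyadicInterval =>
    h1ENorm (fun x => h x - ∑ I ∈ F, transformCoeff ψ k n f I * waveletFn ψ I x)) atTop (𝓝 0)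

end

/-! On wavelet coefficients `T_{k,n}` acts as the 0-1 matrix of the relation `J ∈ related k n I`.
Its rows have at most `6 * 2 ^ max k 0` entries and its columns at most `6 * 2 ^ max (-k) 0`, so
Schur's test gives an `ℓ²` bound of order `2 ^ (|k| / 2)`. The work lies in carrying this to `H¹`,
with a loss of only the square root of a logarithm, and then to `BMO` by transposition.

`H¹` is replaced by a sequence space whose atoms are tents: sequences supported on the dyadic
intervals inside `[c, c + L]`, with `ℓ²` norm at most `lam / √L`. Wavelet coefficients of `H¹`
functions are dominated in modulus by countable sums of tents (`IsWavelet.exists_tentBound_coeff`):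
for an atom, Bessel's inequality handles the intervals near its support, and decay, smoothness and
cancellation handle the others. Conversely, finite wavelet sums dominated by tents are controlled in
`H¹` (`IsWavelet.exists_h1ENorm_sum_le`), because a tent synthesises to a molecule, and a molecule
is a telescoping series of atoms. Only moduli matter, so the nonnegative matrix can act on the
dominating tents, and convergence is unconditional.

The core is `IsTent.tentBound_relSum`. For a tent over an interval of length `L`, the entries `J`
with `(n + 1) max(|I|, |J|) ≤ L` keep `I` within the tripled interval and produce one tent. The
other `J` occupy only about `log (n + 1) + max k 0 + 1` scales. At one scale and on one side of `J`,
all the intervals `I` lie in one translated interval, so they form one tent whose mass does not grow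
with `n`. The squares of these masses add up over the scales, and Cauchy–Schwarz turns the number of
scales into its square root.

For `BMO`, the `L²` John–Nirenberg inequality bounds the pairing of `f` with molecules. Testing `f`
on the molecule built from its own coefficients gives a Carleson condition
(`IsWavelet.exists_carleson`), and Carleson sequences pair boundedly with tents. The transposed
matrix belongs to `-k`, which is why `max (-k) 0` appears. The series for `T_{k,n} f` thus defines a
bounded functional on `H¹`. The Riesz theorem in a weighted `L²` represents it by a locally
integrable function (`exists_locallyIntegrable_of_functional`), and testing on atoms shows that this
function is in `BMO`. -/

namespace DyadicInterval

theorem right_eq (I : DyadicInterval) : I.right = I.left + I.length := by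
  unfold right left; ring

theorem left_le_right (I : DyadicInterval) : I.left ≤ I.right := by
  rw [right_eq]; linarith [I.length_pos]

/-- Dyadic intervals are parametrised by scale and position. -/
def equivProd : DyadicInterval ≃ ℤ × ℤ where
  toFun I := (I.scale, I.pos)
  invFun p := ⟨p.1, p.2⟩
  left_inv _ := rfl
  right_inv _ := rfl

instance : Countable DyadicInterval := equivProd.injective.countable

instance : DecidableEq DyadicInterval := equivProd.injective.decidableEq

theorem tsum_eq (g : DyadicInterval → ℝ≥0∞) :
    ∑' I, g I = ∑' s : ℤ, ∑' m : ℤ, g ⟨s, m⟩ := by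
  rw [← equivProd.symm.tsum_eq]
  exact ENNReal.tsum_prod (f := fun s m => g ⟨s, m⟩)

end DyadicInterval

/-! ### Decay, orthonormality and vanishing mean of wavelets -/

theorem waveletFn_eq (ψ : ℝ → ℂ) (I : DyadicInterval) (x : ℝ) :
    waveletFn ψ I x = (((√I.length)⁻¹ : ℝ) : ℂ) * ψ ((x - I.left) / I.length) := by
  have h2 : (0 : ℝ) < 2 := by norm_num
  have h1 : (2 : ℝ) ^ ((I.scale : ℝ) / 2) = (√I.length)⁻¹ := by
    unfold DyadicInterval.length
    rw [Real.sqrt_eq_rpow, ← Real.rpow_intCast, ← Real.rpow_mul h2.le, ← Real.rpow_neg h2.le]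
    congr 1; push_cast; ring
  have h3 : (2 : ℝ) ^ I.scale * x - I.pos = (x - I.left) / I.length := by
    unfold DyadicInterval.left
    rw [eq_div_iff I.length_pos.ne', sub_mul]
    have : (2 : ℝ) ^ I.scale * I.length = 1 := by
      unfold DyadicInterval.length
      rw [← zpow_add₀ h2.ne']; simp
    linear_combination x * this
  unfold waveletFn
  rw [h1, h3]

theorem enorm_sq_eLpNorm_two {α : Type*} [MeasurableSpace α] {μ : Measure α} (f : α → ℂ) :
    eLpNorm f 2 μ ^ 2 = ∫⁻ x, ‖f x‖ₑ ^ 2 ∂μ := by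
  have := eLpNorm_nnreal_pow_eq_lintegral (f := f) (μ := μ) (p := 2) (by norm_num)
  simpa using this

/-- Decay of a wavelet and of its derivative. -/
structure HasDecay (ψ : ℝ → ℂ) (D : ℝ) : Prop where
  pos : 0 < D
  differentiable : Differentiable ℝ ψ
  norm_le : ∀ x, ‖ψ x‖ ≤ D / (2 + |x|) ^ 2
  norm_deriv_le : ∀ x, ‖deriv ψ x‖ ≤ D / (2 + |x|) ^ 2

/-- By monotonicity `y * W y` is at least `(x / 2) * W x` on `(x / 2, x]`, an interval of length `x
/ 2`. This turns the integrability of `x W(x)` into quadratic decay. -/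
theorem sq_mul_le_of_antitoneOn {W : ℝ → ℝ} (hW : AntitoneOn W (Ici 0))
    (h0 : ∀ x, 0 ≤ x → 0 ≤ W x) (hi : IntegrableOn (fun x => x * W x) (Ici 0)) {x : ℝ}
    (hx : 0 ≤ x) : x ^ 2 * W x ≤ 4 * ∫ y in Ici 0, y * W y := by
  have hsub : Ioc (x / 2) x ⊆ Ici 0 := fun y hy => by
    have := hy.1; simp only [mem_Ici]; linarith
  have h1 : (x / 2 * W x) * volume.real (Ioc (x / 2) x) ≤ ∫ y in Ioc (x / 2) x, y * W y := by
    refine setIntegral_ge_of_const_le_real measurableSet_Ioc (by simp) ?_ (hi.mono_set hsub)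
    intro y hy
    have h3 : W x ≤ W y := hW (hsub hy) hx hy.2
    exact mul_le_mul hy.1.le h3 (h0 x hx) (hsub hy)
  have h2 : ∫ y in Ioc (x / 2) x, y * W y ≤ ∫ y in Ici 0, y * W y := by
    refine setIntegral_mono_set hi ?_ (Eventually.of_forall hsub)
    filter_upwards [ae_restrict_mem measurableSet_Ici] with y hy
    exact mul_nonneg hy (h0 y hy)
  have h4 : volume.real (Ioc (x / 2) x) = x / 2 := by
    rw [Real.volume_real_Ioc_of_le (by linarith)]; ring
  rw [h4] at h1
  nlinarith

theorem IsWavelet.exists_decay {ψ : ℝ → ℂ} (hψ : IsWavelet ψ) : ∃ D, HasDecay ψ D := by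
  obtain ⟨W, hW, -, hi, h1, h2⟩ := hψ.exists_majorant
  have h0 : ∀ x, 0 ≤ x → 0 ≤ W x := fun x hx => by
    have := (norm_nonneg _).trans (h1 x)
    rwa [abs_of_nonneg hx] at this
  set B := ∫ y in Ici 0, y * W y with hB
  have hB0 : 0 ≤ B := by
    have := sq_mul_le_of_antitoneOn hW h0 hi le_rfl
    simp only [← hB] at this
    linarith
  -- The constant comes from `(2 + |x|)² ≤ 8 + 2 |x|²` together with `W |x| ≤ W 0` and `|x|² W |x| ≤
  -- 4 B`; the final `1` makes it positive.
  have key : ∀ x : ℝ, W |x| ≤ (8 * W 0 + 8 * B + 1) / (2 + |x|) ^ 2 := fun x => by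
    have h3 := sq_mul_le_of_antitoneOn hW h0 hi (abs_nonneg x)
    have h4 : W |x| ≤ W 0 := hW (by simp) (abs_nonneg x : (0:ℝ) ≤ |x|) (abs_nonneg x)
    have h5 := h0 _ (abs_nonneg x)
    simp only [← hB] at h3
    rw [le_div_iff₀ (by positivity)]
    nlinarith [mul_nonneg h5 (sq_nonneg (|x| - 2))]
  have := h0 0 le_rfl
  exact ⟨8 * W 0 + 8 * B + 1, by positivity, hψ.differentiable,
    fun x => (h1 x).trans (key x), fun x => (h2 x).trans (key x)⟩

namespace HasDecay

variable {ψ : ℝ → ℂ} {D : ℝ}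

theorem norm_waveletFn_le (h : HasDecay ψ D) (I : DyadicInterval) (x : ℝ) :
    √I.length * ‖waveletFn ψ I x‖ ≤ D / (2 + |x - I.left| / I.length) ^ 2 := by
  have hr := I.length_pos
  have hs : 0 < √I.length := Real.sqrt_pos.2 hr
  rw [waveletFn_eq, norm_mul, Complex.norm_real, norm_inv, Real.norm_of_nonneg hs.le,
    mul_inv_cancel_left₀ hs.ne']
  refine (h.norm_le _).trans_eq ?_
  rw [abs_div, abs_of_pos hr]

/-- Mean value inequality after rescaling `I` to unit length. The summand `2` in `HasDecay` leaves
room for a lower bound `z` of `1 + |t|`, rather than of `|t|`, on the whole segment. -/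
theorem norm_waveletFn_sub_le (h : HasDecay ψ D) (I : DyadicInterval) {x y : ℝ} {z : ℝ}
    (hz : 0 ≤ z) (hxy : ∀ t ∈ uIcc x y, z ≤ 1 + |t - I.left| / I.length) :
    √I.length * ‖waveletFn ψ I x - waveletFn ψ I y‖ ≤
      D / (1 + z) ^ 2 * (|x - y| / I.length) := by
  have hr := I.length_pos
  have hs : 0 < √I.length := Real.sqrt_pos.2 hr
  rw [waveletFn_eq, waveletFn_eq, ← mul_sub, norm_mul, Complex.norm_real, norm_inv,
    Real.norm_of_nonneg hs.le, mul_inv_cancel_left₀ hs.ne']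
  have hD := h.pos
  have := (convex_uIcc ((y - I.left) / I.length)
    ((x - I.left) / I.length)).norm_image_sub_le_of_norm_deriv_le (𝕜 := ℝ) (f := ψ)
    (C := D / (1 + z) ^ 2) (fun t _ => h.differentiable t) ?_ left_mem_uIcc right_mem_uIcc
  · refine this.trans_eq ?_
    rw [← sub_div, Real.norm_eq_abs, abs_div, abs_of_pos hr]
    congr 3; ring
  · intro t ht
    refine (h.norm_deriv_le t).trans ?_
    have h1 : t * I.length + I.left ∈ uIcc x y := by
      rw [mem_uIcc] at ht ⊢
      rw [div_le_iff₀ hr, le_div_iff₀ hr, div_le_iff₀ hr, le_div_iff₀ hr] at ht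
      rcases ht with ht | ht
      · right; constructor <;> linarith [ht.1, ht.2]
      · left; constructor <;> linarith [ht.1, ht.2]
    have h2 := hxy _ h1
    have h3 : |t * I.length + I.left - I.left| / I.length = |t| := by
      rw [add_sub_cancel_right, abs_mul, abs_of_pos hr, mul_div_cancel_right₀ _ hr.ne']
    rw [h3] at h2
    refine div_le_div_of_nonneg_left hD.le (by positivity) ?_
    exact pow_le_pow_left₀ (by positivity) (by linarith) 2

theorem continuous (h : HasDecay ψ D) : Continuous ψ := h.differentiable.continuous

theorem continuous_waveletFn (h : HasDecay ψ D) (I : DyadicInterval) :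
    Continuous (waveletFn ψ I) := by
  have := h.continuous
  unfold waveletFn
  fun_prop

theorem exists_bound_waveletFn (h : HasDecay ψ D) (I : DyadicInterval) :
    ∃ B : ℝ, ∀ x, ‖waveletFn ψ I x‖ ≤ B := by
  have hr := I.length_pos
  have hs : 0 < √I.length := Real.sqrt_pos.2 hr
  refine ⟨D / √I.length, fun x => ?_⟩
  rw [le_div_iff₀ hs, mul_comm]
  refine (h.norm_waveletFn_le I x).trans (div_le_self h.pos.le ?_)
  have : 0 ≤ |x - I.left| / I.length := by positivity
  nlinarith

theorem integrable (h : HasDecay ψ D) : Integrable ψ := by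
  have h1 : Integrable (fun x : ℝ => D * (1 + x ^ 2)⁻¹) := integrable_inv_one_add_sq.const_mul D
  refine h1.mono' h.continuous.aestronglyMeasurable (Eventually.of_forall fun x => ?_)
  refine (h.norm_le x).trans ?_
  rw [div_eq_mul_inv]
  have := h.pos
  gcongr
  nlinarith [abs_nonneg x, sq_abs x]

theorem integrable_waveletFn (h : HasDecay ψ D) (I : DyadicInterval) :
    Integrable (waveletFn ψ I) := by
  have hr := I.length_pos
  have : waveletFn ψ I = fun x => (((√I.length)⁻¹ : ℝ) : ℂ) * ψ ((x - I.left) / I.length) :=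
    funext (waveletFn_eq ψ I)
  rw [this]
  exact (((h.integrable.comp_div hr.ne').comp_sub_right I.left)).const_mul _

end HasDecay

namespace IsWavelet

variable {ψ : ℝ → ℂ}

theorem memLp_waveletFn (hψ : IsWavelet ψ) (I : DyadicInterval) :
    MemLp (waveletFn ψ I) 2 := by
  obtain ⟨b, hb⟩ := hψ.exists_basis
  exact (Lp.memLp (b I)).ae_eq (hb I)

theorem inner_eq_waveletCoeff {b : HilbertBasis DyadicInterval ℂ (Lp ℂ 2 (volume : Measure ℝ))}
    (hb : ∀ I, (b I : ℝ → ℂ) =ᵐ[volume] waveletFn ψ I) {g : ℝ → ℂ} (hg : MemLp g 2)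
    (I : DyadicInterval) : inner ℂ (b I) (hg.toLp g) = waveletCoeff ψ g I := by
  rw [L2.inner_def]
  refine integral_congr_ae ?_
  filter_upwards [hb I, hg.coeFn_toLp] with x h1 h2
  rw [h1, h2, RCLike.inner_apply]

theorem bessel (hψ : IsWavelet ψ) {g : ℝ → ℂ} (hg : MemLp g 2) :
    ∑' I, ‖waveletCoeff ψ g I‖ₑ ^ 2 ≤ ∫⁻ x, ‖g x‖ₑ ^ 2 := by
  obtain ⟨b, hb⟩ := hψ.exists_basis
  rw [ENNReal.tsum_eq_iSup_sum]
  refine iSup_le fun F => ?_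
  have h1 := b.orthonormal.sum_inner_products_le (s := F) (hg.toLp g)
  rw [← enorm_sq_eLpNorm_two]
  have h2 : ‖hg.toLp g‖ = (eLpNorm g 2 volume).toReal := Lp.norm_toLp g hg
  calc ∑ I ∈ F, ‖waveletCoeff ψ g I‖ₑ ^ 2
      = ENNReal.ofReal (∑ I ∈ F, ‖inner ℂ (b I) (hg.toLp g)‖ ^ 2) := by
        rw [ENNReal.ofReal_sum_of_nonneg (fun _ _ => by positivity)]
        refine Finset.sum_congr rfl fun I _ => ?_
        rw [inner_eq_waveletCoeff hb hg, ENNReal.ofReal_pow (norm_nonneg _), ofReal_norm]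
    _ ≤ ENNReal.ofReal ((eLpNorm g 2 volume).toReal ^ 2) := by
        rw [← h2]; exact ENNReal.ofReal_le_ofReal h1
    _ = eLpNorm g 2 volume ^ 2 := by
        rw [ENNReal.ofReal_pow ENNReal.toReal_nonneg, ENNReal.ofReal_toReal hg.eLpNorm_ne_top]

theorem memLp_sum_waveletFn (hψ : IsWavelet ψ) (F : Finset DyadicInterval)
    (u : DyadicInterval → ℂ) : MemLp (fun x => ∑ I ∈ F, u I * waveletFn ψ I x) 2 :=
  memLp_finsetSum F fun I _ => (hψ.memLp_waveletFn I).const_mul (u I)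

theorem lintegral_enorm_sq_sum_waveletFn (hψ : IsWavelet ψ) (F : Finset DyadicInterval)
    (u : DyadicInterval → ℂ) :
    ∫⁻ x, ‖∑ I ∈ F, u I * waveletFn ψ I x‖ₑ ^ 2 = ∑ I ∈ F, ‖u I‖ₑ ^ 2 := by
  obtain ⟨b, hb⟩ := hψ.exists_basis
  have hm := hψ.memLp_sum_waveletFn F u
  have h1 : hm.toLp _ = ∑ I ∈ F, u I • b I := by
    refine Lp.ext ?_
    have h3 : ∀ᵐ x, ∀ I, (u I • b I : Lp ℂ 2 (volume : Measure ℝ)) x = u I * waveletFn ψ I x := by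
      rw [ae_all_iff]
      intro I
      filter_upwards [Lp.coeFn_smul (u I) (b I), hb I] with x h4 h5
      rw [h4, Pi.smul_apply, h5, smul_eq_mul]
    filter_upwards [hm.coeFn_toLp, Lp.coeFn_fun_finsetSum F (fun I => u I • b I), h3]
      with x h4 h5 h6
    rw [h4, h5]
    exact Finset.sum_congr rfl fun I _ => (h6 I).symm
  have h2 : ‖hm.toLp _‖ = (eLpNorm (fun x => ∑ I ∈ F, u I * waveletFn ψ I x) 2 volume).toReal :=
    Lp.norm_toLp _ hm
  have h3 : ‖hm.toLp _‖ ^ 2 = ∑ I ∈ F, ‖u I‖ ^ 2 := by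
    rw [h1]
    have := b.orthonormal.inner_sum u u F
    rw [inner_self_eq_norm_sq_to_K] at this
    have h4 : ((‖∑ I ∈ F, u I • b I‖ ^ 2 : ℝ) : ℂ) = ((∑ I ∈ F, ‖u I‖ ^ 2 : ℝ) : ℂ) := by
      push_cast
      refine this.trans (Finset.sum_congr rfl fun I _ => ?_)
      rw [Complex.conj_mul']
    exact_mod_cast h4
  rw [← enorm_sq_eLpNorm_two, ← ENNReal.ofReal_toReal hm.eLpNorm_ne_top, ← h2,
    ← ENNReal.ofReal_pow (norm_nonneg _), h3, ENNReal.ofReal_sum_of_nonneg (fun _ _ => by positivity)]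
  refine Finset.sum_congr rfl fun I _ => ?_
  rw [ENNReal.ofReal_pow (norm_nonneg _), ofReal_norm]

end IsWavelet

/-- For short intervals well inside `(0, 1]` both limits of integration are far out, so these
coefficients detect the full integral of `ψ`. -/
theorem waveletCoeff_indicator_Ioc (ψ : ℝ → ℂ) (I : DyadicInterval) :
    waveletCoeff ψ ((Ioc 0 1).indicator 1) I =
      conj (((√I.length : ℝ) : ℂ) * ∫ x in -(I.pos : ℝ)..1 / I.length - I.pos, ψ x) := by
  have hr := I.length_pos
  have hs : 0 < √I.length := Real.sqrt_pos.2 hr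
  have h1 : waveletCoeff ψ ((Ioc 0 1).indicator 1) I =
      ∫ x in (0 : ℝ)..1, conj (waveletFn ψ I x) := by
    rw [intervalIntegral.integral_of_le zero_le_one, ← integral_indicator measurableSet_Ioc]
    refine integral_congr_ae (Eventually.of_forall fun x => ?_)
    by_cases hx : x ∈ Ioc (0 : ℝ) 1 <;> simp [hx]
  have h2 : ∀ x, waveletFn ψ I x = (((√I.length)⁻¹ : ℝ) : ℂ) * ψ (x / I.length - I.pos) := by
    intro x
    rw [waveletFn_eq]
    congr 2
    unfold DyadicInterval.left
    field_simp
  rw [h1, intervalIntegral.integral_of_le zero_le_one, integral_conj,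
    ← intervalIntegral.integral_of_le zero_le_one]
  congr 1
  simp_rw [h2]
  rw [intervalIntegral.integral_const_mul, intervalIntegral.integral_comp_div_sub _ hr.ne',
    zero_div, zero_sub, Complex.real_smul, ← mul_assoc, ← Complex.ofReal_mul]
  congr 3
  field_simp
  exact (Real.sq_sqrt hr.le).symm

/-- A wavelet has mean zero. -/
theorem IsWavelet.integral_eq_zero {ψ : ℝ → ℂ} (hψ : IsWavelet ψ) : ∫ x, ψ x = 0 := by
  -- If the integral `α` were nonzero, at every fine scale at least half of the `P = 1 / |I|`
  -- intervals in `(0, 1]` would have a coefficient of size at least `√|I| ‖α‖ / 2`. Each of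
  -- infinitely many scales would then contribute at least `‖α‖² / 8`, contradicting Bessel's
  -- inequality for the indicator of `(0, 1]`.
  by_contra hα
  set α := ∫ x, ψ x with hαdef
  have hα0 : 0 < ‖α‖ := norm_pos_iff.2 hα
  obtain ⟨D, hD⟩ := hψ.exists_decay
  have hlim : Tendsto (fun p : ℝ × ℝ => ∫ x in -p.1..p.2, ψ x) atTop (𝓝 α) := by
    rw [← prod_atTop_atTop_eq]
    exact intervalIntegral_tendsto_integral hD.integrable
      (tendsto_neg_atTop_atBot.comp tendsto_fst) tendsto_snd
  obtain ⟨⟨R₁, R₂⟩, hR⟩ := eventually_atTop.1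
    (hlim.eventually (Metric.ball_mem_nhds α (half_pos hα0)))
  obtain ⟨N, hN⟩ := exists_nat_ge (max R₁ R₂)
  have hN' : ∀ a b : ℝ, N ≤ a → N ≤ b → ‖α‖ / 2 ≤ ‖∫ x in -a..b, ψ x‖ := by
    intro a b ha hb
    have := hR (a, b) ⟨(le_max_left _ _).trans (hN.trans ha), (le_max_right _ _).trans (hN.trans hb)⟩
    rw [dist_eq_norm, ← norm_neg, neg_sub] at this
    have h2 := norm_sub_norm_le α (∫ x in -a..b, ψ x)
    simp only at this
    linarith
  have hmem : MemLp ((Ioc (0 : ℝ) 1).indicator (1 : ℝ → ℂ)) 2 :=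
    memLp_indicator_const 2 measurableSet_Ioc 1 (Or.inr (by simp))
  have hb := hψ.bessel hmem
  have hfin : ∫⁻ x, ‖(Ioc (0 : ℝ) 1).indicator (1 : ℝ → ℂ) x‖ₑ ^ 2 < ∞ := by
    rw [← enorm_sq_eLpNorm_two]
    exact ENNReal.pow_lt_top hmem.eLpNorm_lt_top
  -- With `4 * N ≤ P`, discarding about `N` intervals at either end of `(0, 1]` leaves at least `P /
  -- 2` of them.
  obtain ⟨j₀, hj₀⟩ : ∃ j₀ : ℕ, 4 * N ≤ 2 ^ j₀ := ⟨4 * N, Nat.lt_two_pow_self.le⟩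
  have hscale : ∀ j : ℕ, ENNReal.ofReal (‖α‖ ^ 2 / 8) ≤
      ∑' m : ℤ, ‖waveletCoeff ψ ((Ioc (0 : ℝ) 1).indicator 1) ⟨(j₀ + j : ℕ), m⟩‖ₑ ^ 2 := by
    intro j
    set P : ℕ := 2 ^ (j₀ + j) with hP
    have hPN : 4 * N ≤ P := by
      rw [hP, pow_add]
      exact hj₀.trans (Nat.le_mul_of_pos_right _ (by positivity))
    refine le_trans ?_ (ENNReal.sum_le_tsum (Finset.Icc (N : ℤ) (P - N)))
    have hterm : ∀ m ∈ Finset.Icc (N : ℤ) (P - N), ENNReal.ofReal ((P : ℝ)⁻¹ * (‖α‖ / 2) ^ 2) ≤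
        ‖waveletCoeff ψ ((Ioc (0 : ℝ) 1).indicator 1) ⟨(j₀ + j : ℕ), m⟩‖ₑ ^ 2 := by
      intro m hm
      rw [Finset.mem_Icc] at hm
      have hlen : (⟨(j₀ + j : ℕ), m⟩ : DyadicInterval).length = (P : ℝ)⁻¹ := by
        simp only [DyadicInterval.length, hP, zpow_neg, zpow_natCast, Nat.cast_pow, Nat.cast_ofNat]
      rw [← ofReal_norm, ← ENNReal.ofReal_pow (norm_nonneg _)]
      refine ENNReal.ofReal_le_ofReal ?_
      rw [waveletCoeff_indicator_Ioc, RCLike.norm_conj, norm_mul, Complex.norm_real,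
        Real.norm_of_nonneg (Real.sqrt_nonneg _), mul_pow, hlen, Real.sq_sqrt (by positivity)]
      gcongr
      refine hN' _ _ (by exact_mod_cast hm.1) ?_
      have h3 : ((m : ℤ) : ℝ) ≤ P - N := by exact_mod_cast hm.2
      rw [one_div, inv_inv]
      linarith
    refine le_trans ?_ (Finset.sum_le_sum hterm)
    rw [Finset.sum_const, nsmul_eq_mul, ← ENNReal.ofReal_natCast,
      ← ENNReal.ofReal_mul (by positivity)]
    refine ENNReal.ofReal_le_ofReal ?_
    have hP0 : (0 : ℝ) < P := by rw [hP]; positivity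
    have hcard : (P : ℝ) / 2 ≤ ((Finset.Icc (N : ℤ) (P - N)).card : ℝ) := by
      rw [Int.card_Icc]
      have h4 : ((P : ℤ) - N + 1 - N) = ((P + 1 - 2 * N : ℕ) : ℤ) := by omega
      rw [h4, Int.toNat_natCast, Nat.cast_sub (by omega)]
      have h5 : (4 * N : ℝ) ≤ P := by exact_mod_cast hPN
      push_cast
      linarith
    calc ‖α‖ ^ 2 / 8 = (P : ℝ) / 2 * ((P : ℝ)⁻¹ * (‖α‖ / 2) ^ 2) := by field_simp; norm_num
      _ ≤ _ := by gcongr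
  have htop : ∑' j : ℕ, ENNReal.ofReal (‖α‖ ^ 2 / 8) = ∞ :=
    ENNReal.tsum_const_eq_top_of_ne_zero (by rw [Ne, ENNReal.ofReal_eq_zero]; push Not; positivity)
  rw [DyadicInterval.tsum_eq] at hb
  have hinj : Function.Injective (fun j : ℕ => ((j₀ + j : ℕ) : ℤ)) := fun a b hab => by
    simpa using hab
  have := (ENNReal.tsum_le_tsum hscale).trans (ENNReal.tsum_comp_le_tsum_of_injective hinj
    (fun s : ℤ => ∑' m : ℤ, ‖waveletCoeff ψ ((Ioc (0 : ℝ) 1).indicator 1) ⟨s, m⟩‖ₑ ^ 2))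
  rw [htop] at this
  exact absurd (this.trans hb) (not_le.2 hfin)

theorem IsWavelet.integral_waveletFn {ψ : ℝ → ℂ} (hψ : IsWavelet ψ) (I : DyadicInterval) :
    ∫ x, waveletFn ψ I x = 0 := by
  have hr := I.length_pos
  simp_rw [waveletFn_eq]
  rw [integral_const_mul, integral_sub_right_eq_self (fun x => ψ (x / I.length)) I.left,
    Measure.integral_comp_div, hψ.integral_eq_zero]
  simp

/-! ### The `L²` John–Nirenberg inequality -/

/-- Mean oscillation of `f` about `z` over `(a, b]`. -/
noncomputable def oscAbout (f : ℝ → ℂ) (z : ℂ) (a b : ℝ) : ℝ :=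
  (∫ x in Ioc a b, ‖f x - z‖) / (b - a)

/-- `B` bounds the mean oscillation of `f` over all bounded intervals. -/
def OscBound (f : ℝ → ℂ) (B : ℝ) : Prop :=
  ∀ a b, a < b → oscAbout f (⨍ y in Ioc a b, f y) a b ≤ B

/-- The mean of `|f - z|²` over the `2 ^ m` equal parts of `(a, b]`, with `f` replaced by its means. -/
noncomputable def sqMean (f : ℝ → ℂ) (z : ℂ) : ℕ → ℝ → ℝ → ℝ
  | 0, a, b => ‖(⨍ y in Ioc a b, f y) - z‖ ^ 2
  | m + 1, a, b => (sqMean f z m a ((a + b) / 2) + sqMean f z m ((a + b) / 2) b) / 2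

/-- The function which is equal to the mean of `f` on each of the `2 ^ m` equal parts of `(a, b]`. -/
noncomputable def stepMean (f : ℝ → ℂ) : ℕ → ℝ → ℝ → ℝ → ℂ
  | 0, a, b, _ => ⨍ y in Ioc a b, f y
  | m + 1, a, b, x =>
    if x ≤ (a + b) / 2 then stepMean f m a ((a + b) / 2) x else stepMean f m ((a + b) / 2) b x

section

variable {f : ℝ → ℂ} {a b : ℝ}

theorem MeasureTheory.LocallyIntegrable.integrableOn_Ioc (hf : LocallyIntegrable f) (a b : ℝ) :
    IntegrableOn f (Ioc a b) :=
  (hf.integrableOn_isCompact isCompact_Icc).mono_set Ioc_subset_Icc_self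

theorem average_Ioc_eq (f : ℝ → ℂ) (hab : a < b) :
    ⨍ y in Ioc a b, f y = ((b - a)⁻¹ : ℝ) • ∫ y in Ioc a b, f y := by
  rw [setAverage_eq, Real.volume_real_Ioc_of_le hab.le]

theorem average_Ioc_mid (hf : LocallyIntegrable f) (hab : a < b) :
    ⨍ y in Ioc a b, f y =
      ((⨍ y in Ioc a ((a + b) / 2), f y) + ⨍ y in Ioc ((a + b) / 2) b, f y) / 2 := by
  have h1 : a < (a + b) / 2 := by linarith
  have h2 : (a + b) / 2 < b := by linarith
  rw [average_Ioc_eq f hab, average_Ioc_eq f h1, average_Ioc_eq f h2,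
    ← Ioc_union_Ioc_eq_Ioc h1.le h2.le, setIntegral_union (Ioc_disjoint_Ioc_of_le le_rfl)
      measurableSet_Ioc (hf.integrableOn_Ioc _ _) (hf.integrableOn_Ioc _ _)]
  have h3 : (a + b) / 2 - a = (b - a) / 2 := by ring
  have h4 : b - (a + b) / 2 = (b - a) / 2 := by ring
  rw [h3, h4]
  have h5 : (b - a : ℂ) ≠ 0 := by exact_mod_cast (sub_pos.2 hab).ne'
  simp only [Complex.real_smul]
  push_cast
  field_simp

theorem oscAbout_mid (hf : LocallyIntegrable f) (z : ℂ) (hab : a < b) :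
    oscAbout f z a b =
      (oscAbout f z a ((a + b) / 2) + oscAbout f z ((a + b) / 2) b) / 2 := by
  have h1 : a < (a + b) / 2 := by linarith
  have h2 : (a + b) / 2 < b := by linarith
  have hi : ∀ c d, IntegrableOn (fun x => ‖f x - z‖) (Ioc c d) := fun c d =>
    ((hf.integrableOn_Ioc c d).sub (integrableOn_const (by simp))).norm
  unfold oscAbout
  rw [← Ioc_union_Ioc_eq_Ioc h1.le h2.le, setIntegral_union (Ioc_disjoint_Ioc_of_le le_rfl)
      measurableSet_Ioc (hi _ _) (hi _ _)]
  have h3 : (a + b) / 2 - a = (b - a) / 2 := by ring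
  have h4 : b - (a + b) / 2 = (b - a) / 2 := by ring
  rw [h3, h4]
  have h5 : b - a ≠ 0 := (sub_pos.2 hab).ne'
  field_simp

theorem oscAbout_nonneg (z : ℂ) (hab : a < b) : 0 ≤ oscAbout f z a b :=
  div_nonneg (integral_nonneg fun _ => norm_nonneg _) (sub_pos.2 hab).le

theorem norm_average_sub_le (hf : LocallyIntegrable f) (z : ℂ) (hab : a < b) :
    ‖(⨍ y in Ioc a b, f y) - z‖ ≤ oscAbout f z a b := by
  have hba := sub_pos.2 hab
  have h1 : (⨍ y in Ioc a b, f y) - z = ((b - a)⁻¹ : ℝ) • ∫ y in Ioc a b, (f y - z) := by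
    rw [integral_sub (hf.integrableOn_Ioc _ _) (integrableOn_const (by simp)), smul_sub,
      ← average_Ioc_eq f hab, setIntegral_const, Real.volume_real_Ioc_of_le hab.le, smul_smul,
      inv_mul_cancel₀ hba.ne', one_smul]
  rw [h1, norm_smul, norm_inv, Real.norm_of_nonneg hba.le, oscAbout, div_eq_inv_mul]
  gcongr
  exact norm_integral_le_integral_norm _

/-- The variance does not depend on the centre. At each halving this is the parallelogram law, whose
correction `‖p - q‖² / 4` is the same for all centres. It allows recentring at the mean of a
subinterval. -/
theorem sqMean_sub_eq (hf : LocallyIntegrable f) (z w : ℂ) (m : ℕ) : ∀ {a b : ℝ}, a < b →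
    sqMean f z m a b - ‖(⨍ y in Ioc a b, f y) - z‖ ^ 2 =
      sqMean f w m a b - ‖(⨍ y in Ioc a b, f y) - w‖ ^ 2 := by
  induction m with
  | zero => intro a b _; simp [sqMean]
  | succ m ih =>
    intro a b hab
    have h1 := ih (a := a) (b := (a + b) / 2) (by linarith)
    have h2 := ih (a := (a + b) / 2) (b := b) (by linarith)
    rw [average_Ioc_mid hf hab]
    simp only [sqMean]
    set p := ⨍ y in Ioc a ((a + b) / 2), f y
    set q := ⨍ y in Ioc ((a + b) / 2) b, f y
    have h3 : ∀ v : ℂ, ‖(p + q) / 2 - v‖ ^ 2 =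
        (‖p - v‖ ^ 2 + ‖q - v‖ ^ 2) / 2 - ‖p - q‖ ^ 2 / 4 := by
      intro v
      simp only [← Complex.normSq_eq_norm_sq, Complex.normSq_apply, Complex.sub_re, Complex.sub_im,
        Complex.add_re, Complex.add_im, Complex.div_ofNat_re, Complex.div_ofNat_im]
      ring
    rw [h3 z, h3 w]
    linarith

theorem sqMean_eq_add (hf : LocallyIntegrable f) (z : ℂ) (m : ℕ) (hab : a < b) :
    sqMean f z m a b = sqMean f (⨍ y in Ioc a b, f y) m a b +
      ‖(⨍ y in Ioc a b, f y) - z‖ ^ 2 := by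
  have := sqMean_sub_eq hf z (⨍ y in Ioc a b, f y) m hab
  simp only [sub_self, norm_zero] at this
  linarith

/-- The stopping time argument of John and Nirenberg. -/
theorem sqMean_le (hf : LocallyIntegrable f) {B : ℝ} (hB : OscBound f B) (m : ℕ) :
    (∀ a b z, a < b → oscAbout f z a b ≤ 2 * B →
      sqMean f z m a b ≤ 4 * B ^ 2 + 16 * B * oscAbout f z a b) ∧
    ∀ a b, a < b → sqMean f (⨍ y in Ioc a b, f y) m a b ≤ 20 * B ^ 2 := by
  have hB0 : 0 ≤ B := (oscAbout_nonneg _ zero_lt_one).trans (hB 0 1 zero_lt_one)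
  have key : (∀ a b z, a < b → oscAbout f z a b ≤ 2 * B →
      sqMean f z m a b ≤ 4 * B ^ 2 + 16 * B * oscAbout f z a b) →
      ∀ a b, a < b → sqMean f (⨍ y in Ioc a b, f y) m a b ≤ 20 * B ^ 2 := by
    intro h a b hab
    have h1 := hB a b hab
    have := h a b _ hab (h1.trans (by linarith))
    nlinarith
  suffices h : ∀ a b z, a < b → oscAbout f z a b ≤ 2 * B →
      sqMean f z m a b ≤ 4 * B ^ 2 + 16 * B * oscAbout f z a b from ⟨h, key h⟩
  clear key
  induction m with
  | zero =>
    intro a b z hab h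
    have h1 := norm_average_sub_le hf z hab
    have h2 := norm_nonneg ((⨍ y in Ioc a b, f y) - z)
    simp only [sqMean]
    nlinarith
  | succ m ih =>
    have ih2 : ∀ a b, a < b → sqMean f (⨍ y in Ioc a b, f y) m a b ≤ 20 * B ^ 2 := by
      intro a b hab
      have h1 := hB a b hab
      have := ih a b _ hab (h1.trans (by linarith))
      nlinarith
    intro a b z hab h
    -- A half can have oscillation up to `4 * B`, outside the range of the induction hypothesis.
    -- Once the oscillation `o` exceeds `2 * B` the square mean is recentred: it is at most `20 B² +
    -- o² ≤ 20 B² + 4 B o`, which is below `4 B² + 16 B o` since `o > 2 B`.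
    have step : ∀ c d, c < d → oscAbout f z c d ≤ 4 * B →
        sqMean f z m c d ≤ 4 * B ^ 2 + 16 * B * oscAbout f z c d := by
      intro c d hcd h4
      rcases le_or_gt (oscAbout f z c d) (2 * B) with h5 | h5
      · exact ih c d z hcd h5
      · rw [sqMean_eq_add hf z m hcd]
        have h6 := ih2 c d hcd
        have h7 := (norm_average_sub_le hf z hcd).trans h4
        have h8 := norm_nonneg ((⨍ y in Ioc c d, f y) - z)
        nlinarith
    have h1 : a < (a + b) / 2 := by linarith
    have h2 : (a + b) / 2 < b := by linarith
    have h3 := oscAbout_mid hf z hab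
    have h5 := oscAbout_nonneg (f := f) z h1
    have h6 := oscAbout_nonneg (f := f) z h2
    have h7 := step _ _ h1 (by linarith)
    have h8 := step _ _ h2 (by linarith)
    -- The bound is affine in the oscillation, so averaging it over the two halves reproduces it
    -- exactly and nothing is lost in the induction.
    simp only [sqMean]
    rw [h3]
    linarith

theorem measurable_stepMean (f : ℝ → ℂ) (m : ℕ) : ∀ a b, Measurable (stepMean f m a b) := by
  induction m with
  | zero => intro a b; exact measurable_const
  | succ m ih =>
    intro a b
    exact Measurable.ite measurableSet_Iic (ih _ _) (ih _ _)

theorem lintegral_stepMean (f : ℝ → ℂ) (z : ℂ) (m : ℕ) : ∀ a b, a < b →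
    ∫⁻ x in Ioc a b, ‖stepMean f m a b x - z‖ₑ ^ 2 =
      ENNReal.ofReal ((b - a) * sqMean f z m a b) := by
  have hnn : ∀ m a b, 0 ≤ sqMean f z m a b := by
    intro m
    induction m with
    | zero => intro a b; simp only [sqMean]; positivity
    | succ m ih => intro a b; simp only [sqMean]; linarith [ih a ((a + b) / 2), ih ((a + b) / 2) b]
  induction m with
  | zero =>
    intro a b hab
    simp only [stepMean, sqMean, setLIntegral_const, Real.volume_Ioc]
    rw [ENNReal.ofReal_mul (sub_pos.2 hab).le, mul_comm, ENNReal.ofReal_pow (norm_nonneg _),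
      ofReal_norm]
  | succ m ih =>
    intro a b hab
    have h1 : a < (a + b) / 2 := by linarith
    have h2 : (a + b) / 2 < b := by linarith
    have e1 : ∫⁻ x in Ioc a ((a + b) / 2), ‖stepMean f (m + 1) a b x - z‖ₑ ^ 2 =
        ∫⁻ x in Ioc a ((a + b) / 2), ‖stepMean f m a ((a + b) / 2) x - z‖ₑ ^ 2 :=
      setLIntegral_congr_fun measurableSet_Ioc fun x hx => by simp [stepMean, hx.2]
    have e2 : ∫⁻ x in Ioc ((a + b) / 2) b, ‖stepMean f (m + 1) a b x - z‖ₑ ^ 2 =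
        ∫⁻ x in Ioc ((a + b) / 2) b, ‖stepMean f m ((a + b) / 2) b x - z‖ₑ ^ 2 :=
      setLIntegral_congr_fun measurableSet_Ioc fun x hx => by simp [stepMean, not_le.2 hx.1]
    rw [← Ioc_union_Ioc_eq_Ioc h1.le h2.le,
      lintegral_union measurableSet_Ioc (Ioc_disjoint_Ioc_of_le le_rfl), e1, e2, ih _ _ h1,
      ih _ _ h2, ← ENNReal.ofReal_add (mul_nonneg (by linarith) (hnn _ _ _))
        (mul_nonneg (by linarith) (hnn _ _ _))]
    congr 1
    simp only [sqMean]
    ring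

/-- Puts the dyadic means into the form required by Lebesgue's differentiation theorem: averages
over shrinking balls that contain `x` without being centred at it. -/
theorem exists_stepMean_eq (f : ℝ → ℂ) (m : ℕ) : ∀ a b x, x ∈ Ioc a b →
    ∃ w, x ∈ Metric.closedBall w ((b - a) / 2 / 2 ^ m) ∧
      stepMean f m a b x = ⨍ y in Metric.closedBall w ((b - a) / 2 / 2 ^ m), f y := by
  induction m with
  | zero =>
    intro a b x hx
    refine ⟨(a + b) / 2, ?_, ?_⟩
    · rw [Real.closedBall_eq_Icc]; constructor <;> linarith [hx.1, hx.2]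
    · rw [Real.closedBall_eq_Icc]
      simp only [stepMean]
      have h1 : (a + b) / 2 - (b - a) / 2 / 2 ^ 0 = a := by ring
      have h2 : (a + b) / 2 + (b - a) / 2 / 2 ^ 0 = b := by ring
      rw [h1, h2]
      exact setAverage_congr Ioc_ae_eq_Icc
  | succ m ih =>
    intro a b x hx
    by_cases h : x ≤ (a + b) / 2
    · obtain ⟨w, h1, h2⟩ := ih a ((a + b) / 2) x ⟨hx.1, h⟩
      have : ((a + b) / 2 - a) / 2 / 2 ^ m = (b - a) / 2 / 2 ^ (m + 1) := by
        rw [pow_succ]; field_simp; ring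
      rw [this] at h1 h2
      exact ⟨w, h1, by simp only [stepMean, h, if_true]; exact h2⟩
    · obtain ⟨w, h1, h2⟩ := ih ((a + b) / 2) b x ⟨not_le.1 h, hx.2⟩
      have : (b - (a + b) / 2) / 2 / 2 ^ m = (b - a) / 2 / 2 ^ (m + 1) := by
        rw [pow_succ]; field_simp; ring
      rw [this] at h1 h2
      exact ⟨w, h1, by simp only [stepMean, h, if_false]; exact h2⟩

theorem ae_tendsto_stepMean (hf : LocallyIntegrable f) (hab : a < b) :
    ∀ᵐ x ∂volume.restrict (Ioc a b), Tendsto (fun m => stepMean f m a b x) atTop (𝓝 (f x)) := by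
  rw [ae_restrict_iff' measurableSet_Ioc]
  filter_upwards [IsUnifLocDoublingMeasure.ae_tendsto_average volume hf 1] with x hx hxab
  choose w hw1 hw2 using fun m => exists_stepMean_eq f m a b x hxab
  simp_rw [hw2]
  have hba := sub_pos.2 hab
  refine hx w _ ?_ (Eventually.of_forall fun m => by rw [one_mul]; exact hw1 m)
  rw [tendsto_nhdsWithin_iff]
  refine ⟨?_, Eventually.of_forall fun m => by simp only [mem_Ioi]; positivity⟩
  exact tendsto_const_nhds.div_atTop (tendsto_pow_atTop_atTop_of_one_lt (by norm_num))

/-- The `L²` form of the John–Nirenberg inequality. -/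
theorem lintegral_sq_sub_average_le (hf : LocallyIntegrable f) {B : ℝ} (hB : OscBound f B)
    (hab : a < b) :
    ∫⁻ x in Ioc a b, ‖f x - ⨍ y in Ioc a b, f y‖ₑ ^ 2 ≤
      ENNReal.ofReal ((b - a) * (20 * B ^ 2)) := by
  set z := ⨍ y in Ioc a b, f y with hz
  -- Fatou's lemma transfers the bound, uniform in `m`, from the step functions to `f`.
  calc ∫⁻ x in Ioc a b, ‖f x - z‖ₑ ^ 2
      ≤ ∫⁻ x in Ioc a b, liminf (fun m => ‖stepMean f m a b x - z‖ₑ ^ 2) atTop := by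
        refine lintegral_mono_ae ?_
        filter_upwards [ae_tendsto_stepMean hf hab] with x hx
        refine (Tendsto.liminf_eq ?_).ge
        have : Continuous fun v : ℂ => ‖v - z‖ₑ ^ 2 := by fun_prop
        exact this.tendsto _ |>.comp hx
    _ ≤ liminf (fun m => ∫⁻ x in Ioc a b, ‖stepMean f m a b x - z‖ₑ ^ 2) atTop :=
        lintegral_liminf_le fun m =>
          (((measurable_stepMean f m a b).sub_const z).enorm.pow_const 2)
    _ ≤ _ := by
        refine liminf_le_of_le (by isBoundedDefault) fun v hv => ?_
        obtain ⟨m, hm⟩ := hv.exists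
        refine hm.trans ?_
        rw [lintegral_stepMean f z m a b hab]
        refine ENNReal.ofReal_le_ofReal ?_
        have := (sqMean_le hf hB m).2 a b hab
        have hba := sub_pos.2 hab
        gcongr

theorem MemBMO.oscBound (hf : MemBMO f) : OscBound f (bmoENorm f).toReal := by
  intro a b hab
  have hba := sub_pos.2 hab
  have hi : IntegrableOn (fun x => f x - ⨍ y in Ioc a b, f y) (Ioc a b) :=
    (hf.1.integrableOn_Ioc a b).sub (integrableOn_const (by simp))
  rw [oscAbout, integral_norm_eq_lintegral_enorm hi.aestronglyMeasurable,
    ← ENNReal.toReal_ofReal hba.le, ← ENNReal.toReal_div]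
  refine ENNReal.toReal_mono hf.2.ne ?_
  exact le_iSup_of_le a (le_iSup_of_le b (le_iSup_of_le hab le_rfl))

end

/-! ### The atomic space `H¹`: countable subadditivity and completeness -/

theorem sq_lintegral_mul_le {α : Type*} [MeasurableSpace α] {μ : Measure α} {f g : α → ℝ≥0∞}
    (hf : AEMeasurable f μ) (hg : AEMeasurable g μ) :
    (∫⁻ x, f x * g x ∂μ) ^ 2 ≤ (∫⁻ x, f x ^ 2 ∂μ) * ∫⁻ x, g x ^ 2 ∂μ := by
  have h := ENNReal.lintegral_mul_le_Lp_mul_Lq μ Real.HolderConjugate.two_two hf hg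
  simp only [Pi.mul_apply, ENNReal.rpow_two] at h
  refine (pow_le_pow_left₀ zero_le h 2).trans_eq ?_
  rw [mul_pow]
  simp only [one_div, ← ENNReal.rpow_two, ← ENNReal.rpow_mul]
  norm_num

theorem ENNReal.sq_tsum_mul_le {ι : Type*} (f g : ι → ℝ≥0∞) :
    (∑' i, f i * g i) ^ 2 ≤ (∑' i, f i ^ 2) * ∑' i, g i ^ 2 := by
  let _ : MeasurableSpace ι := ⊤
  simp only [← lintegral_count]
  exact sq_lintegral_mul_le (measurable_from_top).aemeasurable (measurable_from_top).aemeasurable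

theorem isHardyAtom_zero : IsHardyAtom (0 : ℝ → ℂ) :=
  ⟨0, 1, zero_lt_one, by simp, MemLp.zero, by simp, by simp⟩

theorem IsHardyAtom.lintegral_enorm_le_one {a : ℝ → ℂ} (ha : IsHardyAtom a) :
    ∫⁻ x, ‖a x‖ₑ ≤ 1 := by
  obtain ⟨c, d, hcd, hs, hm, hn, -⟩ := ha
  have hdc := sub_pos.2 hcd
  have h1 : ∫⁻ x, ‖a x‖ₑ = ∫⁻ x in Icc c d, ‖a x‖ₑ * 1 := by
    simp only [mul_one]
    refine (setLIntegral_eq_of_support_subset ?_).symm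
    intro x hx
    exact hs (by simpa using hx)
  have h2 : (∫⁻ x, ‖a x‖ₑ) ^ 2 ≤ 1 := by
    rw [h1]
    refine (sq_lintegral_mul_le hm.1.restrict.enorm aemeasurable_const).trans ?_
    simp only [one_pow, lintegral_const, Measure.restrict_apply_univ, one_mul, Real.volume_Icc]
    calc (∫⁻ x in Icc c d, ‖a x‖ₑ ^ 2) * ENNReal.ofReal (d - c)
        ≤ ENNReal.ofReal ((d - c) ^ (-(1 / 2) : ℝ)) ^ 2 * ENNReal.ofReal (d - c) := by
          gcongr
          refine (setLIntegral_le_lintegral _ _).trans ?_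
          rw [← enorm_sq_eLpNorm_two]
          gcongr
      _ = 1 := by
          rw [← ENNReal.ofReal_pow (by positivity), ← ENNReal.ofReal_mul (by positivity),
            ← Real.rpow_natCast, ← Real.rpow_mul hdc.le]
          norm_num
          rw [Real.rpow_neg_one, inv_mul_cancel₀ hdc.ne']
  rw [← one_pow 2, ENNReal.pow_le_pow_left_iff two_ne_zero] at h2
  exact h2

theorem IsHardyAtom.integrable {a : ℝ → ℂ} (ha : IsHardyAtom a) : Integrable a := by
  have h := ha.lintegral_enorm_le_one
  obtain ⟨c, d, -, -, hm, -, -⟩ := ha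
  exact ⟨hm.1, h.trans_lt ENNReal.one_lt_top⟩

theorem isHardyAtom_div {p : ℝ → ℂ} {c d l : ℝ} (hcd : c < d) (hl : 0 < l)
    (hs : Function.support p ⊆ Icc c d) (hm : AEStronglyMeasurable p)
    (h2 : ∫⁻ x, ‖p x‖ₑ ^ 2 ≤ ENNReal.ofReal (l ^ 2 / (d - c))) (h0 : ∫ x, p x = 0) :
    IsHardyAtom (fun x => ((l⁻¹ : ℝ) : ℂ) * p x) := by
  have hdc := sub_pos.2 hcd
  have hn : eLpNorm (fun x => ((l⁻¹ : ℝ) : ℂ) * p x) 2 volume ≤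
      ENNReal.ofReal ((d - c) ^ (-(1 / 2) : ℝ)) := by
    rw [← ENNReal.pow_le_pow_left_iff two_ne_zero, enorm_sq_eLpNorm_two]
    simp only [enorm_mul, mul_pow]
    rw [lintegral_const_mul' _ _ (by simp)]
    calc ‖((l⁻¹ : ℝ) : ℂ)‖ₑ ^ 2 * ∫⁻ x, ‖p x‖ₑ ^ 2
        ≤ ENNReal.ofReal (l⁻¹) ^ 2 * ENNReal.ofReal (l ^ 2 / (d - c)) := by
          gcongr
          rw [← ofReal_norm, Complex.norm_real, Real.norm_of_nonneg (by positivity)]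
      _ = _ := by
          rw [← ENNReal.ofReal_pow (by positivity), ← ENNReal.ofReal_mul (by positivity),
            ← ENNReal.ofReal_pow (by positivity), ← Real.rpow_natCast ((d - c) ^ (-(1 / 2) : ℝ)) 2,
            ← Real.rpow_mul hdc.le]
          congr 1
          norm_num
          rw [Real.rpow_neg_one]
          field_simp
  refine ⟨c, d, hcd, ?_, ⟨hm.const_mul _, hn.trans_lt ENNReal.ofReal_lt_top⟩, hn, ?_⟩
  · intro x hx
    refine hs ?_
    rw [Function.mem_support] at hx ⊢
    exact right_ne_zero_of_mul hx
  · rw [integral_const_mul, h0, mul_zero]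

theorem ae_summable_norm_of_tsum_lintegral_ne_top {ι : Type*} [Countable ι] {G : ι → ℝ → ℂ}
    (hm : ∀ i, AEStronglyMeasurable (G i)) (h : ∑' i, ∫⁻ x, ‖G i x‖ₑ ≠ ∞) :
    ∀ᵐ x : ℝ, Summable fun i => ‖G i x‖ := by
  rw [← lintegral_tsum fun i => (hm i).enorm] at h
  filter_upwards [ae_lt_top' (AEMeasurable.tsum fun i => (hm i).enorm) h] with x hx
  have := ENNReal.summable_toReal hx.ne
  simpa using this

theorem tsum_lintegral_atoms_le {ι : Type*} {μ : ι → ℂ} {a : ι → ℝ → ℂ}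
    (ha : ∀ i, IsHardyAtom (a i)) : ∑' i, ∫⁻ x, ‖μ i * a i x‖ₑ ≤ ∑' i, ‖μ i‖ₑ := by
  refine ENNReal.tsum_le_tsum fun i => ?_
  simp only [enorm_mul]
  rw [lintegral_const_mul' _ _ enorm_ne_top]
  exact mul_le_of_le_one_right zero_le (ha i).lintegral_enorm_le_one

theorem ae_summable_atoms {ι : Type*} [Countable ι] {μ : ι → ℂ} {a : ι → ℝ → ℂ}
    (ha : ∀ i, IsHardyAtom (a i)) (hμ : ∑' i, ‖μ i‖ₑ ≠ ∞) :
    ∀ᵐ x : ℝ, Summable fun i => ‖μ i * a i x‖ :=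
  ae_summable_norm_of_tsum_lintegral_ne_top (fun i => (ha i).integrable.1.const_mul _)
    (ne_top_of_le_ne_top hμ (tsum_lintegral_atoms_le ha))

theorem summable_norm_iff_tsum_enorm_ne_top {ι : Type*} {μ : ι → ℂ} :
    (Summable fun i => ‖μ i‖) ↔ ∑' i, ‖μ i‖ₑ ≠ ∞ := by
  have := ENNReal.tsum_coe_ne_top_iff_summable (f := fun i => ‖μ i‖₊)
  rw [← NNReal.summable_coe] at this
  exact this.symm

/-- An injection of the index type into `ℕ`, with zero atoms off its range, reduces to the indexing
used in the definition. Decompositions may then be indexed by any countable type, in particular by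
pairs. -/
theorem h1ENorm_le_tsum_of_hasSum {ι : Type*} [Countable ι] {g : ℝ → ℂ} {μ : ι → ℂ}
    {a : ι → ℝ → ℂ} (ha : ∀ i, IsHardyAtom (a i)) (hg : ∀ᵐ x : ℝ, HasSum (fun i => μ i * a i x) (g x)) :
    h1ENorm g ≤ ∑' i, ‖μ i‖ₑ := by
  by_cases hμ : ∑' i, ‖μ i‖ₑ = ∞
  · rw [hμ]; exact le_top
  obtain ⟨e, he⟩ := exists_injective_nat ι
  have hnorm : (fun j => ‖Function.extend e μ 0 j‖ₑ) =
      Function.extend e (fun i => ‖μ i‖ₑ) 0 := by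
    funext j
    by_cases hj : ∃ i, e i = j
    · obtain ⟨i, rfl⟩ := hj
      rw [he.extend_apply, he.extend_apply]
    · rw [Function.extend_apply' _ _ _ hj, Function.extend_apply' _ _ _ hj]
      simp
  have hsum : ∑' j, ‖Function.extend e μ 0 j‖ₑ = ∑' i, ‖μ i‖ₑ := by
    rw [hnorm, tsum_extend_zero he]
  have hd : IsAtomicDecomposition g (Function.extend e μ 0) (Function.extend e a 0) := by
    refine ⟨fun j => ?_, ?_, ?_⟩
    · by_cases hj : ∃ i, e i = j
      · obtain ⟨i, rfl⟩ := hj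
        rw [he.extend_apply]; exact ha i
      · rw [Function.extend_apply' _ _ _ hj]; exact isHardyAtom_zero
    · rw [summable_norm_iff_tsum_enorm_ne_top, hsum]; exact hμ
    · filter_upwards [hg] with x hx
      rw [← hasSum_extend_zero he] at hx
      convert hx using 1
      funext j
      by_cases hj : ∃ i, e i = j
      · obtain ⟨i, rfl⟩ := hj
        rw [he.extend_apply, he.extend_apply, he.extend_apply]
      · rw [Function.extend_apply' _ _ _ hj, Function.extend_apply' _ _ _ hj,
          Function.extend_apply' _ _ _ hj]
        simp
  rw [← hsum]
  exact iInf_le_of_le _ (iInf_le_of_le _ (iInf_le_of_le hd le_rfl))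

theorem exists_atomicDecomposition_lt {g : ℝ → ℂ} {M : ℝ≥0∞} (h : h1ENorm g < M) :
    ∃ μ a, IsAtomicDecomposition g μ a ∧ ∑' i, ‖μ i‖ₑ < M := by
  simpa only [h1ENorm, iInf_lt_iff, exists_prop] using h

theorem lintegral_enorm_le_h1ENorm (g : ℝ → ℂ) : ∫⁻ x, ‖g x‖ₑ ≤ h1ENorm g := by
  refine le_iInf fun μ => le_iInf fun a => le_iInf fun ⟨ha, hμ, hg⟩ => ?_
  refine le_trans ?_ (tsum_lintegral_atoms_le ha)
  rw [← lintegral_tsum fun i => ((ha i).integrable.1.const_mul _).enorm]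
  refine lintegral_mono_ae ?_
  filter_upwards [hg] with x hx
  rw [← hx.tsum_eq]
  exact enorm_tsum_le_tsum_enorm

theorem IsAtomicDecomposition.aestronglyMeasurable {g : ℝ → ℂ} {μ : ℕ → ℂ} {a : ℕ → ℝ → ℂ}
    (h : IsAtomicDecomposition g μ a) : AEStronglyMeasurable g :=
  aestronglyMeasurable_of_tendsto_ae atTop
    (fun n : ℕ => Finset.aestronglyMeasurable_fun_sum (Finset.range n)
      fun i _ => (h.1 i).integrable.1.const_mul (μ i))
    (by filter_upwards [h.2.2] with x hx using hx.tendsto_sum_nat)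

theorem MemH1.integrable {g : ℝ → ℂ} (h : MemH1 g) : Integrable g := by
  obtain ⟨μ, a, hd, -⟩ := exists_atomicDecomposition_lt h
  exact ⟨hd.aestronglyMeasurable, (lintegral_enorm_le_h1ENorm g).trans_lt h⟩

/-- Nearly optimal decompositions, with errors of total at most `ε`, are merged into one family over
`ι × ℕ`. Almost everywhere this double series converges absolutely, so it may be summed row by row,
which identifies its sum with `g`. -/
theorem h1ENorm_le_tsum {ι : Type*} [Countable ι] {G : ι → ℝ → ℂ} {g : ℝ → ℂ}
    (hg : ∀ᵐ x : ℝ, HasSum (fun i => G i x) (g x)) : h1ENorm g ≤ ∑' i, h1ENorm (G i) := by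
  by_cases htop : ∑' i, h1ENorm (G i) = ∞
  · rw [htop]; exact le_top
  refine ENNReal.le_of_forall_pos_le_add fun ε hε _ => ?_
  obtain ⟨δ, hδ, hδε⟩ := ENNReal.exists_pos_sum_of_countable' (ε := ε) (by simpa using hε.ne') ι
  have hi : ∀ i, h1ENorm (G i) < h1ENorm (G i) + δ i := fun i =>
    ENNReal.lt_add_right (ENNReal.ne_top_of_tsum_ne_top htop i) (hδ i).ne'
  choose μ a hd hlt using fun i => exists_atomicDecomposition_lt (hi i)
  have hsum : ∑' p : ι × ℕ, ‖μ p.1 p.2‖ₑ ≤ ∑' i, h1ENorm (G i) + ε := by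
    rw [ENNReal.tsum_prod (f := fun i n => ‖μ i n‖ₑ)]
    refine (ENNReal.tsum_le_tsum fun i => (hlt i).le).trans ?_
    rw [ENNReal.tsum_add]
    gcongr
  refine le_trans (h1ENorm_le_tsum_of_hasSum (fun p : ι × ℕ => (hd p.1).1 p.2) ?_) hsum
  have hfin : ∑' p : ι × ℕ, ‖μ p.1 p.2‖ₑ ≠ ∞ :=
    ne_top_of_le_ne_top (ENNReal.add_ne_top.2 ⟨htop, ENNReal.coe_ne_top⟩) hsum
  filter_upwards [hg, ae_all_iff.2 fun i => (hd i).2.2,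
    ae_summable_atoms (fun p : ι × ℕ => (hd p.1).1 p.2) hfin] with x h1 h2 h3
  have h4 := h3.of_norm.hasSum
  have h5 := h4.prod_fiberwise h2
  rwa [← h1.unique h5] at h4

theorem h1ENorm_add_le (g g' : ℝ → ℂ) :
    h1ENorm (fun x => g x + g' x) ≤ h1ENorm g + h1ENorm g' := by
  have := h1ENorm_le_tsum (ι := Bool) (G := fun b => bif b then g' else g)
    (g := fun x => g x + g' x) (Eventually.of_forall fun x => by
      have := hasSum_fintype fun b : Bool => (bif b then g' else g) x
      simpa [add_comm] using this)
  simpa [tsum_bool, add_comm] using this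

theorem h1ENorm_zero : h1ENorm (fun _ => 0) = 0 := by
  have := h1ENorm_le_tsum_of_hasSum (ι := Empty) (g := fun _ => 0) (μ := fun _ => 0)
    (a := fun _ => 0) (fun i => i.elim) (Eventually.of_forall fun x => hasSum_empty)
  simpa using this

theorem h1ENorm_const_mul_le (z : ℂ) (g : ℝ → ℂ) :
    h1ENorm (fun x => z * g x) ≤ ‖z‖ₑ * h1ENorm g := by
  by_cases hz : z = 0
  · simp [hz, h1ENorm_zero]
  have hz0 : ‖z‖ₑ ≠ 0 := enorm_ne_zero.2 hz
  rw [h1ENorm.eq_def g]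
  simp only [ENNReal.mul_iInf_of_ne hz0 enorm_ne_top]
  refine le_iInf fun μ => le_iInf fun a => le_iInf fun ⟨ha, hμ, hg⟩ => ?_
  rw [← ENNReal.tsum_mul_left]
  simp only [← enorm_mul]
  refine h1ENorm_le_tsum_of_hasSum ha ?_
  filter_upwards [hg] with x hx
  simpa [mul_assoc] using hx.mul_left z

theorem h1ENorm_sub_le (g g' : ℝ → ℂ) :
    h1ENorm (fun x => g x - g' x) ≤ h1ENorm g + h1ENorm g' := by
  have h1 := h1ENorm_add_le g (fun x => -1 * g' x)
  have h2 := h1ENorm_const_mul_le (-1) g'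
  rw [enorm_neg, enorm_one, one_mul] at h2
  simp only [neg_one_mul, ← sub_eq_add_neg] at h1 h2
  exact h1.trans (by gcongr)

theorem h1ENorm_le_of_support_subset {p : ℝ → ℂ} {c d l : ℝ} (hcd : c < d) (hl : 0 < l)
    (hs : Function.support p ⊆ Icc c d) (hm : AEStronglyMeasurable p)
    (h2 : ∫⁻ x, ‖p x‖ₑ ^ 2 ≤ ENNReal.ofReal (l ^ 2 / (d - c))) (h0 : ∫ x, p x = 0) :
    h1ENorm p ≤ ENNReal.ofReal l := by
  have := h1ENorm_le_tsum_of_hasSum (ι := Unit) (g := p) (μ := fun _ => (l : ℂ))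
    (fun _ => isHardyAtom_div hcd hl hs hm h2 h0) (Eventually.of_forall fun x => by
      have := hasSum_unique fun _ : Unit => (l : ℂ) * (((l⁻¹ : ℝ) : ℂ) * p x)
      convert this using 1
      have : (l : ℂ) ≠ 0 := by exact_mod_cast hl.ne'
      push_cast
      field_simp)
  refine this.trans_eq ?_
  rw [tsum_fintype, Finset.univ_unique, Finset.sum_singleton, ← ofReal_norm, Complex.norm_real,
    Real.norm_of_nonneg hl.le]

/-- `H¹` is complete: unconditionally Cauchy series converge. -/
theorem exists_tendsto_h1ENorm {ι : Type*} [DecidableEq ι] {φ : ι → ℝ → ℂ}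
    (hm : ∀ i, AEStronglyMeasurable (φ i))
    (hfin : ∀ F : Finset ι, h1ENorm (fun x => ∑ i ∈ F, φ i x) < ∞)
    (hc : ∀ ε : ℝ≥0∞, ε ≠ 0 → ∃ F₀ : Finset ι, ∀ F, Disjoint F F₀ →
      h1ENorm (fun x => ∑ i ∈ F, φ i x) ≤ ε) :
    ∃ h, MemH1 h ∧
      Tendsto (fun F : Finset ι => h1ENorm fun x => h x - ∑ i ∈ F, φ i x) atTop (𝓝 0) := by
  -- Unconditional Cauchyness gives finite sets beyond which every block has norm at most `2⁻¹ ^ n`.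
  -- Their accumulated unions `F n` are increasing, and the differences of the partial sums along
  -- them are summable in norm.
  choose E hE using fun n : ℕ => hc (2⁻¹ ^ n) (by simp)
  set F : ℕ → Finset ι := fun n => (Finset.range (n + 1)).biUnion E with hF
  have hEF : ∀ n, E n ⊆ F n := fun n =>
    Finset.subset_biUnion_of_mem E (Finset.self_mem_range_succ n)
  have hmono : Monotone F := fun m n hmn =>
    Finset.biUnion_subset_biUnion_of_subset_left _ (Finset.range_mono (by omega))
  set S : Finset ι → ℝ → ℂ := fun G x => ∑ i ∈ G, φ i x with hS
  have hSsub : ∀ {G G' : Finset ι}, G ⊆ G' → ∀ x, S (G' \ G) x = S G' x - S G x := by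
    intro G G' h x
    rw [hS, eq_sub_iff_add_eq]
    exact Finset.sum_sdiff h
  have hFS : ∀ n G, Disjoint G (F n) → h1ENorm (S G) ≤ 2⁻¹ ^ n := fun n G hG =>
    hE n G (hG.mono_right (hEF n))
  set d : ℕ → ℝ → ℂ := fun n x => S (F (n + 1)) x - S (F n) x with hd
  have hd1 : ∀ n, h1ENorm (d n) ≤ 2⁻¹ ^ n := fun n => by
    have : d n = S (F (n + 1) \ F n) := funext fun x => (hSsub (hmono n.le_succ) x).symm
    rw [this]
    exact hFS n _ Finset.sdiff_disjoint
  have hSm : ∀ G, AEStronglyMeasurable (S G) := fun G =>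
    Finset.aestronglyMeasurable_fun_sum G fun i _ => hm i
  have hsummable : ∀ᵐ x : ℝ, Summable fun n => ‖d n x‖ := by
    refine ae_summable_norm_of_tsum_lintegral_ne_top (fun n => (hSm _).sub (hSm _)) ?_
    refine ne_top_of_le_ne_top (b := 2) (by simp) ?_
    rw [← ENNReal.tsum_geometric_two]
    exact ENNReal.tsum_le_tsum fun n => (lintegral_enorm_le_h1ENorm _).trans (hd1 n)
  -- The limit is a pointwise telescoping series, which converges almost everywhere because the `H¹`
  -- norm dominates the `L¹` norm.
  set h : ℝ → ℂ := fun x => S (F 0) x + ∑' n, d n x with hh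
  have htail : ∀ n, h1ENorm (fun x => h x - S (F n) x) ≤ 2⁻¹ ^ n * 2 := fun n => by
    have : ∀ᵐ x : ℝ, HasSum (fun m => d (m + n) x) (h x - S (F n) x) := by
      filter_upwards [hsummable] with x hx
      have h1 := (hasSum_nat_add_iff' n).2 hx.of_norm.hasSum
      have e : h x - S (F n) x = ∑' m, d m x - ∑ m ∈ Finset.range n, d m x := by
        simp only [hh, hd, Finset.sum_range_sub (fun n => S (F n) x)]
        ring
      rw [e]
      exact h1
    refine (h1ENorm_le_tsum this).trans ?_
    calc ∑' m, h1ENorm (d (m + n)) ≤ ∑' m, (2⁻¹ : ℝ≥0∞) ^ n * 2⁻¹ ^ m :=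
          ENNReal.tsum_le_tsum fun m => (hd1 _).trans_eq (by rw [pow_add, mul_comm])
      _ = 2⁻¹ ^ n * 2 := by rw [ENNReal.tsum_mul_left, ENNReal.tsum_geometric_two]
  have hbig : ∀ n G, F n ⊆ G → h1ENorm (fun x => h x - S G x) ≤ 2⁻¹ ^ n * 3 := fun n G hG => by
    have e : (fun x => h x - S G x) = fun x => (h x - S (F n) x) - S (G \ F n) x := by
      funext x
      rw [hSsub hG]; ring
    rw [e]
    refine (h1ENorm_sub_le _ _).trans ?_
    have h3 : (3 : ℝ≥0∞) = 2 + 1 := by norm_num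
    rw [h3, mul_add, mul_one]
    exact add_le_add (htail n) (hFS n _ Finset.sdiff_disjoint)
  refine ⟨h, ?_, ?_⟩
  · have e : h = fun x => (h x - S (F 0) x) + S (F 0) x := by funext x; ring
    rw [MemH1, e]
    refine (h1ENorm_add_le _ _).trans_lt (ENNReal.add_lt_top.2 ⟨?_, hfin _⟩)
    exact (htail 0).trans_lt (by simp)
  · rw [ENNReal.tendsto_nhds_zero]
    intro ε hε
    have hlim : Tendsto (fun n : ℕ => (2⁻¹ : ℝ≥0∞) ^ n * 3) atTop (𝓝 0) := by
      have := ENNReal.Tendsto.mul_const (b := 3)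
        (ENNReal.tendsto_pow_atTop_nhds_zero_of_lt_one (r := 2⁻¹) (by simp)) (Or.inr (by simp))
      simpa using this
    obtain ⟨n, hn⟩ := (ENNReal.tendsto_nhds_zero.1 hlim ε hε).exists
    filter_upwards [eventually_ge_atTop (F n)] with G hG
    exact (hbig n G hG).trans hn

/-- Atoms have `L¹` norm at most one, so an atomic series may be integrated termwise against a
bounded function. Wavelet coefficients of `H¹` functions are thereby reduced to those of atoms. -/
theorem hasSum_integral_mul_atoms {φ : ℝ → ℂ} (hφ : Continuous φ) {B : ℝ} (hB : ∀ x, ‖φ x‖ ≤ B)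
    {g : ℝ → ℂ} {μ : ℕ → ℂ} {a : ℕ → ℝ → ℂ} (h : IsAtomicDecomposition g μ a) :
    HasSum (fun i => μ i * ∫ x, a i x * φ x) (∫ x, g x * φ x) := by
  obtain ⟨ha, hμ, hg⟩ := h
  have hi : ∀ i, Integrable fun x => μ i * (a i x * φ x) := fun i =>
    ((ha i).integrable.mul_bdd (c := B) hφ.aestronglyMeasurable
      (Eventually.of_forall hB)).const_mul _
  have hB0 : 0 ≤ B := (norm_nonneg _).trans (hB 0)
  have h1 : ∀ i, ∫ x, ‖μ i * (a i x * φ x)‖ ≤ ‖μ i‖ * B := fun i => by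
    have h2 : ∫ x, ‖a i x‖ ≤ 1 := by
      rw [integral_norm_eq_lintegral_enorm (ha i).integrable.1]
      exact ENNReal.toReal_le_of_le_ofReal zero_le_one
        (by simpa using (ha i).lintegral_enorm_le_one)
    calc ∫ x, ‖μ i * (a i x * φ x)‖ ≤ ∫ x, ‖μ i‖ * B * ‖a i x‖ := by
          refine integral_mono (hi i).norm ((ha i).integrable.norm.const_mul _) fun x => ?_
          simp only [norm_mul]
          have := hB x
          calc ‖μ i‖ * (‖a i x‖ * ‖φ x‖) ≤ ‖μ i‖ * (‖a i x‖ * B) := by gcongr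
            _ = _ := by ring
      _ = ‖μ i‖ * B * ∫ x, ‖a i x‖ := integral_const_mul _ _
      _ ≤ ‖μ i‖ * B * 1 := by gcongr
      _ = _ := mul_one _
  have hs := hasSum_integral_of_summable_integral_norm (E := ℂ) hi
    (Summable.of_nonneg_of_le (fun i => integral_nonneg fun _ => norm_nonneg _) h1 (hμ.mul_right B))
  simp only [integral_const_mul] at hs
  have e : ∫ x, g x * φ x = ∫ x, ∑' i, μ i * (a i x * φ x) := by
    refine integral_congr_ae ?_
    filter_upwards [hg] with x hx
    rw [← hx.tsum_eq, ← tsum_mul_right]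
    simp only [mul_assoc]
  rw [e]
  exact hs

/-! ### Molecules and their atomic decomposition -/

/-- The interval of radius `2 ^ (j + 1) * L` about `c`. -/
def dilate (c L : ℝ) (j : ℕ) : Set ℝ := Ioc (c - 2 ^ (j + 1) * L) (c + 2 ^ (j + 1) * L)

theorem measurableSet_dilate (c L : ℝ) (j : ℕ) : MeasurableSet (dilate c L j) := measurableSet_Ioc

theorem volume_dilate (c L : ℝ) (j : ℕ) :
    volume (dilate c L j) = ENNReal.ofReal (2 ^ (j + 2) * L) := by
  rw [dilate, Real.volume_Ioc]; congr 1; ring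

theorem dilate_mono {c L : ℝ} (hL : 0 < L) {i j : ℕ} (h : i ≤ j) : dilate c L i ⊆ dilate c L j := by
  have : (2 : ℝ) ^ (i + 1) ≤ 2 ^ (j + 1) := pow_le_pow_right₀ (by norm_num) (by omega)
  refine Ioc_subset_Ioc ?_ ?_ <;> nlinarith

theorem le_abs_of_notMem_dilate {c L x : ℝ} {j : ℕ} (h : x ∉ dilate c L j) :
    2 ^ (j + 1) * L ≤ |x - c| := by
  rw [dilate, mem_Ioc, not_and_or, not_lt, not_le] at h
  rcases h with h | h
  · exact le_trans (by linarith) (neg_le_abs _)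
  · exact le_trans (by linarith) (le_abs_self _)

theorem exists_mem_dilate {c L : ℝ} (hL : 0 < L) (x : ℝ) : ∃ j, x ∈ dilate c L j := by
  obtain ⟨j, hj⟩ := pow_unbounded_of_one_lt (|x - c| / L) (by norm_num : (1 : ℝ) < 2)
  refine ⟨j, ?_⟩
  by_contra h
  have h1 := le_abs_of_notMem_dilate h
  rw [div_lt_iff₀ hL] at hj
  rw [pow_succ] at h1
  have : 0 < (2 : ℝ) ^ j * L := by positivity
  linarith

theorem compl_dilate_subset {c L : ℝ} (hL : 0 < L) (l : ℕ) :
    (dilate c L l)ᶜ ⊆ ⋃ j, dilate c L (l + j + 1) \ dilate c L (l + j) := by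
  intro x hx
  have hex : ∃ j, x ∈ dilate c L (l + j + 1) := by
    obtain ⟨j, hj⟩ := exists_mem_dilate hL x (c := c)
    exact ⟨j, dilate_mono hL (by omega) hj⟩
  classical
  refine mem_iUnion.2 ⟨Nat.find hex, Nat.find_spec hex, ?_⟩
  rcases Nat.eq_zero_or_pos (Nat.find hex) with h | h
  · rw [h]; exact hx
  · have := Nat.find_min hex (Nat.sub_lt h one_pos)
    have e : l + (Nat.find hex - 1) + 1 = l + Nat.find hex := by omega
    rwa [e] at this

theorem setLIntegral_compl_dilate_le {c L : ℝ} (hL : 0 < L) (l : ℕ) (h : ℝ → ℝ≥0∞) :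
    ∫⁻ x in (dilate c L l)ᶜ, h x ≤
      ∑' j, ∫⁻ x in dilate c L (l + j + 1) \ dilate c L (l + j), h x :=
  (lintegral_mono_set (compl_dilate_subset hL l)).trans (lintegral_iUnion_le _ _)

/-- A molecule: a function of mean zero which is concentrated around an interval of length `L`. -/
structure IsMolecule (G : ℝ → ℂ) (c L b : ℝ) : Prop where
  length_pos : 0 < L
  pos : 0 < b
  aestronglyMeasurable : AEStronglyMeasurable G
  lintegral_sq_le : ∫⁻ x, ‖G x‖ₑ ^ 2 ≤ ENNReal.ofReal (b ^ 2 * L)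
  norm_le : ∀ x, 2 * L ≤ |x - c| → ‖G x‖ ≤ b * L ^ 2 / |x - c| ^ 2
  integral_eq_zero : ∫ x, G x = 0

namespace IsMolecule

variable {G : ℝ → ℂ} {c L b : ℝ}

theorem norm_le_of_notMem (hG : IsMolecule G c L b) {x : ℝ} {j : ℕ} (hx : x ∉ dilate c L j) :
    ‖G x‖ ≤ b * (1 / 4) ^ (j + 1) := by
  have hL := hG.length_pos
  have hb := hG.pos
  have h1 := le_abs_of_notMem_dilate hx
  have h2 : (2 : ℝ) ≤ 2 ^ (j + 1) := by
    rw [pow_succ]; nlinarith [one_le_pow₀ (M₀ := ℝ) (by norm_num : (1 : ℝ) ≤ 2) (n := j)]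
  refine (hG.norm_le x (le_trans (by nlinarith) h1)).trans ?_
  calc b * L ^ 2 / |x - c| ^ 2 ≤ b * L ^ 2 / (2 ^ (j + 1) * L) ^ 2 := by gcongr
    _ = b * (1 / 4) ^ (j + 1) := by
      rw [mul_pow, ← pow_mul, mul_comm (j + 1) 2, pow_mul, one_div, inv_pow]
      norm_num
      field_simp

theorem setLIntegral_mul_annulus_le (hG : IsMolecule G c L b) (j : ℕ) {h : ℝ → ℝ≥0∞} :
    ∫⁻ x in dilate c L (j + 1) \ dilate c L j, h x * ‖G x‖ₑ ≤
      ENNReal.ofReal (b * (1 / 4) ^ (j + 1)) * ∫⁻ x in dilate c L (j + 1), h x := by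
  have hb := hG.pos
  calc ∫⁻ x in dilate c L (j + 1) \ dilate c L j, h x * ‖G x‖ₑ
      ≤ ∫⁻ x in dilate c L (j + 1) \ dilate c L j, ENNReal.ofReal (b * (1 / 4) ^ (j + 1)) * h x := by
        refine setLIntegral_mono' ((measurableSet_dilate _ _ _).diff (measurableSet_dilate _ _ _))
          fun x hx => ?_
        rw [mul_comm, ← ofReal_norm]
        gcongr
        exact hG.norm_le_of_notMem hx.2
    _ ≤ ∫⁻ x in dilate c L (j + 1), ENNReal.ofReal (b * (1 / 4) ^ (j + 1)) * h x :=
        lintegral_mono_set sdiff_subset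
    _ = _ := lintegral_const_mul' _ _ ENNReal.ofReal_ne_top

/-- From one annulus to the next the volume doubles while the pointwise bound falls by a factor
four, leaving a geometric series of ratio `1 / 2`. -/
theorem setLIntegral_compl_le (hG : IsMolecule G c L b) (l : ℕ) :
    ∫⁻ x in (dilate c L l)ᶜ, ‖G x‖ₑ ≤ ENNReal.ofReal (4 * b * L * (1 / 2) ^ l) := by
  have hL := hG.length_pos
  have hb := hG.pos
  refine (setLIntegral_compl_dilate_le hL l _).trans ?_
  calc ∑' j, ∫⁻ x in dilate c L (l + j + 1) \ dilate c L (l + j), ‖G x‖ₑ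
      ≤ ∑' j : ℕ, ENNReal.ofReal (2 * b * L * (1 / 2) ^ l * (1 / 2) ^ j) := by
        refine ENNReal.tsum_le_tsum fun j => ?_
        have := hG.setLIntegral_mul_annulus_le (l + j) (h := fun _ => 1)
        simp only [one_mul] at this
        refine this.trans ?_
        rw [setLIntegral_one, volume_dilate, ← ENNReal.ofReal_mul (by positivity)]
        refine ENNReal.ofReal_le_ofReal (le_of_eq ?_)
        have e : (1 / 4 : ℝ) = 1 / 2 * (1 / 2) := by norm_num
        rw [e, mul_pow]
        have e2 : ∀ m : ℕ, (2 : ℝ) ^ m * (1 / 2) ^ m = 1 := fun m => by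
          rw [← mul_pow]; norm_num
        linear_combination (2 * b * L * (1 / 2) ^ (l + j)) * e2 (l + j)
    _ = ENNReal.ofReal (4 * b * L * (1 / 2) ^ l) := by
        rw [← ENNReal.ofReal_tsum_of_nonneg (fun _ => by positivity)
          (summable_geometric_two.mul_left _), tsum_mul_left, tsum_geometric_two]
        congr 1; ring

theorem integrable (hG : IsMolecule G c L b) : Integrable G := by
  rw [← integrableOn_univ, ← union_compl_self (dilate c L 0)]
  refine IntegrableOn.union ?_ ⟨hG.aestronglyMeasurable.restrict,
    (hG.setLIntegral_compl_le 0).trans_lt ENNReal.ofReal_lt_top⟩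
  have h2 : MemLp G 2 := by
    refine ⟨hG.aestronglyMeasurable, ?_⟩
    have := hG.lintegral_sq_le.trans_lt ENNReal.ofReal_lt_top
    rw [← enorm_sq_eLpNorm_two] at this
    by_contra h
    rw [not_lt_top_iff] at h
    rw [h] at this
    simp at this
  have : IsFiniteMeasure (volume.restrict (dilate c L 0)) :=
    ⟨by rw [Measure.restrict_apply_univ, volume_dilate]; exact ENNReal.ofReal_lt_top⟩
  exact (h2.restrict _).integrable one_le_two

/-- Since `G` has mean zero, its integral over the dilate is minus its integral over the complement,
where `G` is small. -/
theorem norm_setIntegral_le (hG : IsMolecule G c L b) (l : ℕ) :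
    ‖∫ x in dilate c L l, G x‖ ≤ 4 * b * L * (1 / 2) ^ l := by
  have hL := hG.length_pos
  have hb := hG.pos
  have h1 := integral_add_compl (measurableSet_dilate c L l) hG.integrable
  rw [hG.integral_eq_zero] at h1
  rw [eq_neg_of_add_eq_zero_left h1, norm_neg]
  refine (norm_integral_le_lintegral_norm _).trans ?_
  refine ENNReal.toReal_le_of_le_ofReal (by positivity) ?_
  simpa using hG.setLIntegral_compl_le l

/-- The truncation of `G` to a dilated interval, corrected to have mean zero. -/
noncomputable def trunc (G : ℝ → ℂ) (c L : ℝ) (l : ℕ) : ℝ → ℂ :=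
  (dilate c L l).indicator fun x => G x - (∫ y in dilate c L l, G y) / ((2 ^ (l + 2) * L : ℝ) : ℂ)

theorem norm_mean_le (hG : IsMolecule G c L b) (l : ℕ) :
    ‖(∫ y in dilate c L l, G y) / ((2 ^ (l + 2) * L : ℝ) : ℂ)‖ ≤ b * (1 / 4) ^ l := by
  have hL := hG.length_pos
  rw [norm_div, Complex.norm_real, Real.norm_of_nonneg (by positivity), div_le_iff₀ (by positivity)]
  refine (hG.norm_setIntegral_le l).trans (le_of_eq ?_)
  have e : (1 / 4 : ℝ) = 1 / 2 * (1 / 2) := by norm_num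
  have e2 : (2 : ℝ) ^ l * (1 / 2) ^ l = 1 := by rw [← mul_pow]; norm_num
  rw [e, mul_pow, pow_add]
  linear_combination -(4 * b * L * (1 / 2) ^ l) * e2

theorem integrableOn_trunc (hG : IsMolecule G c L b) (l : ℕ) :
    Integrable (trunc G c L l) := by
  rw [trunc, integrable_indicator_iff (measurableSet_dilate c L l)]
  exact hG.integrable.integrableOn.sub (integrableOn_const
    (by rw [volume_dilate]; exact ENNReal.ofReal_ne_top))

theorem integral_trunc (hG : IsMolecule G c L b) (l : ℕ) : ∫ x, trunc G c L l x = 0 := by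
  have hL := hG.length_pos
  have hv : volume.real (dilate c L l) = 2 ^ (l + 2) * L := by
    rw [measureReal_def, volume_dilate, ENNReal.toReal_ofReal (by positivity)]
  rw [trunc, integral_indicator (measurableSet_dilate c L l), integral_sub hG.integrable.integrableOn
    (integrableOn_const (by rw [volume_dilate]; exact ENNReal.ofReal_ne_top)), setIntegral_const, hv,
    Complex.real_smul, mul_div_cancel₀, sub_self]
  exact_mod_cast (by positivity : 2 ^ (l + 2) * L ≠ 0)

theorem support_trunc_subset (G : ℝ → ℂ) (c L : ℝ) (l : ℕ) :
    Function.support (trunc G c L l) ⊆ dilate c L l := support_indicator_subset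

theorem h1ENorm_trunc_zero_le (hG : IsMolecule G c L b) :
    h1ENorm (trunc G c L 0) ≤ ENNReal.ofReal (7 * b * L) := by
  have hL := hG.length_pos
  have hb := hG.pos
  refine h1ENorm_le_of_support_subset (c := c - 2 ^ (0 + 1) * L) (d := c + 2 ^ (0 + 1) * L)
    (by norm_num; linarith) (by positivity)
    ((support_trunc_subset G c L 0).trans Ioc_subset_Icc_self) (hG.integrableOn_trunc 0).1 ?_
    (hG.integral_trunc 0)
  have hz := hG.norm_mean_le 0
  set z := (∫ y in dilate c L 0, G y) / ((2 ^ (0 + 2) * L : ℝ) : ℂ) with hzdef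
  have h1 : ∀ x, ‖trunc G c L 0 x‖ₑ ^ 2 ≤
      2 * ‖G x‖ₑ ^ 2 + (dilate c L 0).indicator (fun _ => ENNReal.ofReal (2 * b ^ 2)) x := by
    intro x
    by_cases hx : x ∈ dilate c L 0
    · rw [trunc, indicator_of_mem hx, indicator_of_mem hx, ← hzdef]
      have h3 := norm_sub_le (G x) z
      have h4 : ‖G x - z‖ ^ 2 ≤ 2 * ‖G x‖ ^ 2 + 2 * b ^ 2 := by
        have h5 : ‖z‖ ≤ b := by simpa using hz
        nlinarith [norm_nonneg (G x - z), norm_nonneg (G x), norm_nonneg z, sq_nonneg (‖G x‖ - b)]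
      have := ENNReal.ofReal_le_ofReal h4
      rw [ENNReal.ofReal_add (by positivity) (by positivity), ENNReal.ofReal_mul (by norm_num),
        ENNReal.ofReal_pow (norm_nonneg _), ENNReal.ofReal_pow (norm_nonneg _), ofReal_norm,
        ofReal_norm] at this
      simpa using this
    · rw [trunc, indicator_of_notMem hx]
      simp
  refine (lintegral_mono h1).trans ?_
  rw [lintegral_add_right _ (measurable_const.indicator (measurableSet_dilate _ _ _)),
    lintegral_const_mul' _ _ (by simp), lintegral_indicator (measurableSet_dilate _ _ _),
    setLIntegral_const, volume_dilate, ← ENNReal.ofReal_mul (by positivity)]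
  calc 2 * (∫⁻ x, ‖G x‖ₑ ^ 2) + ENNReal.ofReal (2 * b ^ 2 * (2 ^ (0 + 2) * L))
      ≤ ENNReal.ofReal 2 * ENNReal.ofReal (b ^ 2 * L) +
        ENNReal.ofReal (2 * b ^ 2 * (2 ^ (0 + 2) * L)) := by
        gcongr
        · simp
        · exact hG.lintegral_sq_le
    _ ≤ _ := by
        rw [← ENNReal.ofReal_mul (by norm_num), ← ENNReal.ofReal_add (by positivity) (by positivity)]
        refine ENNReal.ofReal_le_ofReal ?_
        have : c + 2 ^ (0 + 1) * L - (c - 2 ^ (0 + 1) * L) = 4 * L := by ring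
        rw [this, le_div_iff₀ (by positivity)]
        -- The factor `7` in the norm bound is chosen because `40 ≤ 7 ^ 2`.
        have h3 : (2 * (b ^ 2 * L) + 2 * b ^ 2 * (2 ^ (0 + 2) * L)) * (4 * L) =
            40 * (b * L) ^ 2 := by ring
        rw [h3, mul_assoc, mul_pow]
        nlinarith [sq_nonneg (b * L)]

/-- On the smaller dilate the difference is one mean minus another, and on the annulus it is `G`
minus a mean. Either way it is at most `3 / 2 * b * (1 / 4) ^ l`. Multiplying by the length `8 * 2 ^
l * L` of the larger dilate gives the mass of the atom. -/
theorem h1ENorm_trunc_succ_sub_le (hG : IsMolecule G c L b) (l : ℕ) :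
    h1ENorm (fun x => trunc G c L (l + 1) x - trunc G c L l x) ≤
      ENNReal.ofReal (12 * b * L * (1 / 2) ^ l) := by
  have hL := hG.length_pos
  have hb := hG.pos
  have hsub := dilate_mono (c := c) hL l.le_succ
  have hpos : 0 < (2 : ℝ) ^ (l + 1 + 1) * L := by positivity
  have hsupp : Function.support (fun x => trunc G c L (l + 1) x - trunc G c L l x) ⊆
      dilate c L (l + 1) := by
    refine (Function.support_sub _ _).trans (union_subset ?_ ?_)
    · exact support_trunc_subset G c L (l + 1)
    · exact (support_trunc_subset G c L l).trans hsub
  have hi : Integrable (fun x => trunc G c L (l + 1) x - trunc G c L l x) :=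
    (hG.integrableOn_trunc (l + 1)).sub (hG.integrableOn_trunc l)
  refine h1ENorm_le_of_support_subset (c := c - 2 ^ (l + 1 + 1) * L) (d := c + 2 ^ (l + 1 + 1) * L)
    (by linarith) (by positivity) (hsupp.trans Ioc_subset_Icc_self) hi.1 ?_ ?_
  · have hbd : ∀ x, ‖trunc G c L (l + 1) x - trunc G c L l x‖ₑ ^ 2 ≤
        (dilate c L (l + 1)).indicator
          (fun _ => ENNReal.ofReal ((3 / 2 * b * (1 / 4) ^ l) ^ 2)) x := by
      intro x
      by_cases hx : x ∈ dilate c L (l + 1)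
      · rw [indicator_of_mem hx, ← ofReal_norm, ← ENNReal.ofReal_pow (norm_nonneg _)]
        refine ENNReal.ofReal_le_ofReal (pow_le_pow_left₀ (norm_nonneg _) ?_ 2)
        have h1 := hG.norm_mean_le l
        have h2 := hG.norm_mean_le (l + 1)
        have h3 : b * (1 / 4) ^ (l + 1) = b * (1 / 4) ^ l / 4 := by rw [pow_succ]; ring
        simp only [trunc, indicator_of_mem hx]
        set z := (∫ y in dilate c L l, G y) / ((2 ^ (l + 2) * L : ℝ) : ℂ)
        set w := (∫ y in dilate c L (l + 1), G y) / ((2 ^ (l + 1 + 2) * L : ℝ) : ℂ)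
        by_cases hx2 : x ∈ dilate c L l
        · rw [indicator_of_mem hx2, sub_sub_sub_cancel_left]
          refine (norm_sub_le z w).trans ?_
          have : 0 < b * (1 / 4) ^ l := by positivity
          linarith
        · rw [indicator_of_notMem hx2, sub_zero]
          have h4 := hG.norm_le_of_notMem hx2
          refine (norm_sub_le (G x) w).trans ?_
          have : 0 < b * (1 / 4) ^ l := by positivity
          linarith
      · have : trunc G c L (l + 1) x - trunc G c L l x = 0 := by
          by_contra h
          exact hx (hsupp h)
        rw [this]; simp
    refine (lintegral_mono hbd).trans ?_
    rw [lintegral_indicator (measurableSet_dilate _ _ _), setLIntegral_const, volume_dilate,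
      ← ENNReal.ofReal_mul (by positivity)]
    refine ENNReal.ofReal_le_ofReal ?_
    have e : c + 2 ^ (l + 1 + 1) * L - (c - 2 ^ (l + 1 + 1) * L) = 2 ^ (l + 1 + 2) * L := by ring
    rw [e, le_div_iff₀ (by positivity)]
    have e1 : (1 / 4 : ℝ) ^ l = (1 / 2) ^ l * (1 / 2) ^ l := by rw [← mul_pow]; norm_num
    have e2 : (2 : ℝ) ^ (l + 1 + 2) = 8 * 2 ^ l := by ring
    have e3 : (2 : ℝ) ^ l * (1 / 2) ^ l = 1 := by rw [← mul_pow]; norm_num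
    rw [e1, e2]
    refine le_of_eq ?_
    linear_combination (144 * b ^ 2 * L ^ 2 * ((1 / 2) ^ l) ^ 2) *
      ((2 : ℝ) ^ l * (1 / 2) ^ l + 1) * e3
  · rw [integral_sub (hG.integrableOn_trunc _) (hG.integrableOn_trunc _), hG.integral_trunc,
      hG.integral_trunc, sub_zero]

/-- `G` is the pointwise limit of its truncations: a point is eventually inside the dilate, and the
subtracted means tend to zero. The telescoping series of truncations has total mass `7 + 12 * 2 =
31`, in units of `b * L`. -/
theorem h1ENorm_le (hG : IsMolecule G c L b) : h1ENorm G ≤ ENNReal.ofReal (31 * b * L) := by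
  have hL := hG.length_pos
  have hb := hG.pos
  set p : ℕ → ℝ → ℂ := fun n => n.casesOn (trunc G c L 0)
    (fun l x => trunc G c L (l + 1) x - trunc G c L l x) with hp
  have hsum : ∑' n, h1ENorm (p n) ≤ ENNReal.ofReal (31 * b * L) := by
    rw [tsum_eq_zero_add' ENNReal.summable]
    calc h1ENorm (p 0) + ∑' l, h1ENorm (p (l + 1))
        ≤ ENNReal.ofReal (7 * b * L) + ∑' l : ℕ, ENNReal.ofReal (12 * b * L * (1 / 2) ^ l) :=
          add_le_add hG.h1ENorm_trunc_zero_le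
            (ENNReal.tsum_le_tsum fun l => hG.h1ENorm_trunc_succ_sub_le l)
      _ = ENNReal.ofReal (31 * b * L) := by
          rw [← ENNReal.ofReal_tsum_of_nonneg (fun _ => by positivity)
            (summable_geometric_two.mul_left _), tsum_mul_left, tsum_geometric_two,
            ← ENNReal.ofReal_add (by positivity) (by positivity)]
          congr 1; ring
  have hpi : ∀ n, Integrable (p n) := by
    rintro (_ | l)
    · exact hG.integrableOn_trunc 0
    · exact (hG.integrableOn_trunc _).sub (hG.integrableOn_trunc _)
  refine le_trans (h1ENorm_le_tsum ?_) hsum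
  have hfin : ∑' n, ∫⁻ x, ‖p n x‖ₑ ≠ ∞ := ne_top_of_le_ne_top ENNReal.ofReal_ne_top
    ((ENNReal.tsum_le_tsum fun n => lintegral_enorm_le_h1ENorm (p n)).trans hsum)
  filter_upwards [ae_summable_norm_of_tsum_lintegral_ne_top (fun n => (hpi n).1) hfin] with x hx
  rw [hx.of_norm.hasSum_iff_tendsto_nat]
  have hpart : ∀ n, ∑ i ∈ Finset.range (n + 1), p i x = trunc G c L n x := by
    intro n
    induction n with
    | zero => simp [hp]
    | succ n ih => rw [Finset.sum_range_succ, ih]; simp [hp]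
  rw [← tendsto_add_atTop_iff_nat 1]
  simp_rw [hpart]
  obtain ⟨N, hN⟩ := exists_mem_dilate (c := c) hL x
  have hmean : Tendsto (fun l : ℕ => (∫ y in dilate c L l, G y) / ((2 ^ (l + 2) * L : ℝ) : ℂ))
      atTop (𝓝 0) := by
    refine squeeze_zero_norm (fun l => hG.norm_mean_le l) ?_
    simpa using (tendsto_pow_atTop_nhds_zero_of_lt_one (by norm_num : (0 : ℝ) ≤ 1 / 4)
      (by norm_num)).const_mul b
  have := (tendsto_const_nhds (x := G x)).sub hmean
  rw [sub_zero] at this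
  refine this.congr' ?_
  filter_upwards [eventually_ge_atTop N] with l hl
  rw [trunc, indicator_of_mem (dilate_mono hL hl hN)]

end IsMolecule

/-! ### Pairing `BMO` with molecules -/

section Pairing

variable {f : ℝ → ℂ} {B : ℝ}

theorem OscBound.nonneg (hB : OscBound f B) : 0 ≤ B :=
  (oscAbout_nonneg _ zero_lt_one).trans (hB 0 1 zero_lt_one)

theorem oscAbout_le_add (hf : LocallyIntegrable f) (z w : ℂ) {a b : ℝ} (hab : a < b) :
    oscAbout f z a b ≤ oscAbout f w a b + ‖w - z‖ := by
  have hba := sub_pos.2 hab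
  have hi : ∀ v, IntegrableOn (fun x => ‖f x - v‖) (Ioc a b) := fun v =>
    ((hf.integrableOn_Ioc a b).sub (integrableOn_const (by simp))).norm
  rw [oscAbout, oscAbout, div_le_iff₀ hba, add_mul, div_mul_cancel₀ _ hba.ne']
  calc ∫ x in Ioc a b, ‖f x - z‖ ≤ ∫ x in Ioc a b, (‖f x - w‖ + ‖w - z‖) := by
        refine integral_mono (hi z) ((hi w).add (integrableOn_const (by simp))) fun x => ?_
        exact norm_sub_le_norm_sub_add_norm_sub _ _ _
    _ = _ := by
        rw [integral_add (hi w) (integrableOn_const (by simp)), setIntegral_const,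
          Real.volume_real_Ioc_of_le hab.le, smul_eq_mul, mul_comm ‖w - z‖]

/-- Passing to an interval of twice the length moves the mean by at most twice the oscillation
bound. -/
theorem norm_average_dilate_sub_le (hf : LocallyIntegrable f) (hB : OscBound f B) {c L : ℝ}
    (hL : 0 < L) (l : ℕ) :
    ‖(⨍ y in dilate c L l, f y) - ⨍ y in dilate c L 0, f y‖ ≤ 2 * l * B := by
  have hlt : ∀ l : ℕ, c - 2 ^ (l + 1) * L < c + 2 ^ (l + 1) * L := fun l => by
    have : 0 < (2 : ℝ) ^ (l + 1) * L := by positivity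
    linarith
  induction l with
  | zero => simp
  | succ l ih =>
    have h1 : ‖(⨍ y in dilate c L l, f y) - ⨍ y in dilate c L (l + 1), f y‖ ≤ 2 * B := by
      refine (norm_average_sub_le hf _ (hlt l)).trans ?_
      have h2 := hB _ _ (hlt (l + 1))
      have hba := sub_pos.2 (hlt l)
      have hba' := sub_pos.2 (hlt (l + 1))
      rw [oscAbout, div_le_iff₀ hba'] at h2
      rw [oscAbout, div_le_iff₀ hba]
      have h3 : ∫ x in Ioc (c - 2 ^ (l + 1) * L) (c + 2 ^ (l + 1) * L),
          ‖f x - ⨍ y in dilate c L (l + 1), f y‖ ≤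
          ∫ x in Ioc (c - 2 ^ (l + 1 + 1) * L) (c + 2 ^ (l + 1 + 1) * L),
          ‖f x - ⨍ y in dilate c L (l + 1), f y‖ := by
        refine setIntegral_mono_set
          ((hf.integrableOn_Ioc _ _).sub (integrableOn_const (by simp))).norm
          (Eventually.of_forall fun _ => norm_nonneg _) ?_
        exact (dilate_mono hL l.le_succ).eventuallyLE
      refine h3.trans (h2.trans (le_of_eq ?_))
      ring
    have h4 := norm_sub_le_norm_sub_add_norm_sub (⨍ y in dilate c L (l + 1), f y)
      (⨍ y in dilate c L l, f y) (⨍ y in dilate c L 0, f y)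
    rw [norm_sub_rev (⨍ y in dilate c L (l + 1), f y) (⨍ y in dilate c L l, f y)] at h4
    push_cast
    linarith

theorem setLIntegral_dilate_sub_le (hf : LocallyIntegrable f) (hB : OscBound f B) {c L : ℝ}
    (hL : 0 < L) (l : ℕ) :
    ∫⁻ x in dilate c L l, ‖f x - ⨍ y in dilate c L 0, f y‖ₑ ≤
      ENNReal.ofReal ((1 + 2 * l) * B * (2 ^ (l + 2) * L)) := by
  have hlt : c - 2 ^ (l + 1) * L < c + 2 ^ (l + 1) * L := by
    have : 0 < (2 : ℝ) ^ (l + 1) * L := by positivity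
    linarith
  have hba := sub_pos.2 hlt
  have hi : IntegrableOn (fun x => f x - ⨍ y in dilate c L 0, f y) (dilate c L l) :=
    (hf.integrableOn_Ioc _ _).sub (integrableOn_const (by simp))
  have h1 := oscAbout_le_add hf (⨍ y in dilate c L 0, f y) (⨍ y in dilate c L l, f y) hlt
  have h2 := hB _ _ hlt
  have h3 := norm_average_dilate_sub_le hf hB (c := c) hL l
  have h4 : oscAbout f (⨍ y in dilate c L 0, f y) (c - 2 ^ (l + 1) * L) (c + 2 ^ (l + 1) * L) ≤
      (1 + 2 * l) * B := by
    refine h1.trans ((add_le_add h2 h3).trans (le_of_eq ?_))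
    ring
  rw [oscAbout, div_le_iff₀ hba] at h4
  have e : c + 2 ^ (l + 1) * L - (c - 2 ^ (l + 1) * L) = 2 ^ (l + 2) * L := by ring
  rw [e] at h4
  rw [← ofReal_integral_norm_eq_lintegral_enorm hi]
  exact ENNReal.ofReal_le_ofReal h4

/-- On the central dilate, Cauchy–Schwarz combines the `L²` size of `G` with the `L²` John–Nirenberg
inequality. On the `j`-th annulus the deviation of `f` from its central mean grows only linearly in
`j`, while decay against volume gives `(1 / 2) ^ j`. -/
theorem IsMolecule.lintegral_sub_mul_le {G : ℝ → ℂ} {c L b : ℝ} (hG : IsMolecule G c L b)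
    (hf : LocallyIntegrable f) (hB : OscBound f B) :
    ∫⁻ x, ‖f x - ⨍ y in dilate c L 0, f y‖ₑ * ‖G x‖ₑ ≤ ENNReal.ofReal (41 * b * L * B) := by
  have hL := hG.length_pos
  have hb := hG.pos
  have hB0 := hB.nonneg
  have hlt : c - 2 ^ (0 + 1) * L < c + 2 ^ (0 + 1) * L := by norm_num; linarith
  set z := ⨍ y in dilate c L 0, f y with hz
  rw [← lintegral_add_compl _ (measurableSet_dilate c L 0)]
  have h1 : ∫⁻ x in dilate c L 0, ‖f x - z‖ₑ * ‖G x‖ₑ ≤ ENNReal.ofReal (9 * b * L * B) := by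
    rw [← ENNReal.pow_le_pow_left_iff two_ne_zero]
    refine (sq_lintegral_mul_le ((hf.integrableOn_Ioc _ _).sub
      (integrableOn_const (by simp))).1.enorm hG.aestronglyMeasurable.restrict.enorm).trans ?_
    have h2 := lintegral_sq_sub_average_le hf hB hlt
    have h3 := (setLIntegral_le_lintegral (dilate c L 0) (fun x => ‖G x‖ₑ ^ 2)).trans
      hG.lintegral_sq_le
    refine (mul_le_mul' h2 h3).trans ?_
    have e : c + 2 ^ (0 + 1) * L - (c - 2 ^ (0 + 1) * L) = 4 * L := by ring
    rw [e, ← ENNReal.ofReal_mul (by positivity), ← ENNReal.ofReal_pow (by positivity)]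
    refine ENNReal.ofReal_le_ofReal ?_
    -- The product of the two squared bounds is `80 * (b * L * B) ^ 2`, below the square of `9 * (b
    -- * L * B)`.
    nlinarith [sq_nonneg (b * L * B)]
  have h2 : ∫⁻ x in (dilate c L 0)ᶜ, ‖f x - z‖ₑ * ‖G x‖ₑ ≤ ENNReal.ofReal (32 * b * L * B) := by
    refine (setLIntegral_compl_dilate_le hL 0 _).trans ?_
    calc ∑' j, ∫⁻ x in dilate c L (0 + j + 1) \ dilate c L (0 + j), ‖f x - z‖ₑ * ‖G x‖ₑ
        ≤ ∑' j : ℕ, ENNReal.ofReal (8 * b * L * B * (3 / 4) ^ j) := by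
          refine ENNReal.tsum_le_tsum fun j => ?_
          rw [zero_add]
          refine (hG.setLIntegral_mul_annulus_le j).trans ?_
          refine (mul_le_mul' le_rfl (setLIntegral_dilate_sub_le hf hB hL (j + 1))).trans ?_
          rw [← ENNReal.ofReal_mul (by positivity)]
          refine ENNReal.ofReal_le_ofReal ?_
          -- Absorbs the linear growth into a geometric factor; what remains has ratio `3 / 2 * 1 /
          -- 2 = 3 / 4`.
          have h5 : ∀ j : ℕ, (3 + 2 * j : ℝ) ≤ 4 * (3 / 2) ^ j := by
            intro j
            induction j with
            | zero => norm_num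
            | succ j ih =>
              have : (1 : ℝ) ≤ (3 / 2) ^ j := one_le_pow₀ (by norm_num)
              rw [pow_succ]; push_cast; linarith
          have e1 : (1 / 4 : ℝ) ^ j * 2 ^ j = (1 / 2) ^ j := by rw [← mul_pow]; norm_num
          have e2 : (3 / 2 : ℝ) ^ j * (1 / 2) ^ j = (3 / 4) ^ j := by rw [← mul_pow]; norm_num
          calc b * (1 / 4) ^ (j + 1) * ((1 + 2 * ((j + 1 : ℕ) : ℝ)) * B * (2 ^ (j + 1 + 2) * L))
              = 2 * b * L * B * (1 / 2) ^ j * (3 + 2 * j) := by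
                rw [← e1]; push_cast; ring
            _ ≤ 2 * b * L * B * (1 / 2) ^ j * (4 * (3 / 2) ^ j) := by
                gcongr; exact h5 j
            _ = _ := by rw [← e2]; ring
      _ = ENNReal.ofReal (32 * b * L * B) := by
          rw [← ENNReal.ofReal_tsum_of_nonneg (fun _ => by positivity)
            ((summable_geometric_of_lt_one (by norm_num) (by norm_num)).mul_left _), tsum_mul_left,
            tsum_geometric_of_lt_one (by norm_num) (by norm_num)]
          congr 1; ring
  refine (add_le_add h1 h2).trans ?_
  rw [← ENNReal.ofReal_add (by positivity) (by positivity)]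
  exact ENNReal.ofReal_le_ofReal (by linarith)

/-- The cancellation of `G` allows a mean of `f` to be subtracted. For a molecule the product with a
`BMO` function is absolutely integrable, which may fail for a general element of `H¹`. -/
theorem IsMolecule.integrable_mul_and_norm_integral_le {G : ℝ → ℂ} {c L b : ℝ}
    (hG : IsMolecule G c L b) (hf : LocallyIntegrable f) (hB : OscBound f B) :
    Integrable (fun x => f x * G x) ∧ ‖∫ x, f x * G x‖ ≤ 41 * b * L * B := by
  have hL := hG.length_pos
  have hb := hG.pos
  have hB0 := hB.nonneg
  have h := hG.lintegral_sub_mul_le hf hB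
  set z := ⨍ y in dilate c L 0, f y with hz
  have h1 : Integrable (fun x => (f x - z) * G x) := by
    refine ⟨(hf.aestronglyMeasurable.sub aestronglyMeasurable_const).mul hG.aestronglyMeasurable, ?_⟩
    simp only [HasFiniteIntegral, enorm_mul]
    exact h.trans_lt ENNReal.ofReal_lt_top
  have h2 : Integrable (fun x => z * G x) := hG.integrable.const_mul z
  have e : (fun x => f x * G x) = fun x => (f x - z) * G x + z * G x := by funext x; ring
  rw [e]
  refine ⟨h1.add h2, ?_⟩
  rw [integral_add h1 h2, integral_const_mul, hG.integral_eq_zero, mul_zero, add_zero]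
  refine (norm_integral_le_lintegral_norm _).trans ?_
  refine ENNReal.toReal_le_of_le_ofReal (by positivity) ?_
  simpa only [ofReal_norm, enorm_mul] using h

end Pairing

/-! ### Tents: an atomic sequence space for wavelet coefficients -/

/-- A nonnegative sequence, supported on the dyadic intervals inside `[c, c + L]`, whose `ℓ²` norm
is at most `lam / √L`. -/
structure IsTent (c L : ℝ) (lam : ℝ≥0∞) (v : DyadicInterval → ℝ≥0∞) : Prop where
  length_pos : 0 < L
  supp : ∀ I, v I ≠ 0 → c ≤ I.left ∧ I.right ≤ c + L
  sq_le : ENNReal.ofReal L * ∑' I, v I ^ 2 ≤ lam ^ 2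

/-- `w` is dominated by a countable sum of tents of total mass at most `M`. -/
def TentBound (w : DyadicInterval → ℝ≥0∞) (M : ℝ≥0∞) : Prop :=
  ∃ (ι : Type) (_ : Countable ι) (c L : ι → ℝ) (lam : ι → ℝ≥0∞) (v : ι → DyadicInterval → ℝ≥0∞),
    (∀ i, IsTent (c i) (L i) (lam i) (v i)) ∧ (∀ I, w I ≤ ∑' i, v i I) ∧ ∑' i, lam i ≤ M

namespace TentBound

variable {w : DyadicInterval → ℝ≥0∞} {M : ℝ≥0∞}

theorem mono (h : TentBound w M) {w' : DyadicInterval → ℝ≥0∞} {M' : ℝ≥0∞} (hw : ∀ I, w' I ≤ w I)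
    (hM : M ≤ M') : TentBound w' M' := by
  obtain ⟨ι, hι, c, L, lam, v, h1, h2, h3⟩ := h
  exact ⟨ι, hι, c, L, lam, v, h1, fun I => (hw I).trans (h2 I), h3.trans hM⟩

theorem tsum {κ : Type} [Countable κ] {u : κ → DyadicInterval → ℝ≥0∞} {m : κ → ℝ≥0∞}
    (h : ∀ k, TentBound (u k) (m k)) (hw : ∀ I, w I ≤ ∑' k, u k I) : TentBound w (∑' k, m k) := by
  choose ι hι c L lam v h1 h2 h3 using h
  refine ⟨Σ k, ι k, inferInstance, fun p => c p.1 p.2, fun p => L p.1 p.2, fun p => lam p.1 p.2,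
    fun p => v p.1 p.2, fun p => h1 p.1 p.2, fun I => ?_, ?_⟩
  · rw [ENNReal.tsum_sigma (f := fun k i => v k i I)]
    exact (hw I).trans (ENNReal.tsum_le_tsum fun k => h2 k I)
  · rw [ENNReal.tsum_sigma (f := fun k i => lam k i)]
    exact ENNReal.tsum_le_tsum h3

theorem const_mul (h : TentBound w M) (z : ℝ≥0∞) : TentBound (fun I => z * w I) (z * M) := by
  obtain ⟨ι, hι, c, L, lam, v, h1, h2, h3⟩ := h
  refine ⟨ι, hι, c, L, fun i => z * lam i, fun i I => z * v i I, fun i => ⟨(h1 i).length_pos,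
    fun I hI => (h1 i).supp I (right_ne_zero_of_mul hI), ?_⟩, fun I => ?_, ?_⟩
  · simp only [mul_pow]
    rw [ENNReal.tsum_mul_left, mul_left_comm]
    gcongr
    exact (h1 i).sq_le
  · rw [ENNReal.tsum_mul_left]; exact mul_le_mul' le_rfl (h2 I)
  · rw [ENNReal.tsum_mul_left]; exact mul_le_mul' le_rfl h3

theorem add {w' : DyadicInterval → ℝ≥0∞} {M' : ℝ≥0∞} (h : TentBound w M) (h' : TentBound w' M') :
    TentBound (fun I => w I + w' I) (M + M') := by
  have := TentBound.tsum (κ := Bool) (u := fun b => bif b then w else w')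
    (m := fun b => bif b then M else M') (w := fun I => w I + w' I)
    (by rintro (_ | _) <;> assumption) (fun I => by simp)
  simpa [tsum_bool, add_comm] using this

end TentBound

theorem IsTent.tentBound {c L : ℝ} {lam : ℝ≥0∞} {v : DyadicInterval → ℝ≥0∞}
    (h : IsTent c L lam v) : TentBound v lam :=
  ⟨Unit, inferInstance, fun _ => c, fun _ => L, fun _ => lam, fun _ => v, fun _ => h,
    fun I => by simp, by simp⟩

theorem isTent_single (I : DyadicInterval) (z : ℝ≥0∞) :
    IsTent I.left I.length (ENNReal.ofReal √I.length * z) (Pi.single I z) := by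
  refine ⟨I.length_pos, fun J hJ => ?_, ?_⟩
  · have : J = I := by
      by_contra h
      exact hJ (by simp [h])
    subst this
    exact ⟨le_rfl, J.right_eq.le⟩
  · rw [tsum_eq_single I fun J hJ => by simp [hJ], Pi.single_eq_same, mul_pow,
      ← ENNReal.ofReal_pow (Real.sqrt_nonneg _), Real.sq_sqrt I.length_pos.le]

/-- Each entry is regarded as a tent over its own interval, of mass `√|I|` times its value. This
crude domination suffices for rapidly decaying tails. -/
theorem tentBound_tsum (w : DyadicInterval → ℝ≥0∞) :
    TentBound w (∑' I, ENNReal.ofReal √I.length * w I) := by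
  refine TentBound.tsum (fun I => (isTent_single I (w I)).tentBound) fun I => ?_
  refine le_trans ?_ (ENNReal.le_tsum I)
  simp

/-! ### Counting -/

theorem tsum_indicator_int_le {A : Set ℤ} {α β : ℝ} (hαβ : α ≤ β)
    (h : ∀ p ∈ A, α ≤ (p : ℝ) ∧ (p : ℝ) ≤ β) :
    ∑' p, A.indicator (1 : ℤ → ℝ≥0∞) p ≤ ENNReal.ofReal (β - α + 1) := by
  rw [tsum_eq_sum (s := Finset.Icc ⌈α⌉ ⌊β⌋) fun p hp => indicator_of_notMem (fun hpA => hp ?_) _]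
  · refine (Finset.sum_le_card_nsmul _ _ 1 fun p _ => indicator_le_self _ _ p).trans ?_
    rw [nsmul_eq_mul, mul_one, Int.card_Icc, ← ENNReal.ofReal_natCast]
    refine ENNReal.ofReal_le_ofReal ?_
    rcases le_total 0 (⌊β⌋ + 1 - ⌈α⌉) with h0 | h0
    · have : (((⌊β⌋ + 1 - ⌈α⌉).toNat : ℤ) : ℝ) = ⌊β⌋ + 1 - ⌈α⌉ := by
        rw [Int.toNat_of_nonneg h0]; push_cast; ring
      have h1 := Int.floor_le β
      have h2 := Int.le_ceil α
      have h3 : (((⌊β⌋ + 1 - ⌈α⌉).toNat : ℕ) : ℝ) = (((⌊β⌋ + 1 - ⌈α⌉).toNat : ℤ) : ℝ) := by norm_cast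
      linarith
    · rw [Int.toNat_of_nonpos h0]; push_cast; linarith
  · rw [Finset.mem_Icc]
    exact ⟨Int.ceil_le.2 (h p hpA).1, Int.le_floor.2 (h p hpA).2⟩

theorem tsum_indicator_dyadic_le {A : Set DyadicInterval} {s : ℤ} {α β : ℝ} (hαβ : α ≤ β)
    (hs : ∀ I ∈ A, I.scale = s) (h : ∀ I ∈ A, α ≤ I.left ∧ I.left ≤ β) :
    ∑' I, A.indicator (1 : DyadicInterval → ℝ≥0∞) I ≤
      ENNReal.ofReal ((β - α) / (2 : ℝ) ^ (-s) + 1) := by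
  have hr : (0 : ℝ) < 2 ^ (-s) := by positivity
  rw [DyadicInterval.tsum_eq, tsum_eq_single s fun t ht => ?_]
  · have := tsum_indicator_int_le (A := {m | (⟨s, m⟩ : DyadicInterval) ∈ A})
      (div_le_div_of_nonneg_right hαβ hr.le) (fun p hp => ?_)
    · rw [← sub_div] at this
      exact this
    · rw [div_le_iff₀ hr, le_div_iff₀ hr]
      exact h _ hp
  · simp only [ENNReal.tsum_eq_zero]
    intro m
    refine indicator_of_notMem (fun hm => ht ?_) _
    exact hs _ hm

namespace DyadicInterval

theorem scale_of_mem_related {k : ℤ} {n : ℕ} {I J : DyadicInterval} (h : J ∈ related k n I) :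
    J.scale = I.scale + k := by
  have h1 := h.1
  simp only [length] at h1
  rw [← zpow_add₀ (by norm_num : (2 : ℝ) ≠ 0)] at h1
  have := zpow_right_injective₀ (by norm_num : (0 : ℝ) < 2) (by norm_num) h1
  omega

theorem mem_related_neg_iff {k : ℤ} {n : ℕ} {I J : DyadicInterval} :
    I ∈ related (-k) n J ↔ J ∈ related k n I := by
  have h1 : rdist J I = rdist I J := by
    unfold rdist; rw [union_comm, max_comm]
  have h2 : J.length = (2 : ℝ) ^ (-k) * I.length ↔ I.length = (2 : ℝ) ^ k * J.length := by
    rw [zpow_neg, eq_comm (a := I.length), inv_mul_eq_div, eq_div_iff (by positivity), mul_comm]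
  simp only [related, mem_ofPred_eq, h1, h2]

theorem max_length_of_mem_related {k : ℤ} {n : ℕ} {I J : DyadicInterval} (h : J ∈ related k n I) :
    max I.length J.length = (2 : ℝ) ^ max k 0 * J.length := by
  have hJ := J.length_pos
  rw [h.1]
  rcases le_total 0 k with hk | hk
  · rw [max_eq_left hk, max_eq_left]
    have : (1 : ℝ) ≤ 2 ^ k := one_le_zpow₀ (by norm_num) hk
    nlinarith
  · rw [max_eq_right hk, max_eq_right]
    · simp
    · have : (2 : ℝ) ^ k ≤ 1 := zpow_le_one_of_nonpos₀ (by norm_num) hk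
      nlinarith

theorem right_sub_left_lt_of_mem_related {k : ℤ} {n : ℕ} {I J : DyadicInterval}
    (h : J ∈ related k n I) :
    I.right - J.left < (n + 1) * max I.length J.length ∧
      J.right - I.left < (n + 1) * max I.length J.length := by
  have hm : 0 < max I.length J.length := lt_max_of_lt_left I.length_pos
  have h3 := (div_lt_iff₀ hm).1 h.2.2
  have hb : Bornology.IsBounded (I.toSet ∪ J.toSet) :=
    (Metric.isBounded_Icc _ _).union (Metric.isBounded_Icc _ _)
  have right_mem : ∀ K : DyadicInterval, K.right ∈ K.toSet := fun K => ⟨K.left_le_right, le_rfl⟩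
  have h1 := Metric.dist_le_diam_of_mem hb (Or.inl (right_mem I)) (Or.inr J.left_mem)
  have h2 := Metric.dist_le_diam_of_mem hb (Or.inr (right_mem J)) (Or.inl I.left_mem)
  rw [Real.dist_eq] at h1 h2
  exact ⟨((le_abs_self _).trans h1).trans_lt h3, ((le_abs_self _).trans h2).trans_lt h3⟩

theorem le_abs_left_sub_of_mem_related {k : ℤ} {n : ℕ} {I J : DyadicInterval}
    (h : J ∈ related k n I) : (n - 1) * max I.length J.length ≤ |I.left - J.left| := by
  have hm : 0 < max I.length J.length := lt_max_of_lt_left I.length_pos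
  have h3 := (le_div_iff₀ hm).1 h.2.1
  have hI := le_max_left I.length J.length
  have hJ := le_max_right I.length J.length
  have h4 : Metric.diam (I.toSet ∪ J.toSet) ≤ |I.left - J.left| + max I.length J.length := by
    refine Metric.diam_le_of_forall_dist_le (by positivity) ?_
    have e1 := I.right_eq
    have e2 := J.right_eq
    have a1 := le_abs_self (I.left - J.left)
    have a2 := neg_le_abs (I.left - J.left)
    rintro x (⟨hx1, hx2⟩ | ⟨hx1, hx2⟩) y (⟨hy1, hy2⟩ | ⟨hy1, hy2⟩) <;>
      rw [Real.dist_eq, abs_le] <;> constructor <;> linarith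
  linarith

theorem length_eq_of_scale {I : DyadicInterval} {s : ℤ} (h : I.scale = s) :
    I.length = (2 : ℝ) ^ (-s) := by rw [← h]; rfl

/-- On either side of `I`, the two-sided bound on `rdist` confines the left end point of `J` to a
window of length `2 max(|I|, |J|)`, whose position depends on `n` but whose length does not. With `a
= 2 ^ max k 0` a window contains at most `2 a + 1 ≤ 3 a` end points at the scale of `J`. -/
theorem tsum_indicator_related_le (k : ℤ) (n : ℕ) (I : DyadicInterval) :
    ∑' J, (related k n I).indicator (1 : DyadicInterval → ℝ≥0∞) J ≤
      ENNReal.ofReal (6 * (2 : ℝ) ^ max k 0) := by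
  set r : ℝ := (2 : ℝ) ^ (-(I.scale + k)) with hr
  set a : ℝ := (2 : ℝ) ^ max k 0 with ha
  have hr0 : 0 < r := by positivity
  have ha1 : 1 ≤ a := one_le_zpow₀ (by norm_num) (le_max_right _ _)
  set A : Bool → Set DyadicInterval := fun b => {J | J ∈ related k n I ∧
    (bif b then J.left ≤ I.left else I.left ≤ J.left)} with hA
  have hM : ∀ J ∈ related k n I, max I.length J.length = a * r := fun J hJ => by
    rw [max_length_of_mem_related hJ, length_eq_of_scale (scale_of_mem_related hJ)]
  have hkey : ∀ b, ∑' J, (A b).indicator (1 : DyadicInterval → ℝ≥0∞) J ≤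
      ENNReal.ofReal (3 * a) := by
    have hcount : ∀ α : ℝ, ENNReal.ofReal ((α + 2 * (a * r) - α) / (2 : ℝ) ^ (-(I.scale + k)) + 1) ≤
        ENNReal.ofReal (3 * a) := fun α => by
      refine ENNReal.ofReal_le_ofReal ?_
      rw [← hr, add_sub_cancel_left, ← mul_assoc, mul_div_cancel_right₀ _ hr0.ne']
      linarith
    have har : 0 < a * r := by positivity
    rintro (_ | _)
    · refine (tsum_indicator_dyadic_le (s := I.scale + k) (α := I.left + (n - 1) * (a * r))
        (β := I.left + (n - 1) * (a * r) + 2 * (a * r)) (by linarith)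
        (fun J hJ => scale_of_mem_related hJ.1) ?_).trans (hcount _)
      rintro J ⟨hJ, hJ2⟩
      have h1 := right_sub_left_lt_of_mem_related hJ
      have h2 := le_abs_left_sub_of_mem_related hJ
      rw [hM J hJ] at h1 h2
      simp only [cond_false] at hJ2
      rw [abs_of_nonpos (by linarith)] at h2
      have := J.left_le_right
      constructor <;> linarith [h1.2]
    · refine (tsum_indicator_dyadic_le (s := I.scale + k) (α := I.left - (n + 1) * (a * r))
        (β := I.left - (n + 1) * (a * r) + 2 * (a * r)) (by linarith)
        (fun J hJ => scale_of_mem_related hJ.1) ?_).trans (hcount _)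
      rintro J ⟨hJ, hJ2⟩
      have h1 := right_sub_left_lt_of_mem_related hJ
      have h2 := le_abs_left_sub_of_mem_related hJ
      rw [hM J hJ] at h1 h2
      simp only [cond_true] at hJ2
      rw [abs_of_nonneg (by linarith)] at h2
      have := I.left_le_right
      constructor <;> linarith [h1.1]
  calc ∑' J, (related k n I).indicator (1 : DyadicInterval → ℝ≥0∞) J
      ≤ ∑' J, ((A true).indicator (1 : DyadicInterval → ℝ≥0∞) J +
          (A false).indicator (1 : DyadicInterval → ℝ≥0∞) J) := by
        refine ENNReal.tsum_le_tsum fun J => ?_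
        by_cases hJ : J ∈ related k n I
        · rw [indicator_of_mem hJ]
          rcases le_total J.left I.left with h | h
          · rw [indicator_of_mem (show J ∈ A true from ⟨hJ, h⟩)]; exact le_self_add
          · rw [indicator_of_mem (show J ∈ A false from ⟨hJ, h⟩)]; exact le_add_self
        · rw [indicator_of_notMem hJ]; exact zero_le
    _ ≤ ENNReal.ofReal (3 * a) + ENNReal.ofReal (3 * a) := by
        rw [ENNReal.tsum_add]; exact add_le_add (hkey _) (hkey _)
    _ = _ := by
        rw [← ENNReal.ofReal_add (by positivity) (by positivity)]; congr 1; ring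

end DyadicInterval

/-- Schur's test for a `0`-`1` matrix. -/
theorem tsum_sq_tsum_indicator_le {ι : Type*} {R : ι → Set ι} {N₁ N₂ : ℝ≥0∞}
    (h₁ : ∀ I, ∑' J, (R I).indicator (1 : ι → ℝ≥0∞) J ≤ N₁)
    (h₂ : ∀ J, ∑' I, (R I).indicator (1 : ι → ℝ≥0∞) J ≤ N₂) (v : ι → ℝ≥0∞) :
    ∑' I, (∑' J, (R I).indicator v J) ^ 2 ≤ N₁ * N₂ * ∑' J, v J ^ 2 := by
  have e : ∀ I J, (R I).indicator v J = (R I).indicator (1 : ι → ℝ≥0∞) J * (R I).indicator v J := by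
    intro I J
    by_cases h : J ∈ R I <;> simp [h]
  have e1 : ∀ I J, (R I).indicator (1 : ι → ℝ≥0∞) J ^ 2 = (R I).indicator (1 : ι → ℝ≥0∞) J := by
    intro I J
    by_cases h : J ∈ R I <;> simp [h]
  have e2 : ∀ I J, (R I).indicator v J ^ 2 = (R I).indicator (1 : ι → ℝ≥0∞) J * v J ^ 2 := by
    intro I J
    by_cases h : J ∈ R I <;> simp [h]
  calc ∑' I, (∑' J, (R I).indicator v J) ^ 2
      ≤ ∑' I, N₁ * ∑' J, (R I).indicator (1 : ι → ℝ≥0∞) J * v J ^ 2 := by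
        refine ENNReal.tsum_le_tsum fun I => ?_
        rw [tsum_congr (e I)]
        refine (ENNReal.sq_tsum_mul_le _ _).trans ?_
        simp_rw [e1, e2]
        gcongr
        exact h₁ I
    _ = N₁ * ∑' J, (∑' I, (R I).indicator (1 : ι → ℝ≥0∞) J) * v J ^ 2 := by
        rw [ENNReal.tsum_mul_left, ENNReal.tsum_comm]
        simp_rw [ENNReal.tsum_mul_right]
    _ ≤ N₁ * ∑' J, N₂ * v J ^ 2 := by
        gcongr with J
        exact h₂ J
    _ = _ := by rw [ENNReal.tsum_mul_left, mul_assoc]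

/-! ### The families `I_{k,n}` acting on tents -/

open DyadicInterval in
/-- The sum over the families `I_{k,n}`. -/
noncomputable def relSum (k : ℤ) (n : ℕ) (w : DyadicInterval → ℝ≥0∞) (I : DyadicInterval) : ℝ≥0∞ :=
  ∑' J, (related k n I).indicator w J

/-- The growth rate of the norm of `T_{k,n}` on `H¹`. -/
noncomputable def transformRate (k : ℤ) (n : ℕ) : ℝ :=
  (2 : ℝ) ^ (|(k : ℝ)| / 2) * (Real.log (n + 1) + max (k : ℝ) 0 + 1) ^ (1 / 2 : ℝ)

namespace DyadicInterval

theorem tsum_indicator_subset_related_le {k : ℤ} {n : ℕ}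
    {R : DyadicInterval → Set DyadicInterval} (hR : ∀ I, R I ⊆ related k n I) (I : DyadicInterval) :
    ∑' J, (R I).indicator (1 : DyadicInterval → ℝ≥0∞) J ≤ ENNReal.ofReal (6 * (2 : ℝ) ^ max k 0) :=
  (ENNReal.tsum_le_tsum fun J => indicator_le_indicator_of_subset (hR I) (fun _ => zero_le) J).trans
    (tsum_indicator_related_le k n I)

theorem tsum_indicator_subset_related_le' {k : ℤ} {n : ℕ}
    {R : DyadicInterval → Set DyadicInterval} (hR : ∀ I, R I ⊆ related k n I) (J : DyadicInterval) :
    ∑' I, (R I).indicator (1 : DyadicInterval → ℝ≥0∞) J ≤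
      ENNReal.ofReal (6 * (2 : ℝ) ^ max (-k) 0) := by
  refine le_trans (ENNReal.tsum_le_tsum fun I => ?_) (tsum_indicator_related_le (-k) n J)
  by_cases h : J ∈ R I
  · rw [indicator_of_mem h, indicator_of_mem (mem_related_neg_iff.2 (hR I h))]
    rfl
  · rw [indicator_of_notMem h]; exact zero_le

end DyadicInterval

open DyadicInterval

theorem exists_mem_of_tsum_indicator_ne_zero {ι : Type*} {A : Set ι} {v : ι → ℝ≥0∞}
    (h : ∑' J, A.indicator v J ≠ 0) : ∃ J ∈ A, v J ≠ 0 := by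
  by_contra! h0
  refine h (ENNReal.tsum_eq_zero.2 fun J => ?_)
  by_cases hJ : J ∈ A
  · rw [indicator_of_mem hJ, h0 J hJ]
  · exact indicator_of_notMem hJ v

theorem ENNReal.le_of_sq_le_ofReal_mul_sq {x y : ℝ≥0∞} {t : ℝ} (ht : 0 ≤ t)
    (h : x ^ 2 ≤ ENNReal.ofReal t * y ^ 2) : x ≤ ENNReal.ofReal √t * y := by
  rw [← ENNReal.pow_le_pow_left_iff two_ne_zero, mul_pow, ← ENNReal.ofReal_pow (Real.sqrt_nonneg _),
    Real.sq_sqrt ht]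
  exact h

section TentTransform

variable {c L : ℝ} {lam : ℝ≥0∞} {v : DyadicInterval → ℝ≥0∞}

/-- Since the separation of `I` and `J` is below `L`, every such `I` stays in the concentric
interval of length `3 * L`. One tent suffices, and Schur's test gives `108 = 3 * 6 * 6`. -/
theorem IsTent.tentBound_near (h : IsTent c L lam v) (k : ℤ) (n : ℕ) :
    TentBound (fun I => ∑' J, {J | J ∈ related k n I ∧
        (n + 1) * ((2 : ℝ) ^ max k 0 * J.length) ≤ L}.indicator v J)
      (ENNReal.ofReal √(108 * ((2 : ℝ) ^ max k 0 * (2 : ℝ) ^ max (-k) 0)) * lam) := by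
  have hL := h.length_pos
  refine IsTent.tentBound (c := c - L) (L := 3 * L) ⟨by positivity, fun I hI => ?_, ?_⟩
  · obtain ⟨J, ⟨hJ, hJ2⟩, hv⟩ := exists_mem_of_tsum_indicator_ne_zero hI
    have h1 := right_sub_left_lt_of_mem_related hJ
    rw [max_length_of_mem_related hJ] at h1
    have h2 := h.supp J hv
    have h3 := J.left_le_right
    constructor <;> linarith [h1.1, h1.2, h2.1, h2.2]
  · rw [mul_pow, ← ENNReal.ofReal_pow (Real.sqrt_nonneg _), Real.sq_sqrt (by positivity)]
    have hR : ∀ I, {J | J ∈ related k n I ∧ (n + 1) * ((2 : ℝ) ^ max k 0 * J.length) ≤ L} ⊆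
        related k n I := fun I J hJ => hJ.1
    calc ENNReal.ofReal (3 * L) * ∑' I, (∑' J, {J | J ∈ related k n I ∧
            (n + 1) * ((2 : ℝ) ^ max k 0 * J.length) ≤ L}.indicator v J) ^ 2
        ≤ ENNReal.ofReal (3 * L) * (ENNReal.ofReal (6 * (2 : ℝ) ^ max k 0) *
            ENNReal.ofReal (6 * (2 : ℝ) ^ max (-k) 0) * ∑' J, v J ^ 2) := by
          gcongr
          exact tsum_sq_tsum_indicator_le (tsum_indicator_subset_related_le hR)
            (tsum_indicator_subset_related_le' hR) v
      _ = ENNReal.ofReal (108 * ((2 : ℝ) ^ max k 0 * (2 : ℝ) ^ max (-k) 0)) *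
            (ENNReal.ofReal L * ∑' J, v J ^ 2) := by
          rw [← mul_assoc, ← mul_assoc, ← ENNReal.ofReal_mul (by positivity),
            ← ENNReal.ofReal_mul (by positivity), ← mul_assoc (ENNReal.ofReal (108 * _)),
            ← ENNReal.ofReal_mul (by positivity)]
          congr 2; ring
      _ ≤ _ := by gcongr; exact h.sq_le

/-- The part of `I_{k,n}` at a fixed scale inside `[c, c + L]` and on one side of `I`. -/
def farFamily (k : ℤ) (n : ℕ) (c L : ℝ) (s : ℤ) (b : Bool) (I : DyadicInterval) :
    Set DyadicInterval :=
  {J | J ∈ related k n I ∧ J.scale = s ∧ (c ≤ J.left ∧ J.right ≤ c + L) ∧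
    (bif b then J.left ≤ I.left else I.left ≤ J.left)}

theorem tsum_scale_indicator (v : DyadicInterval → ℝ≥0∞) (s : ℤ) :
    ∑' J, ({J : DyadicInterval | J.scale = s}.indicator v J) ^ 2 = ∑' m, v ⟨s, m⟩ ^ 2 := by
  rw [DyadicInterval.tsum_eq, tsum_eq_single s fun t ht => ?_]
  · simp [indicator]
  · simp [indicator, ht]

/-- With scale and side fixed, the intervals `I` are displaced by nearly the same amount, so they
lie in an interval of length `L + 3 * (a * r)`. This may be much longer than `L`; the loss is made
up by the row count, since at most `2 * L / r` intervals of length `r` fit into `[c, c + L]`. -/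
theorem IsTent.tentBound_far (h : IsTent c L lam v) (k : ℤ) (n : ℕ) {s : ℤ}
    (hs : (2 : ℝ) ^ (-s) ≤ L) (b : Bool) :
    TentBound (fun I => ∑' J, (farFamily k n c L s b I).indicator v J)
      ((ENNReal.ofReal (72 * ((2 : ℝ) ^ max k 0 * (2 : ℝ) ^ max (-k) 0)) *
        (ENNReal.ofReal L * ∑' m, v ⟨s, m⟩ ^ 2)) ^ (1 / 2 : ℝ)) := by
  have hL := h.length_pos
  set r : ℝ := (2 : ℝ) ^ (-s) with hr
  set a : ℝ := (2 : ℝ) ^ max k 0 with ha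
  set a' : ℝ := (2 : ℝ) ^ max (-k) 0 with ha'
  have hr0 : 0 < r := by positivity
  have ha0 : 0 < a := by positivity
  have ha'0 : 0 < a' := by positivity
  have har : 0 < a * r := by positivity
  refine IsTent.tentBound (c := bif b then c + (n - 1) * (a * r) else c - (n + 1) * (a * r))
    (L := L + 3 * (a * r)) ⟨by positivity, fun I hI => ?_, ?_⟩
  · obtain ⟨J, ⟨hJ, hJs, ⟨hJ1, hJ2⟩, hJ3⟩, hv⟩ := exists_mem_of_tsum_indicator_ne_zero hI
    have h1 := right_sub_left_lt_of_mem_related hJ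
    have h2 := le_abs_left_sub_of_mem_related hJ
    have hI1 := le_max_left I.length J.length
    have hI2 := I.right_eq
    have hlen := length_eq_of_scale hJs
    rw [max_length_of_mem_related hJ, hlen] at h1 h2 hI1
    have h3 := J.left_le_right
    cases b
    · simp only [cond_false] at hJ3 ⊢
      rw [abs_of_nonpos (by linarith)] at h2
      constructor <;> linarith [h1.1, h1.2]
    · simp only [cond_true] at hJ3 ⊢
      rw [abs_of_nonneg (by linarith)] at h2
      constructor <;> linarith [h1.1, h1.2]
  · have e : ∀ I, ∑' J, (farFamily k n c L s b I).indicator v J =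
        ∑' J, (farFamily k n c L s b I).indicator
          ({J : DyadicInterval | J.scale = s}.indicator v) J := fun I => by
      refine tsum_congr fun J => ?_
      by_cases hJ : J ∈ farFamily k n c L s b I
      · rw [indicator_of_mem hJ, indicator_of_mem hJ,
          indicator_of_mem (show J ∈ {J : DyadicInterval | J.scale = s} from hJ.2.1)]
      · rw [indicator_of_notMem hJ, indicator_of_notMem hJ]
    have hR : ∀ I, farFamily k n c L s b I ⊆ related k n I := fun I J hJ => hJ.1
    have hN : ∀ I, ∑' J, (farFamily k n c L s b I).indicator (1 : DyadicInterval → ℝ≥0∞) J ≤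
        ENNReal.ofReal (min (6 * a) (2 * L / r)) := fun I => by
      rcases min_choice (6 * a) (2 * L / r) with h6 | h6
      · rw [h6]; exact tsum_indicator_subset_related_le hR I
      · rw [h6]
        refine (tsum_indicator_dyadic_le (s := s) (α := c) (β := c + L) (by linarith)
          (fun J hJ => hJ.2.1) fun J hJ => ⟨hJ.2.2.1.1, ?_⟩).trans ?_
        · have := J.left_le_right
          linarith [hJ.2.2.1.2]
        · refine ENNReal.ofReal_le_ofReal ?_
          rw [← hr, add_sub_cancel_left, mul_div_assoc]
          have : 1 ≤ L / r := (one_le_div hr0).2 hs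
          linarith
    rw [← ENNReal.rpow_two (x := _ ^ (1 / 2 : ℝ)), ← ENNReal.rpow_mul,
      show (1 / 2 : ℝ) * 2 = 1 by norm_num, ENNReal.rpow_one]
    simp_rw [e]
    calc ENNReal.ofReal (L + 3 * (a * r)) * ∑' I, (∑' J, (farFamily k n c L s b I).indicator
            ({J : DyadicInterval | J.scale = s}.indicator v) J) ^ 2
        ≤ ENNReal.ofReal (L + 3 * (a * r)) * (ENNReal.ofReal (min (6 * a) (2 * L / r)) *
            ENNReal.ofReal (6 * a') * ∑' m, v ⟨s, m⟩ ^ 2) := by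
          rw [← tsum_scale_indicator]
          gcongr
          exact tsum_sq_tsum_indicator_le hN (tsum_indicator_subset_related_le' hR) _
      _ = ENNReal.ofReal ((L + 3 * (a * r)) * (min (6 * a) (2 * L / r)) * (6 * a')) *
            ∑' m, v ⟨s, m⟩ ^ 2 := by
          rw [← mul_assoc, ← mul_assoc, ← ENNReal.ofReal_mul (by positivity),
            ← ENNReal.ofReal_mul (by positivity)]
      _ ≤ ENNReal.ofReal (72 * (a * a') * L) * ∑' m, v ⟨s, m⟩ ^ 2 := by
          refine mul_le_mul' (ENNReal.ofReal_le_ofReal ?_) le_rfl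
          have h1 := min_le_left (6 * a) (2 * L / r)
          have h2 := min_le_right (6 * a) (2 * L / r)
          rw [le_div_iff₀ hr0] at h2
          -- The first entry of the minimum is used against `L` and the second against `3 * (a *
          -- r)`; each contributes `6 * a * L`.
          have h3 : (L + 3 * (a * r)) * min (6 * a) (2 * L / r) ≤ 12 * a * L := by
            nlinarith [mul_le_mul_of_nonneg_left h1 hL.le, mul_le_mul_of_nonneg_left h2 ha0.le]
          nlinarith
      _ = _ := by rw [ENNReal.ofReal_mul (by positivity), mul_assoc]

/-- The source of the logarithm: taking logarithms to base `2` confines `s` to an interval of length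
`log₂ (n + 1) + max k 0`. The factor `2` comes from `1 / log 2 ≤ 2`. -/
theorem tsum_scales_le {L a : ℝ} (hL : 0 < L) (k : ℤ) (n : ℕ) (ha : a = (2 : ℝ) ^ max k 0) :
    ∑' s : ℤ, {s : ℤ | (2 : ℝ) ^ (-s) ≤ L ∧ L < (n + 1) * (a * (2 : ℝ) ^ (-s))}.indicator
      (1 : ℤ → ℝ≥0∞) s ≤ ENNReal.ofReal (2 * (Real.log (n + 1) + max (k : ℝ) 0 + 1)) := by
  have hlog2 : 0 < Real.log 2 := Real.log_pos (by norm_num)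
  have hn : 0 ≤ Real.log (n + 1) := Real.log_nonneg (by simp)
  have hk : (0 : ℝ) ≤ max (k : ℝ) 0 := le_max_right _ _
  refine (tsum_indicator_int_le (α := -Real.log L / Real.log 2)
    (β := -Real.log L / Real.log 2 + (Real.log (n + 1) / Real.log 2 + max (k : ℝ) 0)) ?_ ?_).trans ?_
  · have : 0 ≤ Real.log (n + 1) / Real.log 2 := by positivity
    linarith
  · rintro s ⟨h1, h2⟩
    have h3 := Real.log_le_log (by positivity) h1
    have h4 := Real.log_le_log hL h2.le
    rw [Real.log_mul (by positivity) (by rw [ha]; positivity), ha,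
      Real.log_mul (by positivity) (by positivity), Real.log_zpow, Real.log_zpow] at h4
    rw [Real.log_zpow] at h3
    push_cast at h3 h4
    rw [← add_assoc, ← add_div, div_le_iff₀ hlog2, div_add' _ _ _ hlog2.ne', le_div_iff₀ hlog2]
    constructor <;> linarith
  · refine ENNReal.ofReal_le_ofReal ?_
    have h5 := Real.log_two_gt_d9
    have h6 : Real.log (n + 1) / Real.log 2 ≤ 2 * Real.log (n + 1) := by
      rw [div_le_iff₀ hlog2]; nlinarith
    linarith

/-- The near part gives one tent and the far part two for each admissible scale. The squared far
masses sum to a multiple of `lam ^ 2` because different scales use disjoint parts of `v`, so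
Cauchy–Schwarz costs only the square root of the number of scales. -/
theorem IsTent.tentBound_relSum (h : IsTent c L lam v) (k : ℤ) (n : ℕ) :
    TentBound (relSum k n v) (ENNReal.ofReal (40 * transformRate k n) * lam) := by
  have hL := h.length_pos
  set a : ℝ := (2 : ℝ) ^ max k 0 with ha
  set a' : ℝ := (2 : ℝ) ^ max (-k) 0 with ha'
  set X : ℝ := Real.log (n + 1) + max (k : ℝ) 0 + 1 with hX
  have ha0 : 0 < a := by positivity
  have ha'0 : 0 < a' := by positivity
  have hX1 : 1 ≤ X := by
    have h1 : 0 ≤ Real.log (n + 1) := Real.log_nonneg (by simp)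
    have h2 : (0 : ℝ) ≤ max (k : ℝ) 0 := le_max_right _ _
    linarith
  set S : Set ℤ := {s : ℤ | (2 : ℝ) ^ (-s) ≤ L ∧ L < (n + 1) * (a * (2 : ℝ) ^ (-s))} with hS
  set m : ℤ → ℝ≥0∞ := fun s => (ENNReal.ofReal (72 * (a * a')) *
    (ENNReal.ofReal L * ∑' m, v ⟨s, m⟩ ^ 2)) ^ (1 / 2 : ℝ) with hm
  have hfar := TentBound.tsum (κ := S × Bool)
    (u := fun p I => ∑' J, (farFamily k n c L p.1 p.2 I).indicator v J) (m := fun p => m p.1)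
    (fun p => h.tentBound_far k n p.1.2.1 p.2) (fun I => le_rfl)
  have hmsq : ∀ s, m s ^ 2 = ENNReal.ofReal (72 * (a * a')) *
      (ENNReal.ofReal L * ∑' m, v ⟨s, m⟩ ^ 2) := fun s => by
    rw [hm, ← ENNReal.rpow_two, ← ENNReal.rpow_mul]; norm_num
  -- `576 = 4 * 2 * 72`: the square of the two sides, the factor in the count of scales, and the
  -- Schur constant of one scale.
  have hmsum : ∑' p : S × Bool, m p.1 ≤ ENNReal.ofReal √(576 * (a * a' * X)) * lam := by
    refine ENNReal.le_of_sq_le_ofReal_mul_sq (by positivity) ?_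
    rw [ENNReal.tsum_prod (f := fun (s : S) (_ : Bool) => m s)]
    simp only [tsum_bool]
    have h1 : ∀ s : S, m s + m s = 2 * m s := fun s => (two_mul _).symm
    simp_rw [h1]
    refine (ENNReal.sq_tsum_mul_le _ _).trans ?_
    simp_rw [hmsq]
    calc (∑' _ : S, (2 : ℝ≥0∞) ^ 2) * ∑' s : S, ENNReal.ofReal (72 * (a * a')) *
            (ENNReal.ofReal L * ∑' m, v ⟨s, m⟩ ^ 2)
        ≤ ENNReal.ofReal (4 * (2 * X)) * (ENNReal.ofReal (72 * (a * a')) * lam ^ 2) := by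
          gcongr
          · have h2 : ∀ s : S, (2 : ℝ≥0∞) ^ 2 = 4 * 1 := fun _ => by norm_num
            rw [tsum_congr h2, ENNReal.tsum_mul_left, ENNReal.ofReal_mul (by norm_num)]
            refine mul_le_mul' (by simp) ?_
            have := tsum_subtype S (1 : ℤ → ℝ≥0∞)
            simp only [Pi.one_apply] at this
            rw [this]
            exact tsum_scales_le hL k n ha
          · rw [ENNReal.tsum_mul_left, ENNReal.tsum_mul_left]
            refine mul_le_mul' le_rfl (le_trans (mul_le_mul' le_rfl ?_) h.sq_le)
            rw [DyadicInterval.tsum_eq]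
            exact ENNReal.tsum_comp_le_tsum_of_injective Subtype.val_injective
              (fun s : ℤ => ∑' m, v ⟨s, m⟩ ^ 2)
      _ = _ := by
          rw [← mul_assoc, ← ENNReal.ofReal_mul (by positivity)]
          congr 2; ring
  refine ((h.tentBound_near k n).add hfar).mono (fun I => ?_) ?_
  · rw [relSum, ENNReal.tsum_comm, ← ENNReal.tsum_add]
    refine ENNReal.tsum_le_tsum fun J => ?_
    by_cases hJ : J ∈ related k n I
    · rw [indicator_of_mem hJ]
      by_cases hv : v J = 0
      · rw [hv]; exact zero_le
      by_cases hnear : (n + 1) * ((2 : ℝ) ^ max k 0 * J.length) ≤ L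
      · rw [indicator_of_mem (show J ∈ {J | J ∈ related k n I ∧
          (n + 1) * ((2 : ℝ) ^ max k 0 * J.length) ≤ L} from ⟨hJ, hnear⟩)]
        exact le_self_add
      · have hsupp := h.supp J hv
        have hlen : J.length ≤ L := by have := J.right_eq; linarith [hsupp.1, hsupp.2]
        have hsS : J.scale ∈ S := ⟨hlen, not_le.1 hnear⟩
        refine le_add_left ?_
        rcases le_total J.left I.left with h1 | h1
        · refine le_trans ?_ (ENNReal.le_tsum (⟨⟨J.scale, hsS⟩, true⟩ : S × Bool))
          rw [indicator_of_mem (show J ∈ farFamily k n c L J.scale true I from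
            ⟨hJ, rfl, hsupp, h1⟩)]
        · refine le_trans ?_ (ENNReal.le_tsum (⟨⟨J.scale, hsS⟩, false⟩ : S × Bool))
          rw [indicator_of_mem (show J ∈ farFamily k n c L J.scale false I from
            ⟨hJ, rfl, hsupp, h1⟩)]
    · rw [indicator_of_notMem hJ]; exact zero_le
  · have haa : a * a' = ((2 : ℝ) ^ (|(k : ℝ)| / 2)) ^ 2 := by
      rw [ha, ha', ← zpow_add₀ (by norm_num), ← Real.rpow_natCast, ← Real.rpow_mul (by norm_num),
        ← Real.rpow_intCast]
      congr 1
      have : max k 0 + max (-k) 0 = |k| := by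
        rcases le_total 0 k with hk | hk
        · rw [max_eq_left hk, max_eq_right (by omega), abs_of_nonneg hk, add_zero]
        · rw [max_eq_right hk, max_eq_left (by omega), abs_of_nonpos hk, zero_add]
      rw [this]
      push_cast
      ring
    have hrate : transformRate k n = √(a * a' * X) := by
      rw [Real.sqrt_mul (by positivity), haa, Real.sqrt_sq (by positivity), transformRate,
        Real.sqrt_eq_rpow]
    refine (add_le_add le_rfl hmsum).trans ?_
    rw [← add_mul, ← ENNReal.ofReal_add (by positivity) (by positivity)]
    gcongr
    rw [hrate]
    have h1 : √(108 * (a * a')) ≤ 11 * √(a * a' * X) := by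
      rw [Real.sqrt_le_left (by positivity), mul_pow, Real.sq_sqrt (by positivity)]
      nlinarith [mul_pos ha0 ha'0]
    have h2 : √(576 * (a * a' * X)) = 24 * √(a * a' * X) := by
      rw [Real.sqrt_mul (by norm_num)]
      congr 1
      rw [show (576 : ℝ) = 24 ^ 2 by norm_num, Real.sqrt_sq (by norm_num)]
    have h3 := Real.sqrt_nonneg (a * a' * X)
    rw [h2]
    linarith

theorem TentBound.relSum {w : DyadicInterval → ℝ≥0∞} {M : ℝ≥0∞} (h : TentBound w M) (k : ℤ)
    (n : ℕ) : TentBound (relSum k n w) (ENNReal.ofReal (40 * transformRate k n) * M) := by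
  obtain ⟨ι, hι, c, L, lam, v, h1, h2, h3⟩ := h
  refine (TentBound.tsum (fun i => (h1 i).tentBound_relSum k n) fun I => ?_).mono
    (fun I => le_rfl) ?_
  · unfold _root_.relSum
    rw [ENNReal.tsum_comm]
    refine ENNReal.tsum_le_tsum fun J => ?_
    by_cases hJ : J ∈ related k n I
    · simp only [indicator_of_mem hJ]
      exact h2 J
    · simp only [indicator_of_notMem hJ]
      exact zero_le
  · rw [ENNReal.tsum_mul_left]
    exact mul_le_mul' le_rfl h3

/-- The tails of a sequence which is dominated by tents are dominated by tents of small mass. -/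
theorem TentBound.exists_finset {w : DyadicInterval → ℝ≥0∞} {M : ℝ≥0∞} (h : TentBound w M)
    (hM : M ≠ ∞) {ε : ℝ≥0∞} (hε : ε ≠ 0) :
    ∃ F₀ : Finset DyadicInterval, TentBound (fun I => if I ∈ F₀ then 0 else w I) ε := by
  obtain ⟨ι, hι, c, L, lam, v, h1, h2, h3⟩ := h
  obtain ⟨δ, hδ, hδε⟩ := ENNReal.exists_pos_sum_of_countable' (ε := ε / 2) (by simpa using hε) ι
  have hfin : ∑' i, lam i ≠ ∞ := ne_top_of_le_ne_top hM h3
  -- Finitely many tents carry all the mass up to `ε / 2`. From each of these a finite set of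
  -- intervals is removed, so that its remaining mass is at most `δ i`.
  obtain ⟨s, hs⟩ : ∃ s : Finset ι, ∑' i : { i // i ∉ s }, lam i ≤ ε / 2 :=
    ((ENNReal.tendsto_nhds_zero.1 (ENNReal.tendsto_tsum_compl_atTop_zero hfin)) (ε / 2)
      (by simpa [pos_iff_ne_zero] using hε)).exists
  have hF : ∀ i, ∃ F : Finset DyadicInterval,
      ENNReal.ofReal (L i) * ∑' I : { I // I ∉ F }, v i I ^ 2 ≤ δ i ^ 2 := by
    intro i
    have h5 : ∑' I, ENNReal.ofReal (L i) * v i I ^ 2 ≠ ∞ := by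
      rw [ENNReal.tsum_mul_left]
      exact ne_top_of_le_ne_top (ENNReal.pow_ne_top (ENNReal.ne_top_of_tsum_ne_top hfin i))
        (h1 i).sq_le
    obtain ⟨F, hF⟩ := ((ENNReal.tendsto_nhds_zero.1 (ENNReal.tendsto_tsum_compl_atTop_zero h5))
      (δ i ^ 2) (ENNReal.pow_pos (hδ i) 2)).exists
    rw [ENNReal.tsum_mul_left] at hF
    exact ⟨F, hF⟩
  choose F hF using hF
  classical
  refine ⟨s.biUnion F, ι, hι, c, L, fun i => if i ∈ s then δ i else lam i,
    fun i I => if I ∈ s.biUnion F then 0 else v i I, fun i => ⟨(h1 i).length_pos, fun I hI => ?_, ?_⟩,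
    fun I => ?_, ?_⟩
  · refine (h1 i).supp I fun h0 => hI ?_
    simp [h0]
  · by_cases hi : i ∈ s
    · simp only [hi, if_true]
      refine le_trans (mul_le_mul' le_rfl ?_) (hF i)
      refine le_trans ?_ (tsum_subtype {I | I ∉ F i} (fun I => v i I ^ 2)).ge
      refine ENNReal.tsum_le_tsum fun I => ?_
      by_cases hI : I ∈ s.biUnion F
      · simp [hI]
      · have : I ∉ F i := fun h => hI (Finset.mem_biUnion.2 ⟨i, hi, h⟩)
        rw [if_neg hI, indicator_of_mem (show I ∈ {I | I ∉ F i} from this)]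
    · simp only [hi, if_false]
      refine le_trans (mul_le_mul' le_rfl (ENNReal.tsum_le_tsum fun I => ?_)) (h1 i).sq_le
      split_ifs <;> simp
  · by_cases hI : I ∈ s.biUnion F
    · simp [hI]
    · simp only [hI, if_false]; exact h2 I
  · calc ∑' i, (if i ∈ s then δ i else lam i) ≤ ∑' i, (δ i + {i | i ∉ s}.indicator lam i) := by
          refine ENNReal.tsum_le_tsum fun i => ?_
          by_cases hi : i ∈ s
          · simp [hi]
          · simp [hi]
      _ ≤ ε / 2 + ε / 2 := by
          rw [ENNReal.tsum_add, ← tsum_subtype {i | i ∉ s} lam]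
          exact add_le_add hδε.le hs
      _ = ε := ENNReal.add_halves ε

end TentTransform

/-! ### Wavelet coefficients of atoms -/

theorem summable_int_of_natAbs {g : ℕ → ℝ} (hg : Summable g) : Summable fun j : ℤ => g j.natAbs :=
  Summable.of_nat_of_neg (by simpa using hg) (by simpa using hg)

theorem ENNReal.tsum_ofReal_shift_le {h g : ℤ → ℝ} (hg0 : ∀ j, 0 ≤ g j) (hg : Summable g) (j₀ : ℤ)
    (hh : ∀ j, h j ≤ g (j - j₀)) : ∑' j, ENNReal.ofReal (h j) ≤ ENNReal.ofReal (∑' j, g j) := by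
  rw [ENNReal.ofReal_tsum_of_nonneg hg0 hg,
    ← (Equiv.subRight j₀).tsum_eq (fun j => ENNReal.ofReal (g j))]
  exact ENNReal.tsum_le_tsum fun j => ENNReal.ofReal_le_ofReal (hh j)

/-- The decay `(2 + y) ^ (-3 / 2)`. -/
noncomputable def decayKernel (y : ℝ) : ℝ := 1 / ((2 + y) * √(2 + y))

theorem exists_tsum_decayKernel_le :
    ∃ C : ℝ, 0 ≤ C ∧ ∀ t : ℝ, ∑' m : ℤ, ENNReal.ofReal (decayKernel |m - t|) ≤ ENNReal.ofReal C := by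
  set g : ℕ → ℝ := fun j => ((j + 1 : ℕ) : ℝ) ^ (-(3 / 2) : ℝ) with hg
  have hgs : Summable g :=
    (summable_nat_add_iff 1).2 (Real.summable_nat_rpow.2 (by norm_num : (-(3 / 2) : ℝ) < -1))
  have hg0 : ∀ j, 0 ≤ g j := fun j => by positivity
  refine ⟨∑' j : ℤ, g j.natAbs, tsum_nonneg fun j => hg0 _, fun t => ?_⟩
  refine ENNReal.tsum_ofReal_shift_le (fun j => hg0 _) (summable_int_of_natAbs hgs) ⌊t⌋ fun m => ?_
  have e : g (m - ⌊t⌋).natAbs =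
      1 / ((((m - ⌊t⌋).natAbs + 1 : ℕ) : ℝ) * √(((m - ⌊t⌋).natAbs + 1 : ℕ) : ℝ)) := by
    have h0 : (0 : ℝ) < (((m - ⌊t⌋).natAbs + 1 : ℕ) : ℝ) := by positivity
    simp only [hg]
    rw [Real.rpow_neg h0.le, ← one_div, show (3 / 2 : ℝ) = 1 + 1 / 2 by norm_num,
      Real.rpow_add h0, Real.rpow_one, Real.sqrt_eq_rpow]
  -- The `2` in `decayKernel` pays for replacing `t` by its integer part and still leaves the `1`
  -- that keeps `g` away from zero.
  have h1 : (((m - ⌊t⌋).natAbs + 1 : ℕ) : ℝ) ≤ 2 + |m - t| := by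
    push_cast
    rw [Nat.cast_natAbs]
    push_cast
    have h2 := Int.floor_le t
    have h3 := Int.lt_floor_add_one t
    have h4 := abs_sub_le (m : ℝ) t ⌊t⌋
    have h5 : |t - ⌊t⌋| ≤ 1 := by rw [abs_le]; constructor <;> linarith
    linarith
  rw [e, decayKernel]
  gcongr

theorem exists_tsum_scale_le : ∃ C : ℝ, 0 ≤ C ∧ ∀ L : ℝ, 0 < L →
    ∑' s : ℤ, ENNReal.ofReal (min √((2 : ℝ) ^ (-s) / L) √(L / (2 : ℝ) ^ (-s))) ≤
      ENNReal.ofReal C := by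
  set θ : ℝ := √(1 / 2) with hθ
  have hθ1 : θ < 1 := by
    rw [hθ, Real.sqrt_lt' one_pos]; norm_num
  -- The factor `√2` covers the rounding of `L` to a power of two.
  set g : ℕ → ℝ := fun j => √2 * θ ^ j with hg
  have hgs : Summable g := (summable_geometric_of_lt_one (Real.sqrt_nonneg _) hθ1).mul_left _
  have hg0 : ∀ j, 0 ≤ g j := fun j => by positivity
  have hgsq : ∀ j : ℕ, g j = √(2 * (1 / 2) ^ j) := fun j => by
    rw [← Real.sqrt_sq (hg0 j)]
    congr 1
    simp only [hg, hθ]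
    rw [mul_pow, Real.sq_sqrt (by norm_num), ← pow_mul, mul_comm j 2, pow_mul,
      Real.sq_sqrt (by norm_num)]
  refine ⟨∑' j : ℤ, g j.natAbs, tsum_nonneg fun j => hg0 _, fun L hL => ?_⟩
  obtain ⟨n, hn1, hn2⟩ := exists_mem_Ioc_zpow hL (by norm_num : (1 : ℝ) < 2)
  refine ENNReal.tsum_ofReal_shift_le (fun j => hg0 _) (summable_int_of_natAbs hgs) (-n) fun s => ?_
  rw [hgsq]
  have h2 : (2 : ℝ) ≠ 0 := two_ne_zero
  rcases le_total 0 (s - -n) with h | h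
  · refine (min_le_left _ _).trans (Real.sqrt_le_sqrt ?_)
    rw [div_le_iff₀ hL]
    have e : (2 : ℝ) ^ (-s) = (1 / 2) ^ (s - -n).natAbs * 2 ^ n := by
      rw [← zpow_natCast, Int.natCast_natAbs, abs_of_nonneg h, one_div, inv_zpow, ← zpow_neg,
        ← zpow_add₀ h2]
      congr 1; ring
    rw [e]
    have : (0 : ℝ) < (1 / 2) ^ (s - -n).natAbs := by positivity
    nlinarith
  · refine (min_le_right _ _).trans (Real.sqrt_le_sqrt ?_)
    rw [div_le_iff₀ (by positivity)]
    have e : (2 : ℝ) ^ (n + 1) = 2 * (1 / 2) ^ (s - -n).natAbs * 2 ^ (-s) := by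
      rw [← zpow_natCast, Int.natCast_natAbs, abs_of_nonpos h, one_div, inv_zpow, ← zpow_neg,
        mul_assoc, ← zpow_add₀ h2, ← zpow_one_add₀ h2]
      congr 1; ring
    rw [← e]
    exact hn2

/-- The size of the wavelet coefficients of an atom of `[c, c + L]`. -/
noncomputable def tailKernel (c L : ℝ) (I : DyadicInterval) : ℝ :=
  min √(I.length / L) √(L / I.length) * decayKernel (|I.left - c| / I.length)

theorem exists_tsum_tailKernel_le : ∃ C : ℝ, 0 ≤ C ∧ ∀ c L : ℝ, 0 < L →
    ∑' I, ENNReal.ofReal (tailKernel c L I) ≤ ENNReal.ofReal C := by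
  obtain ⟨C₁, hC₁, h₁⟩ := exists_tsum_decayKernel_le
  obtain ⟨C₂, hC₂, h₂⟩ := exists_tsum_scale_le
  refine ⟨C₂ * C₁, by positivity, fun c L hL => ?_⟩
  rw [DyadicInterval.tsum_eq]
  calc ∑' s : ℤ, ∑' m : ℤ, ENNReal.ofReal (tailKernel c L ⟨s, m⟩)
      ≤ ∑' s : ℤ, ENNReal.ofReal (min √((2 : ℝ) ^ (-s) / L) √(L / (2 : ℝ) ^ (-s))) *
          ENNReal.ofReal C₁ := by
        refine ENNReal.tsum_le_tsum fun s => ?_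
        refine le_trans (le_of_eq ?_) (mul_le_mul' le_rfl (h₁ (c / (2 : ℝ) ^ (-s))))
        rw [← ENNReal.tsum_mul_left]
        refine tsum_congr fun m => ?_
        rw [← ENNReal.ofReal_mul (by positivity)]
        have hr : (0 : ℝ) < 2 ^ (-s) := by positivity
        congr 1
        simp only [tailKernel, DyadicInterval.left, DyadicInterval.length]
        congr 2
        symm
        rw [← abs_of_pos hr, ← abs_div, abs_of_pos hr, sub_div, mul_div_cancel_right₀ _ hr.ne']
    _ ≤ ENNReal.ofReal C₂ * ENNReal.ofReal C₁ := by
        rw [ENNReal.tsum_mul_right]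
        exact mul_le_mul' (h₂ L hL) le_rfl
    _ = _ := (ENNReal.ofReal_mul hC₂).symm

/-- Half a power of the quadratic decay is traded for `√q`, which is summable over scales when `q =
|I| / L`. The remaining exponent `3 / 2` is still summable over positions. -/
theorem one_div_sq_le_decayKernel {y q : ℝ} (hy : 0 ≤ y) (hq : 0 < q) (h : 1 / q ≤ 2 + y) :
    1 / (2 + y) ^ 2 ≤ √q * decayKernel y := by
  have h2 : 0 < 2 + y := by linarith
  have hs := Real.sqrt_pos.2 h2
  have h3 : 1 ≤ √q * √(2 + y) := by
    rw [← Real.sqrt_mul hq.le, Real.one_le_sqrt]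
    rwa [div_le_iff₀ hq, mul_comm] at h
  have h4 : √(2 + y) * √(2 + y) = 2 + y := Real.mul_self_sqrt h2.le
  rw [decayKernel, mul_one_div, div_le_div_iff₀ (by positivity) (by positivity), one_mul]
  calc (2 + y) * √(2 + y) ≤ (2 + y) * √(2 + y) * (√q * √(2 + y)) :=
        le_mul_of_one_le_right (by positivity) h3
    _ = √q * (2 + y) * (√(2 + y) * √(2 + y)) := by ring
    _ = √q * (2 + y) ^ 2 := by rw [h4]; ring

theorem decayKernel_pos {y : ℝ} (hy : 0 ≤ y) : 0 < decayKernel y := by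
  unfold decayKernel; positivity

theorem tailKernel_of_le {c L : ℝ} {I : DyadicInterval} (h : I.length ≤ L) :
    tailKernel c L I = √(I.length / L) * decayKernel (|I.left - c| / I.length) := by
  have hr := I.length_pos
  rw [tailKernel, min_eq_left]
  refine Real.sqrt_le_sqrt ?_
  exact ((div_le_one (hr.trans_le h)).2 h).trans ((one_le_div hr).2 h)

theorem tailKernel_of_ge {c L : ℝ} (hL : 0 < L) {I : DyadicInterval} (h : L ≤ I.length) :
    tailKernel c L I = √(L / I.length) * decayKernel (|I.left - c| / I.length) := by
  have hr := I.length_pos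
  rw [tailKernel, min_eq_right]
  refine Real.sqrt_le_sqrt ?_
  exact ((div_le_one hr).2 h).trans ((one_le_div hL).2 h)

/-- There are two regimes. A short interval outside the enlargement is far from `[c, c + L]` and the
wavelet itself is small there, so `w = 0`. A long one has a wavelet that hardly varies on `[c, c +
L]`, so `w` is its value at `c`. Subtracting `w` is free against an atom, which has mean zero. -/
theorem HasDecay.exists_norm_sub_le_tailKernel {ψ : ℝ → ℂ} {D : ℝ} (hD : HasDecay ψ D) {c L : ℝ}
    (hL : 0 < L) {I : DyadicInterval} (hI : ¬(c - 2 * L ≤ I.left ∧ I.right ≤ c - 2 * L + 5 * L)) :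
    ∃ w : ℂ, ∀ x ∈ Icc c (c + L),
      √I.length * ‖waveletFn ψ I x - w‖ ≤ 4 * D * tailKernel c L I := by
  have hr := I.length_pos
  have hD0 := hD.pos
  set y := |I.left - c| / I.length with hy
  have hy0 : 0 ≤ y := by positivity
  rcases le_total I.length L with h | h
  · refine ⟨0, fun x hx => ?_⟩
    have hfar : 2 * L ≤ |I.left - c| ∧ |I.left - c| / 2 ≤ |x - I.left| := by
      rw [I.right_eq, not_and_or, not_le, not_le] at hI
      rcases hI with hI | hI
      · rw [abs_of_neg (by linarith), abs_of_pos (by linarith [hx.1])]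
        constructor <;> linarith [hx.1]
      · rw [abs_of_pos (by linarith), abs_of_neg (by linarith [hx.2])]
        constructor <;> linarith [hx.2]
    rw [sub_zero]
    refine (hD.norm_waveletFn_le I x).trans ?_
    rw [tailKernel_of_le h, ← hy]
    have h1 : y / 2 ≤ |x - I.left| / I.length := by
      rw [hy, div_div, mul_comm, ← div_div]
      exact div_le_div_of_nonneg_right hfar.2 hr.le
    have h2 : 1 / (I.length / L) ≤ 2 + y := by
      rw [one_div_div, hy]
      have : L / I.length ≤ |I.left - c| / I.length := by gcongr; linarith [hfar.1]
      linarith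
    have h3 := one_div_sq_le_decayKernel hy0 (by positivity) h2
    calc D / (2 + |x - I.left| / I.length) ^ 2 ≤ D / ((2 + y) / 2) ^ 2 := by
          gcongr; linarith
      _ = 4 * D * (1 / (2 + y) ^ 2) := by field_simp; norm_num
      _ ≤ _ := by gcongr
  · refine ⟨waveletFn ψ I c, fun x hx => ?_⟩
    have hxc : |x - c| ≤ L := by rw [abs_le]; constructor <;> linarith [hx.1, hx.2]
    refine (hD.norm_waveletFn_sub_le I (z := y) hy0 fun t ht => ?_).trans ?_
    · have htc : |t - c| ≤ I.length := by
        rw [uIcc_of_ge hx.1] at ht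
        rw [abs_le]; constructor <;> linarith [hx.1, hx.2, ht.1, ht.2]
      rw [hy, div_le_iff₀ hr, add_mul, div_mul_cancel₀ _ hr.ne', one_mul]
      have := abs_sub_le I.left t c
      rw [abs_sub_comm I.left t] at this
      linarith
    · rw [tailKernel_of_ge hL h, ← hy]
      have h1 : |x - c| / I.length ≤ L / I.length := by gcongr
      have h2 : L / I.length ≤ √(L / I.length) := by
        rw [Real.le_sqrt (by positivity) (by positivity), sq]
        exact mul_le_of_le_one_right (by positivity) ((div_le_one hr).2 h)
      have h3 := one_div_sq_le_decayKernel hy0 one_pos (by linarith)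
      rw [Real.sqrt_one, one_mul] at h3
      calc D / (1 + y) ^ 2 * (|x - c| / I.length) ≤ D / ((2 + y) / 2) ^ 2 * √(L / I.length) := by
            gcongr
            · linarith
            · exact h1.trans h2
        _ = 4 * D * (√(L / I.length) * (1 / (2 + y) ^ 2)) := by field_simp; norm_num
        _ ≤ _ := by gcongr

theorem IsHardyAtom.conj {a : ℝ → ℂ} (ha : IsHardyAtom a) : IsHardyAtom fun x => conj (a x) := by
  obtain ⟨c, d, hcd, hs, hm, hn, h0⟩ := ha
  have e : eLpNorm (fun x => conj (a x)) 2 volume = eLpNorm a 2 volume :=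
    eLpNorm_congr_norm_ae (Eventually.of_forall fun x => RCLike.norm_conj _)
  refine ⟨c, d, hcd, fun x hx => hs ?_, ⟨?_, e.trans_lt hm.2⟩, e.trans_le hn, ?_⟩
  · simpa using hx
  · exact Complex.continuous_conj.comp_aestronglyMeasurable hm.1
  · rw [integral_conj, h0, map_zero]

/-- The wavelet coefficients of atoms are dominated by tents of bounded mass. -/
theorem IsWavelet.exists_tentBound_atom {ψ : ℝ → ℂ} (hψ : IsWavelet ψ) : ∃ C : ℝ, 0 ≤ C ∧
    ∀ a, IsHardyAtom a → TentBound (fun I => ‖waveletCoeff ψ a I‖ₑ) (ENNReal.ofReal C) := by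
  obtain ⟨D, hD⟩ := hψ.exists_decay
  obtain ⟨C, hC, hsum⟩ := exists_tsum_tailKernel_le
  have hD0 := hD.pos
  refine ⟨3 + 4 * D * C, by positivity, fun a ha => ?_⟩
  have hint := ha.integrable
  have hone := ha.lintegral_enorm_le_one
  obtain ⟨c, d, hcd, hs, hm, hn, h0⟩ := ha
  set L := d - c with hL
  have hL0 : 0 < L := sub_pos.2 hcd
  set N : Set DyadicInterval := {I | c - 2 * L ≤ I.left ∧ I.right ≤ c - 2 * L + 5 * L} with hN
  -- Near the support only Bessel's inequality is used: the enlarged interval has length `5 * L`,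
  -- and `5 ≤ 3 ^ 2`.
  have hnear : TentBound (N.indicator fun I => ‖waveletCoeff ψ a I‖ₑ) (ENNReal.ofReal 3) := by
    refine IsTent.tentBound (c := c - 2 * L) (L := 5 * L) ⟨by positivity, fun I hI => ?_, ?_⟩
    · have : I ∈ N := mem_of_indicator_ne_zero hI
      exact this
    · calc ENNReal.ofReal (5 * L) * ∑' I, N.indicator (fun I => ‖waveletCoeff ψ a I‖ₑ) I ^ 2
          ≤ ENNReal.ofReal (5 * L) * ENNReal.ofReal (L ^ (-(1 / 2) : ℝ)) ^ 2 := by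
            refine mul_le_mul' le_rfl ?_
            refine le_trans (ENNReal.tsum_le_tsum fun I => ?_)
              ((hψ.bessel hm).trans ((enorm_sq_eLpNorm_two a).symm.trans_le
                (pow_le_pow_left₀ zero_le hn 2)))
            gcongr
            exact indicator_le_self _ _ I
        _ ≤ ENNReal.ofReal 3 ^ 2 := by
            rw [← ENNReal.ofReal_pow (by positivity), ← ENNReal.ofReal_mul (by positivity),
              ← ENNReal.ofReal_pow (by norm_num), ← Real.rpow_natCast (L ^ (-(1 / 2) : ℝ)),
              ← Real.rpow_mul hL0.le]
            refine ENNReal.ofReal_le_ofReal ?_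
            norm_num
            rw [Real.rpow_neg_one, mul_assoc, mul_inv_cancel₀ hL0.ne']
            norm_num
  have hfar := tentBound_tsum (Nᶜ.indicator fun I => ‖waveletCoeff ψ a I‖ₑ)
  have hfarsum : ∑' I, ENNReal.ofReal √I.length *
      Nᶜ.indicator (fun I => ‖waveletCoeff ψ a I‖ₑ) I ≤ ENNReal.ofReal (4 * D * C) := by
    rw [ENNReal.ofReal_mul (by positivity)]
    refine le_trans ?_ (mul_le_mul' le_rfl (hsum c L hL0))
    rw [← ENNReal.tsum_mul_left]
    refine ENNReal.tsum_le_tsum fun I => ?_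
    by_cases hI : I ∈ N
    · rw [indicator_of_notMem (by simpa using hI), mul_zero]; exact zero_le
    · rw [indicator_of_mem (by simpa using hI)]
      obtain ⟨w, hw⟩ := hD.exists_norm_sub_le_tailKernel hL0 hI
      have hb := hD.exists_bound_waveletFn I
      obtain ⟨B, hB⟩ := hb
      have hcont := hD.continuous_waveletFn I
      have e : waveletCoeff ψ a I = ∫ x, a x * conj (waveletFn ψ I x - w) := by
        have i1 : Integrable fun x => a x * conj (waveletFn ψ I x) :=
          hint.mul_bdd (c := B) (Complex.continuous_conj.comp hcont).aestronglyMeasurable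
            (Eventually.of_forall fun x => by rw [RCLike.norm_conj]; exact hB x)
        simp_rw [map_sub, mul_sub]
        rw [integral_sub i1 (hint.mul_const _), integral_mul_const, h0, zero_mul, sub_zero]
        rfl
      rw [← ENNReal.ofReal_mul (by positivity)]
      calc ENNReal.ofReal √I.length * ‖waveletCoeff ψ a I‖ₑ
          ≤ ENNReal.ofReal √I.length * ∫⁻ x, ‖a x * conj (waveletFn ψ I x - w)‖ₑ := by
            rw [e]; gcongr; exact enorm_integral_le_lintegral_enorm _
        _ = ∫⁻ x, ENNReal.ofReal √I.length * ‖a x * conj (waveletFn ψ I x - w)‖ₑ :=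
            (lintegral_const_mul' _ _ ENNReal.ofReal_ne_top).symm
        _ ≤ ∫⁻ x, ENNReal.ofReal (4 * D * tailKernel c L I) * ‖a x‖ₑ := by
            refine lintegral_mono fun x => ?_
            by_cases hx : a x = 0
            · simp [hx]
            · have hxs : x ∈ Icc c (c + L) := by
                have := hs hx
                rwa [hL, add_sub_cancel]
              rw [enorm_mul, mul_left_comm, mul_comm (ENNReal.ofReal _) ‖a x‖ₑ]
              gcongr
              rw [← ofReal_norm, ← ENNReal.ofReal_mul (by positivity), RCLike.norm_conj]
              exact ENNReal.ofReal_le_ofReal (hw x hxs)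
        _ ≤ _ := by
            rw [lintegral_const_mul' _ _ ENNReal.ofReal_ne_top]
            exact mul_le_of_le_one_right zero_le hone
  refine (hnear.add hfar).mono (fun I => ?_) ?_
  · by_cases hI : I ∈ N
    · rw [indicator_of_mem hI]; exact le_self_add
    · rw [indicator_of_notMem hI, indicator_of_mem (by simpa using hI)]; exact le_add_self
  · rw [ENNReal.ofReal_add (by norm_num) (by positivity)]
    exact add_le_add le_rfl hfarsum

/-! ### Synthesis from tents, and the Carleson condition -/

theorem IsMolecule.conj {G : ℝ → ℂ} {c L b : ℝ} (hG : IsMolecule G c L b) :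
    IsMolecule (fun x => conj (G x)) c L b where
  length_pos := hG.length_pos
  pos := hG.pos
  aestronglyMeasurable := Complex.continuous_conj.comp_aestronglyMeasurable hG.aestronglyMeasurable
  lintegral_sq_le := by
    refine le_of_eq_of_le (lintegral_congr fun x => ?_) hG.lintegral_sq_le
    rw [RCLike.enorm_conj]
  norm_le x hx := by rw [RCLike.norm_conj]; exact hG.norm_le x hx
  integral_eq_zero := by rw [integral_conj, hG.integral_eq_zero, map_zero]

/-- Inside the tent, with `q = |I| / L ≤ 1`, the position satisfies `2 + y ≤ 3 / q`, so the kernel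
is at least `q ^ 2 / 6 ≥ q ^ 3 / 6`. The summability already proved for the kernel then bounds the
sum of `|I| ^ 3` over the tent. -/
theorem cube_length_le_tailKernel {c L : ℝ} {I : DyadicInterval} (hc : c ≤ I.left)
    (hL : I.right ≤ c + L) : I.length ^ 3 ≤ 6 * L ^ 3 * tailKernel c L I := by
  have hr := I.length_pos
  rw [I.right_eq] at hL
  have hrL : I.length ≤ L := by linarith
  have hL0 : 0 < L := hr.trans_le hrL
  rw [tailKernel_of_le hrL]
  set q := I.length / L with hq
  have hq0 : 0 < q := by positivity
  have hq1 : q ≤ 1 := (div_le_one hL0).2 hrL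
  set y := |I.left - c| / I.length with hy
  have hy0 : 0 ≤ y := by positivity
  have hyq : 2 + y ≤ 3 / q := by
    have h1 : y ≤ 1 / q := by
      rw [hy, hq, one_div_div, abs_of_nonneg (by linarith)]
      gcongr; linarith
    have h2 : 1 ≤ 1 / q := (one_le_div hq0).2 hq1
    have h3 : 3 / q = 3 * (1 / q) := by ring
    linarith
  have hsq := Real.sqrt_pos.2 hq0
  have hs := Real.sqrt_pos.2 (show 0 < 2 + y by linarith)
  have h1 : √(2 + y) ≤ 2 / √q := by
    rw [Real.sqrt_le_left (by positivity), div_pow, Real.sq_sqrt hq0.le]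
    refine hyq.trans ?_
    gcongr; norm_num
  have h2 : q ^ 2 / 6 ≤ √q * decayKernel y := by
    rw [decayKernel, mul_one_div, div_le_div_iff₀ (by norm_num) (by positivity)]
    calc q ^ 2 * ((2 + y) * √(2 + y)) ≤ q ^ 2 * (3 / q * (2 / √q)) := by gcongr
      _ = 6 * (q / √q) := by field_simp; norm_num
      _ = √q * 6 := by rw [Real.div_sqrt, mul_comm]
  have h3 : I.length = q * L := by rw [hq, div_mul_cancel₀ _ hL0.ne']
  rw [h3, mul_pow]
  have h4 : q ^ 3 ≤ q ^ 2 := pow_le_pow_of_le_one hq0.le hq1 (by norm_num)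
  calc q ^ 3 * L ^ 3 ≤ q ^ 2 * L ^ 3 := by gcongr
    _ = 6 * L ^ 3 * (q ^ 2 / 6) := by ring
    _ ≤ _ := by gcongr

theorem exists_sum_cube_length_le : ∃ C : ℝ, 0 ≤ C ∧ ∀ c L : ℝ, 0 < L →
    ∀ F : Finset DyadicInterval, (∀ I ∈ F, c ≤ I.left ∧ I.right ≤ c + L) →
      ∑ I ∈ F, I.length ^ 3 ≤ C * L ^ 3 := by
  obtain ⟨C, hC, h⟩ := exists_tsum_tailKernel_le
  refine ⟨6 * C, by positivity, fun c L hL F hF => ?_⟩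
  have hpos : ∀ I, 0 ≤ tailKernel c L I := fun I =>
    mul_nonneg (by positivity) (decayKernel_pos (div_nonneg (abs_nonneg _) I.length_pos.le)).le
  have h1 : ∑ I ∈ F, tailKernel c L I ≤ C := by
    rw [← ENNReal.ofReal_le_ofReal_iff hC, ENNReal.ofReal_sum_of_nonneg fun I _ => hpos I]
    exact (ENNReal.sum_le_tsum F).trans (h c L hL)
  calc ∑ I ∈ F, I.length ^ 3 ≤ ∑ I ∈ F, 6 * L ^ 3 * tailKernel c L I :=
        Finset.sum_le_sum fun I hI => cube_length_le_tailKernel (hF I hI).1 (hF I hI).2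
    _ = 6 * L ^ 3 * ∑ I ∈ F, tailKernel c L I := by rw [Finset.mul_sum]
    _ ≤ 6 * L ^ 3 * C := by gcongr
    _ = _ := by ring

/-- The quadratic decay, against the normalisation `|I| ^ (-1 / 2)`, leaves the power `|I| ^ (3 /
2)`. Its square is the cube that is summed over a tent. -/
theorem HasDecay.norm_waveletFn_le_of_far {ψ : ℝ → ℂ} {D : ℝ} (hD : HasDecay ψ D) {c L : ℝ}
    {I : DyadicInterval} (hc : c ≤ I.left) (hL : I.right ≤ c + L) {x : ℝ}
    (hx : 2 * L ≤ |x - c|) (hL0 : 0 < L) :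
    ‖waveletFn ψ I x‖ ≤ 4 * D / |x - c| ^ 2 * (I.length * √I.length) := by
  have hr := I.length_pos
  have hs := Real.sqrt_pos.2 hr
  have hD0 := hD.pos
  have hlr := I.left_le_right
  have h1 : |x - c| / 2 ≤ |x - I.left| := by
    have h2 := abs_sub_le x I.left c
    have h3 : |I.left - c| ≤ L := by rw [abs_le]; constructor <;> linarith
    linarith
  have hxc : 0 < |x - c| := by linarith
  have h2 := hD.norm_waveletFn_le I x
  have h3 : D / (2 + |x - I.left| / I.length) ^ 2 ≤ D / (|x - c| / 2 / I.length) ^ 2 := by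
    gcongr
    have : |x - c| / 2 / I.length ≤ |x - I.left| / I.length := by gcongr
    linarith
  have h4 : D / (|x - c| / 2 / I.length) ^ 2 = √I.length * (4 * D / |x - c| ^ 2 *
      (I.length * √I.length)) := by
    have e : √I.length * √I.length = I.length := Real.mul_self_sqrt hr.le
    calc D / (|x - c| / 2 / I.length) ^ 2 = 4 * D / |x - c| ^ 2 * I.length * I.length := by
          field_simp; norm_num
      _ = 4 * D / |x - c| ^ 2 * I.length * (√I.length * √I.length) := by rw [e]
      _ = _ := by ring
  rw [h4] at h3
  exact le_of_mul_le_mul_left (h2.trans h3) hs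

/-- Finite sums of wavelets with coefficients supported in a tent are molecules. -/
theorem IsWavelet.exists_isMolecule {ψ : ℝ → ℂ} (hψ : IsWavelet ψ) : ∃ C : ℝ, 0 < C ∧
    ∀ (c L l : ℝ) (F : Finset DyadicInterval) (u : DyadicInterval → ℂ), 0 < L → 0 < l →
      (∀ I ∈ F, c ≤ I.left ∧ I.right ≤ c + L) → L * ∑ I ∈ F, ‖u I‖ ^ 2 ≤ l ^ 2 →
      IsMolecule (fun x => ∑ I ∈ F, u I * waveletFn ψ I x) c L (C * l / L) := by
  obtain ⟨D, hD⟩ := hψ.exists_decay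
  obtain ⟨C, hC, hcube⟩ := exists_sum_cube_length_le
  have hD0 := hD.pos
  refine ⟨1 + 4 * D * √C, by positivity, fun c L l F u hL hl hF hu => ?_⟩
  have hu' : ∑ I ∈ F, ‖u I‖ ^ 2 ≤ l ^ 2 / L := by rw [le_div_iff₀ hL, mul_comm]; exact hu
  refine ⟨hL, by positivity, (hψ.memLp_sum_waveletFn F u).1, ?_, fun x hx => ?_, ?_⟩
  · rw [hψ.lintegral_enorm_sq_sum_waveletFn]
    have e : ∑ I ∈ F, ‖u I‖ₑ ^ 2 = ENNReal.ofReal (∑ I ∈ F, ‖u I‖ ^ 2) := by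
      rw [ENNReal.ofReal_sum_of_nonneg fun _ _ => by positivity]
      refine Finset.sum_congr rfl fun I _ => ?_
      rw [ENNReal.ofReal_pow (norm_nonneg _), ofReal_norm]
    rw [e]
    refine ENNReal.ofReal_le_ofReal (hu'.trans ?_)
    have h1 : 1 ≤ (1 + 4 * D * √C) ^ 2 := one_le_pow₀ (by
      have : 0 ≤ 4 * D * √C := by positivity
      linarith)
    calc l ^ 2 / L = 1 * (l ^ 2 / L) := (one_mul _).symm
      _ ≤ (1 + 4 * D * √C) ^ 2 * (l ^ 2 / L) := by gcongr
      _ = _ := by field_simp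
  · have hxc : 0 < |x - c| := by linarith
    have h1 : ‖∑ I ∈ F, u I * waveletFn ψ I x‖ ≤
        4 * D / |x - c| ^ 2 * ∑ I ∈ F, ‖u I‖ * (I.length * √I.length) := by
      rw [Finset.mul_sum]
      refine (norm_sum_le _ _).trans (Finset.sum_le_sum fun I hI => ?_)
      rw [norm_mul, mul_left_comm]
      gcongr
      exact hD.norm_waveletFn_le_of_far (hF I hI).1 (hF I hI).2 hx hL
    -- Cauchy–Schwarz, with the `ℓ²` bound on `u` and the sum of cubes over the tent.
    have h2 : ∑ I ∈ F, ‖u I‖ * (I.length * √I.length) ≤ √C * l * L := by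
      refine abs_le_of_sq_le_sq' ?_ (by positivity) |>.2
      refine (Finset.sum_mul_sq_le_sq_mul_sq _ _ _).trans ?_
      have e : ∀ I ∈ F, (I.length * √I.length) ^ 2 = I.length ^ 3 := fun I _ => by
        rw [mul_pow, Real.sq_sqrt I.length_pos.le]; ring
      rw [Finset.sum_congr rfl e]
      calc (∑ I ∈ F, ‖u I‖ ^ 2) * ∑ I ∈ F, I.length ^ 3 ≤ l ^ 2 / L * (C * L ^ 3) := by
            gcongr
            · exact Finset.sum_nonneg fun I _ => pow_nonneg I.length_pos.le 3
            · exact hcube c L hL F hF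
        _ = (√C * l * L) ^ 2 := by
            rw [mul_pow, mul_pow, Real.sq_sqrt hC]; field_simp
    refine h1.trans ?_
    calc 4 * D / |x - c| ^ 2 * ∑ I ∈ F, ‖u I‖ * (I.length * √I.length)
        ≤ 4 * D / |x - c| ^ 2 * (√C * l * L) := by gcongr
      _ = 4 * D * √C * l / L * L ^ 2 / |x - c| ^ 2 := by field_simp
      _ ≤ _ := by
          gcongr
          linarith
  · rw [integral_finsetSum _ fun I _ => (hD.integrable_waveletFn I).const_mul _]
    refine Finset.sum_eq_zero fun I _ => ?_
    rw [integral_const_mul, hψ.integral_waveletFn, mul_zero]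

/-- Synthesis: finite wavelet sums with coefficients dominated by tents belong to `H¹`. -/
theorem IsWavelet.exists_h1ENorm_sum_le {ψ : ℝ → ℂ} (hψ : IsWavelet ψ) : ∃ C : ℝ, 0 < C ∧
    ∀ (u : DyadicInterval → ℂ) (w : DyadicInterval → ℝ≥0∞) (M : ℝ≥0∞) (F : Finset DyadicInterval),
      TentBound w M → M ≠ ∞ → (∀ I ∈ F, ‖u I‖ₑ ≤ w I) →
      h1ENorm (fun x => ∑ I ∈ F, u I * waveletFn ψ I x) ≤ ENNReal.ofReal C * M := by
  obtain ⟨C, hC, hmol⟩ := hψ.exists_isMolecule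
  have single : ∀ (c L : ℝ) (lam : ℝ≥0∞) (v : DyadicInterval → ℝ≥0∞) (u : DyadicInterval → ℂ)
      (F : Finset DyadicInterval), IsTent c L lam v → lam ≠ ∞ → (∀ I ∈ F, ‖u I‖ₑ ≤ v I) →
      h1ENorm (fun x => ∑ I ∈ F, u I * waveletFn ψ I x) ≤ ENNReal.ofReal (31 * C) * lam := by
    intro c L lam v u F hv hlam hu
    have hL := hv.length_pos
    have hF : ∀ x, ∑ I ∈ F, u I * waveletFn ψ I x =
        ∑ I ∈ F with u I ≠ 0, u I * waveletFn ψ I x := fun x =>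
      (Finset.sum_filter_of_ne fun I _ h => left_ne_zero_of_mul h).symm
    simp_rw [hF]
    have hsupp : ∀ I ∈ Finset.filter (fun I => u I ≠ 0) F, c ≤ I.left ∧ I.right ≤ c + L := by
      intro I hI
      rw [Finset.mem_filter] at hI
      refine hv.supp I fun h0 => hI.2 ?_
      have := hu I hI.1
      rwa [h0, nonpos_iff_eq_zero, enorm_eq_zero] at this
    have hsq : ENNReal.ofReal (L * ∑ I ∈ F with u I ≠ 0, ‖u I‖ ^ 2) ≤ lam ^ 2 := by
      refine le_trans ?_ hv.sq_le
      rw [ENNReal.ofReal_mul hL.le, ENNReal.ofReal_sum_of_nonneg fun _ _ => by positivity]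
      refine mul_le_mul' le_rfl (le_trans (Finset.sum_le_sum fun I hI => ?_)
        (ENNReal.sum_le_tsum (Finset.filter (fun I => u I ≠ 0) F)))
      rw [ENNReal.ofReal_pow (norm_nonneg _), ofReal_norm]
      gcongr
      exact hu I (Finset.mem_filter.1 hI).1
    rcases eq_or_ne lam 0 with h0 | h0
    · have hz : ∀ I ∈ Finset.filter (fun I => u I ≠ 0) F, False := by
        intro I hI
        rw [h0, zero_pow two_ne_zero, nonpos_iff_eq_zero, ENNReal.ofReal_eq_zero] at hsq
        have h1 := Finset.single_le_sum (f := fun I => ‖u I‖ ^ 2) (fun I _ => by positivity) hI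
        have h2 : 0 < ‖u I‖ ^ 2 := by
          have := (Finset.mem_filter.1 hI).2
          positivity
        nlinarith
      rw [Finset.eq_empty_of_forall_notMem fun I hI => hz I hI]
      simp [h1ENorm_zero]
    · have hl : 0 < lam.toReal := ENNReal.toReal_pos h0 hlam
      have hm := hmol c L lam.toReal _ u hL hl hsupp (by
        rw [← ENNReal.ofReal_le_ofReal_iff (by positivity), ENNReal.ofReal_pow hl.le,
          ENNReal.ofReal_toReal hlam]
        exact hsq)
      refine hm.h1ENorm_le.trans (le_of_eq ?_)
      rw [← ENNReal.ofReal_toReal hlam, ← ENNReal.ofReal_mul (by positivity),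
        ENNReal.toReal_ofReal hl.le]
      congr 1
      field_simp
  refine ⟨31 * C, by positivity, fun u w M F ⟨ι, hι, c, L, lam, v, h1, h2, h3⟩ hM hu => ?_⟩
  have hlam : ∑' i, lam i ≠ ∞ := ne_top_of_le_ne_top hM h3
  set V : DyadicInterval → ℝ≥0∞ := fun I => ∑' i, v i I with hV
  -- An interval in the support of a tent has length at most `L i`, so `√|I| * v i I ≤ lam i`.
  -- Finiteness of `V` makes the quotients below meaningful.
  have hVtop : ∀ I, V I ≠ ∞ := by
    intro I htop
    have hr := I.length_pos
    have h4 : ∑' i, ENNReal.ofReal √I.length * v i I ≤ ∑' i, lam i := by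
      refine ENNReal.tsum_le_tsum fun i => ?_
      by_cases hv : v i I = 0
      · rw [hv, mul_zero]; exact zero_le
      · rw [← ENNReal.pow_le_pow_left_iff two_ne_zero, mul_pow,
          ← ENNReal.ofReal_pow (Real.sqrt_nonneg _), Real.sq_sqrt hr.le]
        refine le_trans ?_ (h1 i).sq_le
        have h5 := (h1 i).supp I hv
        rw [I.right_eq] at h5
        exact mul_le_mul' (ENNReal.ofReal_le_ofReal (by linarith))
          (ENNReal.le_tsum (f := fun I => v i I ^ 2) I)
    rw [ENNReal.tsum_mul_left] at h4
    change ENNReal.ofReal √I.length * V I ≤ _ at h4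
    rw [htop, ENNReal.mul_top (by
      rw [Ne, ENNReal.ofReal_eq_zero, not_le]; exact Real.sqrt_pos.2 hr)] at h4
    exact hlam (top_le_iff.1 h4)
  -- The coefficients are split among the tents in proportion to `v i I / V I`, so that each piece
  -- is dominated by its own tent.
  set q : ι → DyadicInterval → ℝ≥0∞ := fun i I => v i I / V I with hq
  have hqsum : ∀ I, V I ≠ 0 → ∑' i, q i I = 1 := fun I hI => by
    simp only [hq, div_eq_mul_inv]
    rw [ENNReal.tsum_mul_right]
    exact ENNReal.mul_inv_cancel hI (hVtop I)
  have hsum : ∀ I ∈ F, HasSum (fun i => u I * (((q i I).toReal : ℝ) : ℂ)) (u I) := by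
    intro I hI
    by_cases hI0 : V I = 0
    · have : u I = 0 := by
        have := (hu I hI).trans (h2 I)
        rw [show ∑' i, v i I = V I from rfl, hI0, nonpos_iff_eq_zero, enorm_eq_zero] at this
        exact this
      simp [this, hasSum_zero]
    · have h5 : HasSum (fun i => (q i I).toReal) 1 := by
        have h6 := ENNReal.hasSum_toReal (f := fun i => q i I) (by rw [hqsum I hI0]; simp)
        have h7 := ENNReal.tsum_toReal_eq (f := fun i => q i I)
          (ENNReal.ne_top_of_tsum_ne_top (by rw [hqsum I hI0]; simp))
        rw [← h7, hqsum I hI0] at h6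
        simpa using h6
      have h7 := (Complex.hasSum_ofReal.2 h5).mul_left (u I)
      simpa using h7
  have hbound : ∀ i, h1ENorm (fun x => ∑ I ∈ F, u I * (((q i I).toReal : ℝ) : ℂ) *
      waveletFn ψ I x) ≤ ENNReal.ofReal (31 * C) * lam i := by
    intro i
    refine single (c i) (L i) (lam i) (v i) (fun I => u I * (((q i I).toReal : ℝ) : ℂ)) F (h1 i)
      (ENNReal.ne_top_of_tsum_ne_top hlam i) fun I hI => ?_
    rw [enorm_mul, ← ofReal_norm (((q i I).toReal : ℝ) : ℂ), Complex.norm_real,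
      Real.norm_of_nonneg ENNReal.toReal_nonneg]
    calc ‖u I‖ₑ * ENNReal.ofReal (q i I).toReal ≤ V I * (v i I / V I) :=
          mul_le_mul' ((hu I hI).trans (h2 I)) ENNReal.ofReal_toReal_le
      _ ≤ v i I := ENNReal.mul_div_le
  refine (h1ENorm_le_tsum (G := fun i x => ∑ I ∈ F, u I * (((q i I).toReal : ℝ) : ℂ) *
    waveletFn ψ I x) (Eventually.of_forall fun x => ?_)).trans
    ((ENNReal.tsum_le_tsum hbound).trans ?_)
  · exact hasSum_sum fun I hI => (hsum I hI).mul_right (waveletFn ψ I x)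
  · rw [ENNReal.tsum_mul_left]
    exact mul_le_mul' le_rfl h3

/-- The Carleson condition for the wavelet coefficients of functions in `BMO`. -/
theorem IsWavelet.exists_carleson {ψ : ℝ → ℂ} (hψ : IsWavelet ψ) : ∃ C : ℝ, 0 < C ∧
    ∀ (f : ℝ → ℂ) (B : ℝ), LocallyIntegrable f → OscBound f B →
      ∀ c L : ℝ, 0 < L → ∑' I, {I : DyadicInterval | c ≤ I.left ∧ I.right ≤ c + L}.indicator
        (fun I => ‖waveletCoeff ψ f I‖ₑ ^ 2) I ≤ ENNReal.ofReal ((C * B) ^ 2 * L) := by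
  obtain ⟨C, hC, hmol⟩ := hψ.exists_isMolecule
  refine ⟨41 * C, by positivity, fun f B hf hB c L hL => ?_⟩
  have hB0 := hB.nonneg
  set A : Set DyadicInterval := {I : DyadicInterval | c ≤ I.left ∧ I.right ≤ c + L} with hA
  -- A single wavelet is a molecule, hence the integral that defines a coefficient of a `BMO`
  -- function converges absolutely.
  have hint : ∀ I, Integrable fun x => f x * conj (waveletFn ψ I x) := by
    intro I
    have hr := I.length_pos
    have h1 := hmol I.left I.length (√I.length) {I} (fun _ => 1) hr (Real.sqrt_pos.2 hr)
      (fun J hJ => by rw [Finset.mem_singleton.1 hJ]; exact ⟨le_rfl, I.right_eq.le⟩)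
      (by rw [Real.sq_sqrt hr.le]; simp)
    have h2 := (h1.conj.integrable_mul_and_norm_integral_le hf hB).1
    simpa using h2
  rw [ENNReal.tsum_eq_iSup_sum]
  refine iSup_le fun F' => ?_
  classical
  set F := F'.filter (· ∈ A) with hF
  have e1 : ∑ I ∈ F', A.indicator (fun I => ‖waveletCoeff ψ f I‖ₑ ^ 2) I =
      ENNReal.ofReal (∑ I ∈ F, ‖waveletCoeff ψ f I‖ ^ 2) := by
    rw [ENNReal.ofReal_sum_of_nonneg fun _ _ => by positivity, hF, Finset.sum_filter]
    refine Finset.sum_congr rfl fun I _ => ?_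
    by_cases hI : I ∈ A
    · rw [indicator_of_mem hI, if_pos hI, ENNReal.ofReal_pow (norm_nonneg _), ofReal_norm]
    · rw [indicator_of_notMem hI, if_neg hI]
  rw [e1]
  refine ENNReal.ofReal_le_ofReal ?_
  set X := ∑ I ∈ F, ‖waveletCoeff ψ f I‖ ^ 2 with hX
  have hX0 : 0 ≤ X := Finset.sum_nonneg fun _ _ => by positivity
  rcases hX0.eq_or_lt with h0 | h0
  · rw [← h0]; positivity
  have hLX : 0 < L * X := mul_pos hL h0
  -- Pairing `f` with the conjugate of the molecule built from its own coefficients gives exactly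
  -- `X`. The molecule bound then reads `X ≤ 41 * C * B * √(L * X)`, which is solved for `X`.
  have hG := hmol c L (√(L * X)) F (waveletCoeff ψ f) hL (Real.sqrt_pos.2 hLX)
    (fun I hI => (Finset.mem_filter.1 hI).2) (by rw [Real.sq_sqrt hLX.le])
  have h1 := (hG.conj.integrable_mul_and_norm_integral_le hf hB).2
  have e2 : ∫ x, f x * conj (∑ I ∈ F, waveletCoeff ψ f I * waveletFn ψ I x) = (X : ℂ) := by
    have e3 : ∀ x, f x * conj (∑ I ∈ F, waveletCoeff ψ f I * waveletFn ψ I x) =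
        ∑ I ∈ F, conj (waveletCoeff ψ f I) * (f x * conj (waveletFn ψ I x)) := fun x => by
      rw [map_sum, Finset.mul_sum]
      refine Finset.sum_congr rfl fun I _ => ?_
      rw [map_mul]; ring
    simp_rw [e3]
    rw [integral_finsetSum _ fun I _ => (hint I).const_mul _, hX]
    push_cast
    refine Finset.sum_congr rfl fun I _ => ?_
    rw [integral_const_mul, ← Complex.conj_mul']
    rfl
  rw [e2, Complex.norm_real, Real.norm_of_nonneg hX0] at h1
  have h2 : 41 * (C * √(L * X) / L) * L * B = 41 * C * B * √(L * X) := by field_simp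
  rw [h2] at h1
  have h3 : X ^ 2 ≤ (41 * C * B) ^ 2 * (L * X) := by
    calc X ^ 2 ≤ (41 * C * B * √(L * X)) ^ 2 := pow_le_pow_left₀ hX0 h1 2
      _ = _ := by rw [mul_pow, Real.sq_sqrt hLX.le]
  nlinarith

/-- Carleson sequences are bounded functionals on sequences dominated by tents. -/
theorem TentBound.tsum_mul_le {w : DyadicInterval → ℝ≥0∞} {M : ℝ≥0∞} (h : TentBound w M)
    {z : DyadicInterval → ℝ≥0∞} {K : ℝ} (hK : 0 ≤ K)
    (hz : ∀ c L : ℝ, 0 < L → ∑' I, {I : DyadicInterval | c ≤ I.left ∧ I.right ≤ c + L}.indicator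
        (fun I => z I ^ 2) I ≤ ENNReal.ofReal (K ^ 2 * L)) :
    ∑' I, z I * w I ≤ ENNReal.ofReal K * M := by
  obtain ⟨ι, hι, c, L, lam, v, h1, h2, h3⟩ := h
  calc ∑' I, z I * w I ≤ ∑' I, z I * ∑' i, v i I := by
        gcongr with I; exact h2 I
    _ = ∑' i, ∑' I, z I * v i I := by
        rw [ENNReal.tsum_comm]
        simp_rw [ENNReal.tsum_mul_left]
    _ ≤ ∑' i, ENNReal.ofReal K * lam i := by
        refine ENNReal.tsum_le_tsum fun i => ?_
        have hL := (h1 i).length_pos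
        set A : Set DyadicInterval :=
          {I : DyadicInterval | c i ≤ I.left ∧ I.right ≤ c i + L i} with hA
        have e : ∀ I, z I * v i I = A.indicator z I * v i I := fun I => by
          by_cases hv : v i I = 0
          · rw [hv, mul_zero, mul_zero]
          · rw [indicator_of_mem (show I ∈ A from (h1 i).supp I hv)]
        have e2 : ∀ I, A.indicator z I ^ 2 = A.indicator (fun I => z I ^ 2) I := fun I => by
          by_cases hI : I ∈ A <;> simp [hI]
        rw [tsum_congr e, ← ENNReal.pow_le_pow_left_iff two_ne_zero]
        refine (ENNReal.sq_tsum_mul_le _ _).trans ?_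
        rw [tsum_congr e2]
        calc (∑' I, A.indicator (fun I => z I ^ 2) I) * ∑' I, v i I ^ 2
            ≤ ENNReal.ofReal (K ^ 2 * L i) * ∑' I, v i I ^ 2 := mul_le_mul' (hz _ _ hL) le_rfl
          _ = ENNReal.ofReal (K ^ 2) * (ENNReal.ofReal (L i) * ∑' I, v i I ^ 2) := by
              rw [ENNReal.ofReal_mul (by positivity), mul_assoc]
          _ ≤ ENNReal.ofReal (K ^ 2) * lam i ^ 2 := mul_le_mul' le_rfl (h1 i).sq_le
          _ = _ := by rw [mul_pow, ENNReal.ofReal_pow hK]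
    _ ≤ ENNReal.ofReal K * M := by
        rw [ENNReal.tsum_mul_left]
        exact mul_le_mul' le_rfl h3

/-! ### The transform on `H¹` -/

theorem transformRate_nonneg (k : ℤ) (n : ℕ) : 0 ≤ transformRate k n := by
  have h : 0 ≤ Real.log ((n : ℝ) + 1) := Real.log_nonneg (by linarith [n.cast_nonneg (α := ℝ)])
  unfold transformRate
  positivity

theorem enorm_transformCoeff_le (ψ f : ℝ → ℂ) (k : ℤ) (n : ℕ) (I : DyadicInterval) :
    ‖transformCoeff ψ k n f I‖ₑ ≤ relSum k n (fun J => ‖waveletCoeff ψ f J‖ₑ) I := by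
  refine (enorm_sum_le _ _).trans (le_trans (le_of_eq ?_) (ENNReal.sum_le_tsum
    (DyadicInterval.related_finite k n I).toFinset))
  refine Finset.sum_congr rfl fun J hJ => ?_
  rw [indicator_of_mem ((Set.Finite.mem_toFinset _).1 hJ)]

/-- The wavelet coefficients of a function in `H¹` are dominated by tents. -/
theorem IsWavelet.exists_tentBound_coeff {ψ : ℝ → ℂ} (hψ : IsWavelet ψ) : ∃ C : ℝ, 0 < C ∧
    ∀ (g : ℝ → ℂ) (M : ℝ≥0∞), h1ENorm g < M →
      TentBound (fun I => ‖waveletCoeff ψ g I‖ₑ) (ENNReal.ofReal C * M) := by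
  obtain ⟨C, hC, h⟩ := hψ.exists_tentBound_atom
  obtain ⟨D, hD⟩ := hψ.exists_decay
  refine ⟨C + 1, by positivity, fun g M hg => ?_⟩
  obtain ⟨μ, a, hdec, hM⟩ := exists_atomicDecomposition_lt hg
  refine (TentBound.tsum (fun i => (h (a i) (hdec.1 i)).const_mul ‖μ i‖ₑ) fun I => ?_).mono
    (fun _ => le_rfl) ?_
  · obtain ⟨B, hB⟩ := hD.exists_bound_waveletFn I
    have h1 := hasSum_integral_mul_atoms (φ := fun x => conj (waveletFn ψ I x))
      (Complex.continuous_conj.comp (hD.continuous_waveletFn I))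
      (fun x => (RCLike.norm_conj _).trans_le (hB x)) hdec
    change HasSum (fun i => μ i * waveletCoeff ψ (a i) I) (waveletCoeff ψ g I) at h1
    rw [← h1.tsum_eq]
    refine enorm_tsum_le_tsum_enorm.trans (le_of_eq ?_)
    simp_rw [enorm_mul]
  · rw [ENNReal.tsum_mul_right, mul_comm]
    exact mul_le_mul' (ENNReal.ofReal_le_ofReal (by linarith)) hM.le

/-- Passes to the infimum in the `H¹` norm, which need not be attained: decompositions are available
only for masses strictly above it. -/
theorem ENNReal.le_const_mul_of_forall_lt {x K m : ℝ≥0∞} (hK : K ≠ ∞) (hm : m ≠ ∞)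
    (h : ∀ M, m < M → x ≤ K * M) : x ≤ K * m := by
  have h1 : Tendsto (fun M => K * M) (𝓝[>] m) (𝓝 (K * m)) :=
    (ENNReal.Tendsto.const_mul tendsto_id (Or.inr hK)).mono_left nhdsWithin_le_nhds
  have : (𝓝[>] m).NeBot := by
    refine mem_closure_iff_nhdsWithin_neBot.1 ?_
    rw [closure_Ioi' ⟨∞, hm.lt_top⟩]
    exact self_mem_Ici
  exact ge_of_tendsto h1 (eventually_mem_nhdsWithin.mono fun M hM => h M hM)

/-- `T_{k,n}` is bounded on `H¹`. -/
theorem IsWavelet.exists_transformH1 {ψ : ℝ → ℂ} (hψ : IsWavelet ψ) : ∃ C : ℝ, 0 < C ∧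
    ∀ (k : ℤ) (n : ℕ) (f : ℝ → ℂ), MemH1 f →
      (∃ h, IsTransformH1 ψ k n f h) ∧ ∀ h, IsTransformH1 ψ k n f h →
        h1ENorm h ≤ ENNReal.ofReal (C * transformRate k n) * h1ENorm f := by
  classical
  obtain ⟨C₁, hC₁, hcoef⟩ := hψ.exists_tentBound_coeff
  obtain ⟨C₂, hC₂, hsyn⟩ := hψ.exists_h1ENorm_sum_le
  obtain ⟨D, hD⟩ := hψ.exists_decay
  refine ⟨C₂ * (40 * C₁), by positivity, fun k n f hf => ?_⟩
  set w := relSum k n (fun J => ‖waveletCoeff ψ f J‖ₑ) with hw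
  have hbd : ∀ M, h1ENorm f < M →
      TentBound w (ENNReal.ofReal (40 * transformRate k n) * (ENNReal.ofReal C₁ * M)) :=
    fun M hM => (hcoef f M hM).relSum k n
  have ht := enorm_transformCoeff_le ψ f k n
  have hsum : ∀ (M : ℝ≥0∞), h1ENorm f < M → ∀ F : Finset DyadicInterval,
      h1ENorm (fun x => ∑ I ∈ F, transformCoeff ψ k n f I * waveletFn ψ I x) ≤
        ENNReal.ofReal (C₂ * (40 * C₁) * transformRate k n) * M := by
    intro M hM F
    have e : ENNReal.ofReal (C₂ * (40 * C₁) * transformRate k n) * M = ENNReal.ofReal C₂ *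
        (ENNReal.ofReal (40 * transformRate k n) * (ENNReal.ofReal C₁ * M)) := by
      rw [show C₂ * (40 * C₁) * transformRate k n = C₂ * (C₁ * (40 * transformRate k n)) by ring,
        ENNReal.ofReal_mul hC₂.le, ENNReal.ofReal_mul hC₁.le]
      ring_nf
    by_cases hMt : M = ∞
    · obtain ⟨M', h1, h2⟩ := exists_between (hM.trans_eq hMt)
      rw [e]
      refine (hsyn _ w _ F (hbd M' h1) ?_ fun I _ => ht I).trans ?_
      · exact ENNReal.mul_ne_top ENNReal.ofReal_ne_top (ENNReal.mul_ne_top ENNReal.ofReal_ne_top h2.ne)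
      · rw [hMt]; gcongr
    · rw [e]
      exact hsyn _ w _ F (hbd M hM) (ENNReal.mul_ne_top ENNReal.ofReal_ne_top
        (ENNReal.mul_ne_top ENNReal.ofReal_ne_top hMt)) fun I _ => ht I
  obtain ⟨M₀, hM₀, hM₀t⟩ := exists_between (show h1ENorm f < ∞ from hf)
  refine ⟨?_, fun h hh => ?_⟩
  · refine exists_tendsto_h1ENorm
      (φ := fun I x => transformCoeff ψ k n f I * waveletFn ψ I x) ?_ ?_ ?_
    · exact fun I => ((hD.continuous_waveletFn I).const_mul _).aestronglyMeasurable
    · exact fun F => (hsum M₀ hM₀ F).trans_lt (ENNReal.mul_lt_top ENNReal.ofReal_lt_top hM₀t)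
    · intro ε hε
      by_cases hεt : ε = ∞
      · exact ⟨∅, fun F _ => hεt ▸ le_top⟩
      have hC₂0 : ENNReal.ofReal C₂ ≠ 0 := by simpa using hC₂
      have hδ : ε / ENNReal.ofReal C₂ ≠ 0 := (ENNReal.div_pos hε ENNReal.ofReal_ne_top).ne'
      -- Outside a finite set the coefficients are dominated by tents of arbitrarily small mass.
      -- Synthesis then gives the unconditional Cauchy property.
      obtain ⟨F₀, hF₀⟩ := (hbd M₀ hM₀).exists_finset (ENNReal.mul_ne_top ENNReal.ofReal_ne_top
        (ENNReal.mul_ne_top ENNReal.ofReal_ne_top hM₀t.ne)) hδ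
      refine ⟨F₀, fun F hF => ?_⟩
      refine (hsyn _ _ _ F hF₀ (ENNReal.div_ne_top hεt hC₂0) fun I hI => ?_).trans ?_
      · rw [if_neg fun h => Finset.disjoint_left.1 hF hI h]
        exact ht I
      · exact ENNReal.mul_div_le
  · refine ENNReal.le_const_mul_of_forall_lt ENNReal.ofReal_ne_top hf.ne fun M hM => ?_
    have h1 : ∀ F : Finset DyadicInterval, h1ENorm h ≤
        h1ENorm (fun x => h x - ∑ I ∈ F, transformCoeff ψ k n f I * waveletFn ψ I x) +
          ENNReal.ofReal (C₂ * (40 * C₁) * transformRate k n) * M := fun F => by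
      refine le_trans (le_of_eq ?_) ((h1ENorm_add_le _ _).trans (add_le_add le_rfl (hsum M hM F)))
      congr 1
      ext x; ring
    have h2 := hh.2.add_const (ENNReal.ofReal (C₂ * (40 * C₁) * transformRate k n) * M)
    rw [zero_add] at h2
    exact ge_of_tendsto h2 (Eventually.of_forall h1)

/-! ### Functions that represent functionals on `H¹` -/

theorem IsHardyAtom.isAtomicDecomposition {a : ℝ → ℂ} (ha : IsHardyAtom a) :
    IsAtomicDecomposition a (fun i => if i = 0 then 1 else 0) (fun _ => a) := by
  refine ⟨fun _ => ha, ?_, Eventually.of_forall fun x => ?_⟩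
  · refine summable_of_ne_finset_zero (s := {0}) fun i hi => ?_
    simpa using hi
  · have h := hasSum_single (f := fun i : ℕ => (if i = 0 then (1 : ℂ) else 0) * a x) 0
      fun i hi => by rw [if_neg hi, zero_mul]
    simpa using h

theorem IsHardyAtom.h1ENorm_le_one {a : ℝ → ℂ} (ha : IsHardyAtom a) : h1ENorm a ≤ 1 := by
  refine (iInf₂_le _ _).trans ((iInf_le _ ha.isAtomicDecomposition).trans (le_of_eq ?_))
  rw [tsum_eq_single 0 fun i hi => by rw [if_neg hi, enorm_zero]]
  simp

/-- A function that is bounded on atoms belongs to `BMO`. -/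
theorem bmoENorm_le_of_atoms {h : ℝ → ℂ} (hloc : LocallyIntegrable h) {R : ℝ} (hR : 0 ≤ R)
    (hb : ∀ a, IsHardyAtom a → ‖∫ x, h x * a x‖ ≤ R) :
    bmoENorm h ≤ ENNReal.ofReal (2 * R) := by
  refine iSup_le fun c => iSup_le fun d => iSup_le fun hcd => ?_
  have hdc : 0 < d - c := sub_pos.2 hcd
  set z := ⨍ y in Ioc c d, h y with hz
  have hint : IntegrableOn h (Ioc c d) :=
    (hloc.integrableOn_isCompact isCompact_Icc).mono_set Ioc_subset_Icc_self
  have hint' : IntegrableOn (fun x => h x - z) (Ioc c d) :=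
    hint.sub (integrable_const z)
  -- `s` is the conjugate phase of `h - z`. Subtracting its mean gives a function bounded by `2`
  -- with integral zero, so it is `2 * (d - c)` times an atom. Its pairing with `h` is exactly the
  -- integral of `‖h - z‖`, because the terms with `σ` and `z` integrate to zero.
  set s : ℝ → ℂ := fun x => conj (h x - z) / ‖h x - z‖ with hs
  have hsn : ∀ x, ‖s x‖ ≤ 1 := fun x => by
    rw [hs]; simp only [norm_div, RCLike.norm_conj, Complex.norm_real, norm_norm]
    exact div_self_le_one _
  have hsm : AEStronglyMeasurable s (volume.restrict (Ioc c d)) := by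
    have h1 := hint'.aestronglyMeasurable
    have h2 : AEMeasurable (fun x => conj (h x - z)) (volume.restrict (Ioc c d)) :=
      (Complex.continuous_conj.comp_aestronglyMeasurable h1).aemeasurable
    have h3 : AEMeasurable (fun x => ((‖h x - z‖ : ℝ) : ℂ)) (volume.restrict (Ioc c d)) :=
      (Complex.continuous_ofReal.comp_aestronglyMeasurable h1.norm).aemeasurable
    exact (h2.div h3).aestronglyMeasurable
  have hmul : ∀ x, (h x - z) * s x = (‖h x - z‖ : ℝ) := fun x => by
    by_cases hx : h x - z = 0
    · simp [hs, hx]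
    · rw [hs]; simp only
      rw [mul_div_assoc', Complex.mul_conj', sq, mul_div_assoc, div_self, mul_one]
      simpa using hx
  have hsi : IntegrableOn s (Ioc c d) :=
    (integrable_const (1 : ℝ)).mono' hsm (Eventually.of_forall hsn)
  set σ := ⨍ y in Ioc c d, s y with hσ
  have hvol : volume.real (Ioc c d) = d - c := by
    rw [Measure.real, Real.volume_Ioc, ENNReal.toReal_ofReal hdc.le]
  have hσn : ‖σ‖ ≤ 1 := by
    rw [hσ, setAverage_eq, norm_smul, hvol, norm_inv, Real.norm_of_nonneg hdc.le]
    have := norm_setIntegral_le_of_norm_le_const (μ := volume) (s := Ioc c d) (f := s) (C := 1)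
      (by simp) (fun x _ => hsn x)
    rw [hvol, one_mul] at this
    rw [inv_mul_le_iff₀ hdc, mul_one]
    exact this
  have hav : ∀ {φ : ℝ → ℂ}, IntegrableOn φ (Ioc c d) →
      ∫ x in Ioc c d, (φ x - ⨍ y in Ioc c d, φ y) = 0 := fun {φ} hφ => by
    rw [integral_sub hφ (integrable_const _), setAverage_eq, setIntegral_const, hvol, smul_smul,
      mul_inv_cancel₀ hdc.ne', one_smul, sub_self]
  set p : ℝ → ℂ := (Ioc c d).indicator fun x => s x - σ with hp
  have hpn : ∀ x, ‖p x‖ₑ ^ 2 ≤ (Ioc c d).indicator (fun _ => 4) x := fun x => by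
    by_cases hx : x ∈ Ioc c d
    · rw [hp, indicator_of_mem hx, indicator_of_mem hx, ← ofReal_norm,
        ← ENNReal.ofReal_pow (norm_nonneg _), show (4 : ℝ≥0∞) = ENNReal.ofReal 4 by norm_num]
      refine ENNReal.ofReal_le_ofReal ?_
      have := (norm_sub_le (s x) σ).trans (add_le_add (hsn x) hσn)
      nlinarith [norm_nonneg (s x - σ)]
    · rw [hp, indicator_of_notMem hx, indicator_of_notMem hx]; simp
  have hatom := isHardyAtom_div (p := p) (l := 2 * (d - c)) hcd (by positivity)
    (support_indicator_subset.trans Ioc_subset_Icc_self)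
    ((aestronglyMeasurable_indicator_iff measurableSet_Ioc).2 (hsm.sub aestronglyMeasurable_const))
    (by
      refine (lintegral_mono hpn).trans (le_of_eq ?_)
      rw [lintegral_indicator measurableSet_Ioc, setLIntegral_const, Real.volume_Ioc,
        show (4 : ℝ≥0∞) = ENNReal.ofReal 4 by norm_num, ← ENNReal.ofReal_mul (by norm_num)]
      congr 1; field_simp; norm_num)
    (by rw [hp, integral_indicator measurableSet_Ioc]; exact hav hsi)
  have e1 : ∫ x, h x * ((((2 * (d - c))⁻¹ : ℝ) : ℂ) * p x) =
      (((2 * (d - c))⁻¹ : ℝ) : ℂ) * ((∫ x in Ioc c d, ‖h x - z‖ : ℝ) : ℂ) := by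
    have h1 : ∀ x, h x * ((((2 * (d - c))⁻¹ : ℝ) : ℂ) * p x) = (((2 * (d - c))⁻¹ : ℝ) : ℂ) *
        (Ioc c d).indicator (fun x => h x * (s x - σ)) x := fun x => by
      rw [hp, indicator_mul_right]; ring
    simp_rw [h1]
    rw [integral_const_mul, integral_indicator measurableSet_Ioc]
    congr 1
    have h2 : ∀ x, h x * (s x - σ) = (((‖h x - z‖ : ℝ) : ℂ) - σ * (h x - z)) + z * (s x - σ) :=
      fun x => by rw [← hmul]; ring
    simp_rw [h2]
    have i1 : IntegrableOn (fun x => ((‖h x - z‖ : ℝ) : ℂ)) (Ioc c d) := hint'.norm.ofReal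
    have i2 : IntegrableOn (fun x => s x - σ) (Ioc c d) := hsi.sub (integrable_const σ)
    have i3 : IntegrableOn (fun x => ((‖h x - z‖ : ℝ) : ℂ) - σ * (h x - z)) (Ioc c d) :=
      i1.sub (hint'.const_mul σ)
    rw [integral_add i3 (i2.const_mul z), integral_sub i1 (hint'.const_mul σ), integral_const_mul, integral_const_mul, hav hsi, hav hint,
      integral_complex_ofReal]
    ring
  have h3 := hb _ hatom
  rw [e1, norm_mul, Complex.norm_real, Complex.norm_real, Real.norm_of_nonneg (by positivity),
    Real.norm_of_nonneg (integral_nonneg fun _ => norm_nonneg _), inv_mul_le_iff₀ (by positivity)]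
    at h3
  refine ENNReal.div_le_of_le_mul ?_
  rw [← ofReal_integral_norm_eq_lintegral_enorm hint',
    ← ENNReal.ofReal_mul (by positivity)]
  exact ENNReal.ofReal_le_ofReal (h3.trans_eq (by ring))

/-- The weight `4^(-⌊|x|⌋)`. -/
noncomputable def floorWeight (x : ℝ) : ℝ := (1 / 4) ^ ⌊|x|⌋₊

theorem measurable_floorWeight : Measurable floorWeight := by
  unfold floorWeight
  exact (measurable_of_countable fun m : ℕ => ((1 / 4 : ℝ)) ^ m).comp
    (Nat.measurable_floor.comp continuous_abs.measurable)

theorem floorWeight_pos (x : ℝ) : 0 < floorWeight x := by unfold floorWeight; positivity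

theorem inv_floorWeight_le {c d x : ℝ} (hx : x ∈ Icc c d) :
    (floorWeight x)⁻¹ ≤ 4 ^ ⌊|c| + |d|⌋₊ := by
  unfold floorWeight
  rw [one_div, inv_pow, inv_inv]
  refine pow_le_pow_right₀ (by norm_num) (Nat.floor_le_floor ?_)
  rcases hx with ⟨h1, h2⟩
  rw [abs_le]
  constructor <;> linarith [neg_abs_le c, abs_nonneg d, le_abs_self d, abs_nonneg c]

/-- The weight `floorWeight` maps `L²` into `H¹`, after a correction of the mean. -/
noncomputable def hardyEmbed (q : ℝ → ℂ) (x : ℝ) : ℂ :=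
  floorWeight x * q x - (∫ y, floorWeight y * q y) * (Ioc (0 : ℝ) 1).indicator 1 x

theorem lintegral_enorm_le_of_support_subset {p : ℝ → ℂ} {c d : ℝ}
    (hs : Function.support p ⊆ Icc c d) (hm : AEStronglyMeasurable p) :
    (∫⁻ x, ‖p x‖ₑ) ^ 2 ≤ ENNReal.ofReal (d - c) * ∫⁻ x, ‖p x‖ₑ ^ 2 := by
  have h1 := sq_lintegral_mul_le (μ := volume) (f := (Icc c d).indicator 1) (g := fun x => ‖p x‖ₑ)
    (aemeasurable_const.indicator measurableSet_Icc) hm.enorm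
  have e1 : ∀ x, (Icc c d).indicator (1 : ℝ → ℝ≥0∞) x * ‖p x‖ₑ = ‖p x‖ₑ := fun x => by
    by_cases hx : x ∈ Icc c d
    · rw [indicator_of_mem hx, Pi.one_apply, one_mul]
    · rw [Function.notMem_support.1 fun h => hx (hs h)]; simp
  have e2 : ∀ x, (Icc c d).indicator (1 : ℝ → ℝ≥0∞) x ^ 2 = (Icc c d).indicator 1 x := fun x => by
    by_cases hx : x ∈ Icc c d <;> simp [hx]
  simp_rw [e1, e2] at h1
  rwa [lintegral_indicator_one measurableSet_Icc, Real.volume_Icc] at h1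

/-- Correcting the mean of a function with bounded support gives a function in `H¹`. -/
theorem h1ENorm_sub_integral_le {p : ℝ → ℂ} {N : ℝ} (hN : 1 ≤ N) {l : ℝ} (hl : 0 < l)
    (hs : Function.support p ⊆ Icc (-N) N) (hm : AEStronglyMeasurable p)
    (h2 : ∫⁻ x, ‖p x‖ₑ ^ 2 ≤ ENNReal.ofReal (l ^ 2)) :
    h1ENorm (fun x => p x - (∫ y, p y) * (Ioc (0 : ℝ) 1).indicator 1 x) ≤
      ENNReal.ofReal (4 * N * l) := by
  have h3 := (lintegral_enorm_le_of_support_subset hs hm).trans (mul_le_mul' le_rfl h2)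
  rw [← ENNReal.ofReal_mul (by linarith)] at h3
  have hfin : ∫⁻ x, ‖p x‖ₑ ≠ ∞ := fun h => by
    rw [h, ENNReal.top_pow two_ne_zero, top_le_iff] at h3
    exact ENNReal.ofReal_ne_top h3
  have hint : Integrable p := ⟨hm, lt_top_iff_ne_top.2 hfin⟩
  set z := ∫ y, p y with hz
  have hz2 : ‖z‖ₑ ^ 2 ≤ ENNReal.ofReal (2 * N * l ^ 2) :=
    (pow_le_pow_left₀ zero_le (enorm_integral_le_lintegral_enorm p) 2).trans
      (h3.trans_eq (by congr 1; ring))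
  have hindm : AEStronglyMeasurable ((Ioc (0 : ℝ) 1).indicator (1 : ℝ → ℂ)) :=
    aestronglyMeasurable_const.indicator measurableSet_Ioc
  refine h1ENorm_le_of_support_subset (c := -N) (d := N) (by linarith) (by positivity)
    (fun x hx => ?_) (hm.sub (hindm.const_mul z)) ?_ ?_
  · by_contra h
    refine hx ?_
    have h01 : x ∉ Ioc (0 : ℝ) 1 := fun hx => h ⟨by linarith [hx.1], by linarith [hx.2]⟩
    change p x - z * _ = 0
    rw [Function.notMem_support.1 fun hx => h (hs hx), indicator_of_notMem h01]
    simp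
  · have h4 : ∀ x, ‖p x - z * (Ioc (0 : ℝ) 1).indicator 1 x‖ₑ ^ 2 ≤
        2 * ‖p x‖ₑ ^ 2 + (Ioc (0 : ℝ) 1).indicator (fun _ => 2 * ‖z‖ₑ ^ 2) x := fun x => by
      have e : ∀ u v : ℂ, ‖u - v‖ₑ ^ 2 ≤ 2 * ‖u‖ₑ ^ 2 + 2 * ‖v‖ₑ ^ 2 := fun u v => by
        simp only [← ofReal_norm, ← ENNReal.ofReal_pow (norm_nonneg _),
          show (2 : ℝ≥0∞) = ENNReal.ofReal 2 by norm_num]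
        rw [← ENNReal.ofReal_mul two_pos.le, ← ENNReal.ofReal_mul two_pos.le,
          ← ENNReal.ofReal_add (by positivity) (by positivity)]
        refine ENNReal.ofReal_le_ofReal ?_
        have := norm_sub_le u v
        nlinarith [norm_nonneg (u - v), sq_nonneg (‖u‖ - ‖v‖)]
      refine (e _ _).trans (le_of_eq ?_)
      by_cases hx : x ∈ Ioc (0 : ℝ) 1 <;> simp [hx]
    refine (lintegral_mono h4).trans ?_
    rw [lintegral_add_left' ((hm.enorm.pow_const 2).const_mul 2),
      lintegral_const_mul' _ _ ENNReal.ofNat_ne_top, lintegral_indicator measurableSet_Ioc,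
      setLIntegral_const, Real.volume_Ioc]
    calc 2 * (∫⁻ x, ‖p x‖ₑ ^ 2) + 2 * ‖z‖ₑ ^ 2 * ENNReal.ofReal (1 - 0)
        ≤ 2 * ENNReal.ofReal (l ^ 2) + 2 * ENNReal.ofReal (2 * N * l ^ 2) := by
          rw [sub_zero, ENNReal.ofReal_one, mul_one]
          gcongr
      _ = ENNReal.ofReal (2 * l ^ 2 + 2 * (2 * N * l ^ 2)) := by
          rw [ENNReal.ofReal_add (by positivity) (by positivity), ENNReal.ofReal_mul two_pos.le,
            ENNReal.ofReal_mul (p := 2) (q := 2 * N * l ^ 2) two_pos.le]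
          norm_num
      _ ≤ _ := by
          refine ENNReal.ofReal_le_ofReal ?_
          rw [le_div_iff₀ (by linarith)]
          nlinarith [sq_nonneg l, mul_nonneg (sub_nonneg.2 hN) (sq_nonneg l),
            mul_nonneg (mul_nonneg (sub_nonneg.2 hN) (sq_nonneg l)) (by linarith : 0 ≤ N)]
  · have h5 : Integrable ((Ioc (0 : ℝ) 1).indicator (1 : ℝ → ℂ)) :=
      (integrable_indicator_iff measurableSet_Ioc).2 (integrableOn_const (by simp))
    rw [integral_sub hint (h5.const_mul z), integral_const_mul,
      integral_indicator measurableSet_Ioc]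
    simp [hz]

/-- The set where `⌊|x|⌋ = N`. -/
def floorAnnulus (N : ℕ) : Set ℝ := {x | ⌊|x|⌋₊ = N}

theorem measurableSet_floorAnnulus (N : ℕ) : MeasurableSet (floorAnnulus N) :=
  (Nat.measurable_floor.comp continuous_abs.measurable) (measurableSet_singleton N)

theorem hasSum_indicator_floorAnnulus (φ : ℝ → ℂ) (x : ℝ) :
    HasSum (fun N => (floorAnnulus N).indicator φ x) (φ x) := by
  have h := hasSum_single (f := fun N => (floorAnnulus N).indicator φ x) ⌊|x|⌋₊ fun N hN =>
    indicator_of_notMem (s := floorAnnulus N)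
      (fun hx => hN (show ⌊|x|⌋₊ = N from hx).symm) φ
  rwa [indicator_of_mem (show x ∈ floorAnnulus ⌊|x|⌋₊ from rfl)] at h

theorem floorAnnulus_subset (N : ℕ) : floorAnnulus N ⊆ Icc (-((N : ℝ) + 1)) (N + 1) := by
  rintro x rfl
  exact abs_le.1 (Nat.lt_floor_add_one |x|).le

theorem succ_mul_quarter_pow_le (N : ℕ) : ((N : ℝ) + 1) * (1 / 4) ^ N ≤ (1 / 2) ^ N := by
  have h : ((N : ℝ) + 1) ≤ 2 ^ N := by exact_mod_cast Nat.lt_two_pow_self (n := N)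
  calc ((N : ℝ) + 1) * (1 / 4) ^ N ≤ 2 ^ N * (1 / 4) ^ N := by gcongr
    _ = _ := by rw [← mul_pow]; norm_num

theorem tsum_ofReal_mul_half_pow {A : ℝ} (hA : 0 ≤ A) :
    ∑' N : ℕ, ENNReal.ofReal (A * (1 / 2) ^ N) = ENNReal.ofReal (2 * A) := by
  rw [← ENNReal.ofReal_tsum_of_nonneg (fun N => by positivity)
    (summable_geometric_two.mul_left A), tsum_mul_left, tsum_geometric_two, mul_comm]

/-- On the annulus `⌊|x|⌋ = N`, correcting the mean on the fixed interval `(0, 1]` costs a factor of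
order `N + 1`, and the weight supplies `4 ^ (-N)`. The corrections of the annuli add up to the
correction of the whole. -/
theorem h1ENorm_hardyEmbed_le {q : ℝ → ℂ} (hm : AEStronglyMeasurable q) {A : ℝ} (hA : 0 < A)
    (h2 : ∫⁻ x, ‖q x‖ₑ ^ 2 ≤ ENNReal.ofReal (A ^ 2)) :
    Integrable (fun x => (floorWeight x : ℂ) * q x) ∧
      h1ENorm (hardyEmbed q) ≤ ENNReal.ofReal (8 * A) := by
  set φ : ℝ → ℂ := fun x => (floorWeight x : ℂ) * q x with hφ
  have hφm : AEStronglyMeasurable φ :=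
    (Complex.measurable_ofReal.comp measurable_floorWeight).aestronglyMeasurable.mul hm
  have hpm : ∀ N, AEStronglyMeasurable ((floorAnnulus N).indicator φ) := fun N =>
    hφm.indicator (measurableSet_floorAnnulus N)
  have hps : ∀ N, Function.support ((floorAnnulus N).indicator φ) ⊆
      Icc (-((N : ℝ) + 1)) (N + 1) := fun N =>
    support_indicator_subset.trans (floorAnnulus_subset N)
  have hp2 : ∀ N, ∫⁻ x, ‖(floorAnnulus N).indicator φ x‖ₑ ^ 2 ≤
      ENNReal.ofReal (((1 / 4) ^ N * A) ^ 2) := fun N => by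
    have h3 : ∀ x, ‖(floorAnnulus N).indicator φ x‖ₑ ^ 2 ≤
        ENNReal.ofReal ((1 / 4) ^ N) ^ 2 * ‖q x‖ₑ ^ 2 := fun x => by
      by_cases hx : x ∈ floorAnnulus N
      · rw [indicator_of_mem hx, hφ, enorm_mul, ← ofReal_norm (floorWeight x : ℂ),
          Complex.norm_real, Real.norm_of_nonneg (floorWeight_pos x).le, mul_pow, floorWeight,
          show ⌊|x|⌋₊ = N from hx]
      · rw [indicator_of_notMem hx]; simp
    refine (lintegral_mono h3).trans ?_
    rw [lintegral_const_mul' _ _ (by finiteness), mul_pow, ENNReal.ofReal_mul (by positivity),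
      ENNReal.ofReal_pow (p := (1 / 4) ^ N) (by positivity)]
    exact mul_le_mul' le_rfl h2
  have hφi : Integrable φ := by
    refine ⟨hφm, ?_⟩
    have h3 : ∀ x, ‖φ x‖ₑ ≤ ∑' N, ‖(floorAnnulus N).indicator φ x‖ₑ := fun x => by
      rw [← (hasSum_indicator_floorAnnulus φ x).tsum_eq]
      exact enorm_tsum_le_tsum_enorm
    refine (lintegral_mono h3).trans_lt ?_
    rw [lintegral_tsum fun N => (hpm N).enorm]
    refine (ENNReal.tsum_le_tsum fun N => ?_).trans_lt
      ((tsum_ofReal_mul_half_pow (A := 2 * A) (by positivity)).trans_lt ENNReal.ofReal_lt_top)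
    rw [← ENNReal.pow_le_pow_left_iff two_ne_zero]
    refine (lintegral_enorm_le_of_support_subset (hps N) (hpm N)).trans
      ((mul_le_mul' le_rfl (hp2 N)).trans ?_)
    rw [← ENNReal.ofReal_mul (by linarith [N.cast_nonneg (α := ℝ)]),
      ← ENNReal.ofReal_pow (by positivity)]
    refine ENNReal.ofReal_le_ofReal ?_
    have h4 := succ_mul_quarter_pow_le N
    have h5 : (0 : ℝ) ≤ N := N.cast_nonneg
    have h6 : (0 : ℝ) < (1 / 4) ^ N := by positivity
    calc ((N : ℝ) + 1 - -(N + 1)) * ((1 / 4) ^ N * A) ^ 2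
        ≤ (2 * (N + 1)) ^ 2 * ((1 / 4) ^ N * A) ^ 2 := by
          gcongr; nlinarith
      _ = (2 * A * ((N + 1) * (1 / 4) ^ N)) ^ 2 := by ring
      _ ≤ _ := by gcongr
  refine ⟨hφi, ?_⟩
  have hI : HasSum (fun N => ∫ y, (floorAnnulus N).indicator φ y) (∫ y, φ y) := by
    have h3 := hasSum_integral_iUnion (f := φ) (μ := volume) measurableSet_floorAnnulus
      (fun i j hij => Set.disjoint_left.2 fun x hi hj =>
        hij ((show ⌊|x|⌋₊ = i from hi).symm.trans hj)) hφi.integrableOn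
    rw [show ⋃ N, floorAnnulus N = univ from eq_univ_of_forall fun x =>
      mem_iUnion.2 ⟨⌊|x|⌋₊, rfl⟩, setIntegral_univ] at h3
    simp_rw [integral_indicator (measurableSet_floorAnnulus _)]
    exact h3
  refine (h1ENorm_le_tsum (G := fun N x => (floorAnnulus N).indicator φ x -
    (∫ y, (floorAnnulus N).indicator φ y) * (Ioc (0 : ℝ) 1).indicator 1 x)
    (Eventually.of_forall fun x =>
      (hasSum_indicator_floorAnnulus φ x).sub (hI.mul_right _))).trans ?_
  rw [show 8 * A = 2 * (4 * A) by ring, ← tsum_ofReal_mul_half_pow (by positivity)]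
  refine ENNReal.tsum_le_tsum fun N => ?_
  refine (h1ENorm_sub_integral_le (by simp) (by positivity) (hps N) (hpm N) (hp2 N)).trans
    (ENNReal.ofReal_le_ofReal ?_)
  have h4 := succ_mul_quarter_pow_le N
  nlinarith

/-- Functionals on `H¹` are represented by locally integrable functions. -/
theorem exists_locallyIntegrable_of_functional {Λ : (ℝ → ℂ) → ℂ} {R : ℝ} (hR : 0 ≤ R)
    (hadd : ∀ g g', MemH1 g → MemH1 g' → Λ (fun x => g x + g' x) = Λ g + Λ g')
    (hmul : ∀ (z : ℂ) g, Λ (fun x => z * g x) = z * Λ g)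
    (hcongr : ∀ g g', g =ᵐ[volume] g' → Λ g = Λ g')
    (hbd : ∀ g, MemH1 g → ‖Λ g‖ₑ ≤ ENNReal.ofReal R * h1ENorm g) :
    ∃ h : ℝ → ℂ, LocallyIntegrable h ∧ ∀ a, IsHardyAtom a → ∫ x, h x * a x = Λ a := by
  have hL : ∀ q : Lp ℂ 2 (volume : Measure ℝ),
      ∫⁻ x, ‖q x‖ₑ ^ 2 = ENNReal.ofReal (‖q‖ ^ 2) := fun q => by
    rw [← enorm_sq_eLpNorm_two, ← Lp.enorm_def, ENNReal.ofReal_pow (norm_nonneg _), ofReal_norm]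
  have hE : ∀ q : Lp ℂ 2 (volume : Measure ℝ), ∀ A : ℝ, ‖q‖ < A →
      Integrable (fun x => (floorWeight x : ℂ) * q x) ∧
        h1ENorm (hardyEmbed q) ≤ ENNReal.ofReal (8 * A) := fun q A hA =>
    h1ENorm_hardyEmbed_le (Lp.aestronglyMeasurable q) ((norm_nonneg _).trans_lt hA)
      ((hL q).trans_le (ENNReal.ofReal_le_ofReal (by gcongr)))
  have hmem : ∀ q : Lp ℂ 2 (volume : Measure ℝ), MemH1 (hardyEmbed q) := fun q =>
    ((hE q _ (lt_add_one _)).2).trans_lt ENNReal.ofReal_lt_top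
  have hEi : ∀ q : Lp ℂ 2 (volume : Measure ℝ),
      Integrable (fun x => (floorWeight x : ℂ) * q x) := fun q => (hE q _ (lt_add_one _)).1
  let lin : Lp ℂ 2 (volume : Measure ℝ) →ₗ[ℂ] ℂ :=
    { toFun := fun q => Λ (hardyEmbed q)
      map_add' := fun q q' => by
        rw [← hadd _ _ (hmem q) (hmem q')]
        refine hcongr _ _ ?_
        have h1 := Lp.coeFn_add q q'
        have h2 : ∫ y, (floorWeight y : ℂ) * (q + q' : Lp ℂ 2 (volume : Measure ℝ)) y =
            (∫ y, (floorWeight y : ℂ) * q y) + ∫ y, (floorWeight y : ℂ) * q' y := by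
          rw [← integral_add (hEi q) (hEi q')]
          refine integral_congr_ae (h1.mono fun x hx => ?_)
          simp only [hx, Pi.add_apply, mul_add]
        filter_upwards [h1] with x hx
        simp only [hardyEmbed, h2, hx, Pi.add_apply]
        ring
      map_smul' := fun z q => by
        rw [RingHom.id_apply, smul_eq_mul, ← hmul]
        refine hcongr _ _ ?_
        have h1 := Lp.coeFn_smul z q
        have h2 : ∫ y, (floorWeight y : ℂ) * (z • q : Lp ℂ 2 (volume : Measure ℝ)) y =
            z * ∫ y, (floorWeight y : ℂ) * q y := by
          rw [← integral_const_mul]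
          refine integral_congr_ae (h1.mono fun x hx => ?_)
          simp only [hx, Pi.smul_apply, smul_eq_mul]; ring
        filter_upwards [h1] with x hx
        simp only [hardyEmbed, h2, hx, Pi.smul_apply, smul_eq_mul]
        ring }
  have hlin : ∀ q, ‖lin q‖ ≤ 8 * R * ‖q‖ := fun q => by
    have h1 : ∀ A, ‖q‖ < A → ‖lin q‖ ≤ 8 * R * A := fun A hA => by
      have h2 := (hbd _ (hmem q)).trans (mul_le_mul' le_rfl (hE q A hA).2)
      rw [← ENNReal.ofReal_mul hR, ← ofReal_norm, ENNReal.ofReal_le_ofReal_iff (by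
        have := (norm_nonneg q).trans hA.le; positivity)] at h2
      exact h2.trans_eq (by ring)
    have h3 : Tendsto (fun A => 8 * R * A) (𝓝[>] ‖q‖) (𝓝 (8 * R * ‖q‖)) :=
      ((continuous_const.mul continuous_id).tendsto _).mono_left nhdsWithin_le_nhds
    exact ge_of_tendsto h3 (eventually_mem_nhdsWithin.mono fun A hA => h1 A hA)
  -- Pulling `Λ` back along `hardyEmbed` gives a bounded functional on the Hilbert space `L²`, so
  -- Riesz yields one global representative. Dividing by the weight keeps it locally integrable.
  set h₀ := (InnerProductSpace.toDual ℂ (Lp ℂ 2 (volume : Measure ℝ))).symm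
    (lin.mkContinuous (8 * R) hlin) with hh₀
  have hh : ∀ q, inner ℂ h₀ q = lin q := fun q => by
    rw [hh₀, InnerProductSpace.toDual_symm_apply]; rfl
  have hinvm : AEStronglyMeasurable (fun x => (((floorWeight x)⁻¹ : ℝ) : ℂ)) (volume : Measure ℝ) :=
    (Complex.measurable_ofReal.comp measurable_floorWeight.inv).aestronglyMeasurable
  have hconj : AEStronglyMeasurable (fun x => conj (h₀ x)) (volume : Measure ℝ) :=
    Complex.continuous_conj.comp_aestronglyMeasurable (Lp.aestronglyMeasurable h₀)
  refine ⟨fun x => conj (h₀ x) * (((floorWeight x)⁻¹ : ℝ) : ℂ), ?_, fun a ha => ?_⟩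
  · refine fun x => ⟨Icc (x - 1) (x + 1), Icc_mem_nhds (by linarith) (by linarith), ?_⟩
    have h1 : IntegrableOn (fun x => conj (h₀ x)) (Icc (x - 1) (x + 1)) := by
      have h2 : IntegrableOn h₀ (Icc (x - 1) (x + 1)) :=
        ((Lp.memLp h₀).restrict _).integrable (by norm_num)
      exact (integrable_norm_iff hconj.restrict).1 (by simpa using h2.norm)
    refine Integrable.mul_bdd (c := 4 ^ ⌊|x - 1| + |x + 1|⌋₊) h1 hinvm.restrict ?_
    refine (ae_restrict_mem measurableSet_Icc).mono fun y hy => ?_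
    rw [Complex.norm_real, Real.norm_of_nonneg (inv_nonneg.2 (floorWeight_pos y).le)]
    exact inv_floorWeight_le hy
  · obtain ⟨c, d, hcd, hs, hm, -, h0⟩ := id ha
    -- The quotient of the atom by the weight is in `L²` because the support is bounded. As the atom
    -- has mean zero, no correction is made and `hardyEmbed` returns the atom itself.
    have hgm : MemLp (fun x => (((floorWeight x)⁻¹ : ℝ) : ℂ) * a x) 2 := by
      refine MemLp.of_le_mul (c := 4 ^ ⌊|c| + |d|⌋₊) hm (hinvm.mul hm.1)
        (Eventually.of_forall fun x => ?_)
      by_cases hx : x ∈ Icc c d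
      · rw [norm_mul, Complex.norm_real, Real.norm_of_nonneg (inv_nonneg.2 (floorWeight_pos x).le)]
        exact mul_le_mul_of_nonneg_right (inv_floorWeight_le hx) (norm_nonneg _)
      · rw [Function.notMem_support.1 fun h => hx (hs h)]; simp
    have h1 := hh (hgm.toLp _)
    rw [L2.inner_def] at h1
    have e1 : ∫ x, inner ℂ (h₀ x) (hgm.toLp _ x) =
        ∫ x, conj (h₀ x) * (((floorWeight x)⁻¹ : ℝ) : ℂ) * a x := by
      refine integral_congr_ae (hgm.coeFn_toLp.mono fun x hx => ?_)
      simp only [hx, RCLike.inner_apply]; ring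
    rw [e1] at h1
    rw [h1]
    refine hcongr _ _ ?_
    have h2 : ∀ᵐ x : ℝ, (floorWeight x : ℂ) * hgm.toLp _ x = a x :=
      hgm.coeFn_toLp.mono fun x hx => by
        rw [hx, ← mul_assoc, ← Complex.ofReal_mul, mul_inv_cancel₀ (floorWeight_pos x).ne',
          Complex.ofReal_one, one_mul]
    have h3 : ∫ x, (floorWeight x : ℂ) * hgm.toLp _ x = 0 := (integral_congr_ae h2).trans h0
    filter_upwards [h2] with x hx
    rw [hardyEmbed, h3, hx]; ring

/-! ### The transform on `BMO` -/

/-- Reversing the relation replaces `k` by `-k`. This is where `BMO` acquires `max (-k) 0` in place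
of `max k 0`. -/
theorem tsum_relSum_mul (k : ℤ) (n : ℕ) (z d : DyadicInterval → ℝ≥0∞) :
    ∑' I, relSum k n z I * d I = ∑' J, z J * relSum (-k) n d J := by
  unfold relSum
  simp_rw [← ENNReal.tsum_mul_right, ← ENNReal.tsum_mul_left]
  rw [ENNReal.tsum_comm]
  refine tsum_congr fun J => tsum_congr fun I => ?_
  by_cases h : J ∈ DyadicInterval.related k n I
  · rw [indicator_of_mem h, indicator_of_mem (DyadicInterval.mem_related_neg_iff.2 h)]
  · rw [indicator_of_notMem h, indicator_of_notMem (mt DyadicInterval.mem_related_neg_iff.1 h)]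
    simp

/-- By transposition the families act on the coefficients of the atom, where they preserve
domination by tents. The Carleson condition for the coefficients of `f` then bounds the pairing. -/
theorem IsWavelet.exists_tsum_transformCoeff_le {ψ : ℝ → ℂ} (hψ : IsWavelet ψ) : ∃ C : ℝ, 0 < C ∧
    ∀ (k : ℤ) (n : ℕ) (f : ℝ → ℂ), MemBMO f → ∀ a, IsHardyAtom a →
      ∑' I, ‖transformCoeff ψ k n f I‖ₑ * ‖∫ x, waveletFn ψ I x * a x‖ₑ ≤
        ENNReal.ofReal (C * transformRate (-k) n * (bmoENorm f).toReal) := by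
  obtain ⟨C₁, hC₁, hcarl⟩ := hψ.exists_carleson
  obtain ⟨C₂, hC₂, hatom⟩ := hψ.exists_tentBound_coeff
  refine ⟨C₁ * (C₂ * 2) * 40, by positivity, fun k n f hf a ha => ?_⟩
  set B := (bmoENorm f).toReal with hB
  -- The coefficient bound needs a mass strictly above the norm of the atom, which is at most `1`.
  -- The atom is conjugated because the pairing is bilinear while wavelet coefficients are
  -- sesquilinear.
  have h1 := hatom _ 2 (ha.conj.h1ENorm_le_one.trans_lt ENNReal.one_lt_two)
  have h2 := (h1.relSum (-k) n).tsum_mul_le (K := C₁ * B) (by positivity)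
    (hcarl f B hf.1 hf.oscBound)
  rw [← tsum_relSum_mul] at h2
  have e : ∀ I, ‖∫ x, waveletFn ψ I x * a x‖ₑ = ‖waveletCoeff ψ (fun x => conj (a x)) I‖ₑ :=
    fun I => by
      have : waveletCoeff ψ (fun x => conj (a x)) I = conj (∫ x, waveletFn ψ I x * a x) := by
        rw [waveletCoeff, ← integral_conj]
        refine integral_congr_ae (Eventually.of_forall fun x => ?_)
        simp only [map_mul]; ring
      rw [this, ← ofReal_norm, ← ofReal_norm, RCLike.norm_conj]
  simp_rw [e]
  refine (ENNReal.tsum_le_tsum fun I =>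
    mul_le_mul' (enorm_transformCoeff_le ψ f k n I) le_rfl).trans (h2.trans_eq ?_)
  rw [show C₁ * (C₂ * 2) * 40 * transformRate (-k) n * B =
    C₁ * B * (C₂ * 2 * (40 * transformRate (-k) n)) by ring,
    ENNReal.ofReal_mul (p := C₁ * B) (by positivity),
    ENNReal.ofReal_mul (p := C₂ * 2) (by positivity), ENNReal.ofReal_mul (p := C₂) hC₂.le,
    ENNReal.ofReal_ofNat]
  ring

section Pairing

variable {ψ : ℝ → ℂ} {t : DyadicInterval → ℂ} {R : ℝ}

/-- Series of wavelets that are bounded on atoms can be paired with functions in `H¹`. -/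
theorem IsWavelet.hasSum_pairing (hψ : IsWavelet ψ)
    (ht : ∀ a, IsHardyAtom a → ∑' I, ‖t I‖ₑ * ‖∫ x, waveletFn ψ I x * a x‖ₑ ≤ ENNReal.ofReal R)
    {g : ℝ → ℂ} {μ : ℕ → ℂ} {a : ℕ → ℝ → ℂ} (h : IsAtomicDecomposition g μ a) :
    HasSum (fun I => t I * ∫ x, waveletFn ψ I x * g x) (∑' I, t I * ∫ x, waveletFn ψ I x * g x) ∧
    HasSum (fun i => μ i * ∑' I, t I * ∫ x, waveletFn ψ I x * a i x)
      (∑' I, t I * ∫ x, waveletFn ψ I x * g x) ∧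
    ‖∑' I, t I * ∫ x, waveletFn ψ I x * g x‖ₑ ≤ ENNReal.ofReal R * ∑' i, ‖μ i‖ₑ := by
  obtain ⟨D, hD⟩ := hψ.exists_decay
  -- The double series over atoms and dyadic intervals converges absolutely. Summing it in both
  -- orders shows that the value does not depend on the decomposition.
  set F : ℕ × DyadicInterval → ℂ := fun p => μ p.1 * (t p.2 * ∫ x, waveletFn ψ p.2 x * a p.1 x)
    with hF
  have hle : ∑' p, ‖F p‖ₑ ≤ ENNReal.ofReal R * ∑' i, ‖μ i‖ₑ := by
    rw [ENNReal.tsum_prod', mul_comm, ← ENNReal.tsum_mul_right]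
    refine ENNReal.tsum_le_tsum fun i => ?_
    simp only [hF, enorm_mul]
    rw [ENNReal.tsum_mul_left]
    exact mul_le_mul' le_rfl (ht _ (h.1 i))
  have hfin : ∑' p, ‖F p‖ₑ ≠ ∞ := ne_top_of_le_ne_top (ENNReal.mul_ne_top ENNReal.ofReal_ne_top
    (summable_norm_iff_tsum_enorm_ne_top.1 h.2.1)) hle
  have hS : HasSum F (∑' p, F p) :=
    (summable_norm_iff_tsum_enorm_ne_top.2 hfin).of_norm.hasSum
  have hrow : ∀ i, HasSum (fun I => F (i, I)) (μ i * ∑' I, t I * ∫ x, waveletFn ψ I x * a i x) :=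
    fun i => by
      refine HasSum.mul_left _ (Summable.hasSum (Summable.of_norm ?_))
      refine summable_norm_iff_tsum_enorm_ne_top.2 (ne_top_of_le_ne_top
        (ENNReal.ofReal_ne_top (r := R)) ?_)
      simp_rw [enorm_mul]
      exact ht _ (h.1 i)
  have hcol : ∀ I, HasSum (fun i => F (i, I)) (t I * ∫ x, waveletFn ψ I x * g x) := fun I => by
    obtain ⟨B, hB⟩ := hD.exists_bound_waveletFn I
    have h1 := (hasSum_integral_mul_atoms (hD.continuous_waveletFn I) hB h).mul_left (t I)
    simp_rw [mul_comm _ (waveletFn ψ I _), mul_left_comm (t I)] at h1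
    exact h1
  have h1 := hS.prod_fiberwise hrow
  have h2 := ((Equiv.prodComm DyadicInterval ℕ).hasSum_iff.2 hS).prod_fiberwise hcol
  rw [h2.tsum_eq]
  exact ⟨h2, h1, enorm_tsum_le_tsum_enorm.trans hle⟩

/-- The wavelet series is a functional of `g` itself, and absolute convergence makes it additive on
`H¹` and bounded there, so the representation theorem applies. -/
theorem IsWavelet.exists_integral_mul_atom_eq (hψ : IsWavelet ψ) (hR : 0 ≤ R)
    (ht : ∀ a, IsHardyAtom a → ∑' I, ‖t I‖ₑ * ‖∫ x, waveletFn ψ I x * a x‖ₑ ≤ ENNReal.ofReal R) :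
    ∃ h : ℝ → ℂ, LocallyIntegrable h ∧ ∀ a, IsHardyAtom a →
      ∫ x, h x * a x = ∑' I, t I * ∫ x, waveletFn ψ I x * a x := by
  obtain ⟨D, hD⟩ := hψ.exists_decay
  have hint : ∀ g, MemH1 g → ∀ I, Integrable fun x => waveletFn ψ I x * g x := fun g hg I => by
    obtain ⟨B, hB⟩ := hD.exists_bound_waveletFn I
    exact hg.integrable.bdd_mul (hD.continuous_waveletFn I).aestronglyMeasurable
      (Eventually.of_forall hB)
  refine exists_locallyIntegrable_of_functional
    (Λ := fun g => ∑' I, t I * ∫ x, waveletFn ψ I x * g x) hR ?_ ?_ ?_ ?_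
  · intro g g' hg hg'
    obtain ⟨μ, a, h1, -⟩ := exists_atomicDecomposition_lt hg
    obtain ⟨μ', a', h2, -⟩ := exists_atomicDecomposition_lt hg'
    rw [← ((hψ.hasSum_pairing ht h1).1.add (hψ.hasSum_pairing ht h2).1).tsum_eq]
    refine tsum_congr fun I => ?_
    simp_rw [mul_add]
    rw [integral_add (hint g hg I) (hint g' hg' I), mul_add]
  · intro z g
    simp only
    rw [← tsum_mul_left]
    refine tsum_congr fun I => ?_
    simp_rw [mul_left_comm _ z]
    rw [integral_const_mul]; ring
  · intro g g' h
    refine tsum_congr fun I => ?_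
    congr 1
    exact integral_congr_ae (h.mono fun x hx => by simp only [hx])
  · intro g hg
    refine ENNReal.le_const_mul_of_forall_lt ENNReal.ofReal_ne_top hg.ne fun M hM => ?_
    obtain ⟨μ, a, h1, h2⟩ := exists_atomicDecomposition_lt hM
    exact (hψ.hasSum_pairing ht h1).2.2.trans (mul_le_mul' le_rfl h2.le)

end Pairing

/-- `T_{k,n}` is bounded on `BMO`. -/
theorem IsWavelet.exists_transformBMO {ψ : ℝ → ℂ} (hψ : IsWavelet ψ) : ∃ C : ℝ, 0 < C ∧
    ∀ (k : ℤ) (n : ℕ) (f : ℝ → ℂ), MemBMO f →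
      (∃ h, IsTransformBMO ψ k n f h) ∧ ∀ h, IsTransformBMO ψ k n f h →
        bmoENorm h ≤ ENNReal.ofReal (C * transformRate (-k) n) * bmoENorm f := by
  obtain ⟨C, hC, hsum⟩ := hψ.exists_tsum_transformCoeff_le
  refine ⟨2 * C, by positivity, fun k n f hf => ?_⟩
  have hrate := transformRate_nonneg (-k) n
  set R := C * transformRate (-k) n * (bmoENorm f).toReal with hRdef
  have hR : 0 ≤ R := by positivity
  have ht := hsum k n f hf
  have hbd : ∀ a, IsHardyAtom a →
      ‖∑' I, transformCoeff ψ k n f I * ∫ x, waveletFn ψ I x * a x‖ ≤ R := fun a ha => by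
    have h1 : ‖∑' I, transformCoeff ψ k n f I * ∫ x, waveletFn ψ I x * a x‖ₑ ≤
        ENNReal.ofReal R := by
      refine enorm_tsum_le_tsum_enorm.trans ?_
      simp_rw [enorm_mul]
      exact ht a ha
    rwa [← ofReal_norm, ENNReal.ofReal_le_ofReal_iff hR] at h1
  refine ⟨?_, fun h hh => ?_⟩
  · obtain ⟨h, hloc, hh⟩ := hψ.exists_integral_mul_atom_eq hR ht
    have hbmo := bmoENorm_le_of_atoms hloc hR fun a ha => by rw [hh a ha]; exact hbd a ha
    refine ⟨h, ⟨hloc, hbmo.trans_lt ENNReal.ofReal_lt_top⟩, fun g hg => ?_⟩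
    obtain ⟨μ, a, h1, -⟩ := exists_atomicDecomposition_lt hg
    refine ⟨_, fun μ' a' h2 => ?_, (hψ.hasSum_pairing ht h1).1⟩
    simp_rw [fun i => hh _ (h2.1 i)]
    exact (hψ.hasSum_pairing ht h2).2.1
  -- Any weak* sum is tested on an atom through the decomposition consisting of that atom alone.
  -- This identifies the integral with the series, so the bound holds for every representative.
  · have h1 := bmoENorm_le_of_atoms hh.1.1 hR fun a ha => by
      obtain ⟨v, h2, h3⟩ := hh.2 a (ha.h1ENorm_le_one.trans_lt ENNReal.one_lt_top)
      have h4 := (h2 _ _ ha.isAtomicDecomposition).unique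
        (hasSum_single (f := fun i : ℕ => (if i = 0 then (1 : ℂ) else 0) * ∫ x, h x * a x) 0
          fun i hi => by rw [if_neg hi, zero_mul])
      rw [if_pos rfl, one_mul] at h4
      rw [← h4, ← h3.tsum_eq]
      exact hbd a ha
    refine h1.trans (le_of_eq ?_)
    rw [hRdef, ← mul_assoc, ← mul_assoc, ENNReal.ofReal_mul (by positivity),
      ENNReal.ofReal_toReal hf.2.ne]

theorem proposition3p1 (ψ : ℝ → ℂ) (hψ : IsWavelet ψ) :
    ∃ C : ℝ, 0 < C ∧ ∀ (k : ℤ) (n : ℕ), 1 ≤ n →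
      (∀ f : ℝ → ℂ, MemBMO f →
        (∃ h, IsTransformBMO ψ k n f h) ∧
        ∀ h, IsTransformBMO ψ k n f h →
          bmoENorm h ≤ ENNReal.ofReal (C * (2 : ℝ) ^ (|(k : ℝ)| / 2) *
            (Real.log (n + 1) + max (-(k : ℝ)) 0 + 1) ^ (1 / 2 : ℝ)) * bmoENorm f) ∧
      (∀ f : ℝ → ℂ, MemH1 f →
        (∃ h, IsTransformH1 ψ k n f h) ∧
        ∀ h, IsTransformH1 ψ k n f h →
          h1ENorm h ≤ ENNReal.ofReal (C * (2 : ℝ) ^ (|(k : ℝ)| / 2) *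
            (Real.log (n + 1) + max (k : ℝ) 0 + 1) ^ (1 / 2 : ℝ)) * h1ENorm f) := by

  obtain ⟨C₁, hC₁, h1⟩ := hψ.exists_transformBMO
  obtain ⟨C₂, hC₂, h2⟩ := hψ.exists_transformH1
  refine ⟨C₁ + C₂, by positivity, fun k n _ => ⟨fun f hf => ⟨(h1 k n f hf).1, fun h hh => ?_⟩,
    fun f hf => ⟨(h2 k n f hf).1, fun h hh => ?_⟩⟩⟩
  · refine ((h1 k n f hf).2 h hh).trans (mul_le_mul' (ENNReal.ofReal_le_ofReal ?_) le_rfl)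
    have h3 := transformRate_nonneg (-k) n
    unfold transformRate at h3 ⊢
    push_cast at h3 ⊢
    rw [abs_neg] at h3 ⊢
    rw [mul_assoc (C₁ + C₂)]
    exact mul_le_mul_of_nonneg_right (by linarith) h3
  · refine ((h2 k n f hf).2 h hh).trans (mul_le_mul' (ENNReal.ofReal_le_ofReal ?_) le_rfl)
    have h3 := transformRate_nonneg k n
    unfold transformRate at h3 ⊢
    rw [mul_assoc (C₁ + C₂)]
    exact mul_le_mul_of_nonneg_right (by linarith) h3
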